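/- \textbf{Layered Modal ML (LMML).} Terms are considered up to renaming of bound variables; typing contexts are finite lists of declarations, and the local context $\Gamma$ of a contextual type $\Box(\Gamma\vdash T)$ binds its variables. \emph{Types} are $T::=\mathbf{Unit}\mid\mathbf{Int}\mid T_1\to T_2\mid\mathbf{ref}\,T\mid\Box(\Gamma\vdash T)$. At layer $0$ types contain no $\Box$; at layer $1$, types may contain $\Box(\Gamma\vdash T)$ with $\Gamma,T$ of layer $0$. A local context $\Gamma$ declares $x:T$; a global context $\Psi$ declares $u:(\Gamma\vdash T)$ with $\Gamma,T$ of layer $0$; a store context $\Sigma$ is a finite partial map of locations to types, written $\ell:\mathbf{ref}\,T$, with $T$ of layer at most $1$. \emph{Terms} are $M::=()\mid \hat n\mid x\mid u^{\delta}\mid \ell\mid\lambda x.M\mid M_1M_2\mid\mathbf{rec}\,y(x).M\mid M_1\oplus M_2\mid\mathbf{if}\,M_1\,\mathbf{then}\,M_2\,\mathbf{else}\,M_3\mid\mathbf{ref}\,M\mid\,!M\mid M_1:=M_2\mid\mathbf{box}\,M\mid\mathbf{letbox}\,u=M_1\,\mathbf{in}\,M_2$, with $n\in\mathbb N$, $\oplus\in\{+,-,*,<,=\}$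 (truncated subtraction; comparisons return $1$ or $0$), and $\delta$ a finite map from local variables to values. \emph{Values} are $()$, $\hat n$, $\ell$, $x$, $\lambda x.M$, $\mathbf{rec}\,y(x).M$, $\mathbf{box}\,M$; $\mathbf{box}$ binds all local variables of its body. \emph{Typing} $\Sigma;\Psi;\Gamma\vdash_i M:T$ ($i\in\{0,1\}$) uses the usual rules of ML with references, for contexts $\Psi$, $\Gamma$, $\Sigma$ that are well formed ($\Gamma$ at layer $i$); a location $\ell:\mathbf{ref}\,T$ may be used at layer $i$ if $T$ is a type of layer $i$. In addition: $\Sigma;\Psi;\Gamma\vdash_i u^\delta:T$ if $u:(\Gamma'\vdash T)\in\Psi$ and $\Sigma;\Psi;\Gamma\vdash_i\delta:\Gamma'$ (that is, $\mathrm{dom}\,\delta=\mathrm{dom}\,\Gamma'$ and $\Sigma;\Psi;\Gamma\vdash_i\delta(x):U$ for every $x:U\in\Gamma'$); $\Sigma;\Psi;\Gamma\vdash_1\mathbf{box}\,M:\Box(\Gamma'\vdash T)$ if $\Sigma;\Psi;\Gamma'\vdash_0M:T$; and $\Sigma;\Psi;\Gamma\vdash_1\mathbf{letbox}\,u=M_1\,\mathbf{in}\,M_2:T'$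 if $\Sigma;\Psi;\Gamma\vdash_1M_1:\Box(\Gamma'\vdash T)$ and $\Sigma;\Psi,u:(\Gamma'\vdash T);\Gamma\vdash_1M_2:T'$. A global substitution satisfies $\Sigma;\Psi\vdash\sigma:\Psi'$ if $\mathrm{dom}\,\sigma=\mathrm{dom}\,\Psi'$ and $\Sigma;\Psi;\Gamma\vdash_0\sigma(u):T$ for every $u:(\Gamma\vdash T)\in\Psi'$. A heap $h$ is a finite partial map from locations to values; $\Sigma;\Psi;\Gamma\vdash h:\mathbf{heap}$ means $\mathrm{dom}\,h=\mathrm{dom}\,\Sigma$ and $\Sigma;\Psi;\Gamma\vdash_1h(\ell):T$ for every $\ell:\mathbf{ref}\,T\in\Sigma$. \emph{Substitution} is capture-avoiding; $(\mathbf{box}\,M)[\delta]=\mathbf{box}\,M$, $(\mathbf{box}\,M)[\sigma]=\mathbf{box}\,(M[\sigma])$, $u^{\delta}[\delta']=u^{\delta[\delta']}$ and $u^\delta[\sigma]=\sigma(u)[\delta[\sigma]]$. \emph{Reduction} $(M,h)\to(M',h')$ is the standard left-to-right call-by-value reduction for $\lambda$, $\mathbf{rec}$, arithmetic, conditionals (nonzero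 is true) and references (allocation at any fresh location), together with $(\mathbf{letbox}\,u=\mathbf{box}\,M_1\,\mathbf{in}\,M_2,h)\to(M_2[M_1/u],h)$, closed under the evaluation contexts $K::=\bullet\mid KM\mid VK\mid K\oplus M\mid V\oplus K\mid\mathbf{if}\,K\,\mathbf{then}\,M_1\,\mathbf{else}\,M_2\mid\mathbf{ref}\,K\mid\,!K\mid K:=M\mid V:=K\mid\mathbf{letbox}\,u=K\,\mathbf{in}\,M$. Write $(M,h)\Downarrow$ if $(M,h)\to^*(V,h')$ for some value $V$ and heap $h'$. \emph{Contexts} $C$ are terms with one hole $\bullet$, possibly under binders and under $\mathbf{box}$, but not inside an explicit substitution. The judgement $\Sigma\vdash C:(\Psi';\Gamma';i';T')\to(\Psi;\Gamma;i;T)$ is given by the typing rules of terms together with $\Sigma\vdash\bullet:(\Psi';\Gamma';i';T)\to(\Psi;\Gamma;i;T)$ for $\Psi'\subseteq\Psi$, $\Gamma'\subseteq\Gamma$, $i'\le i$ (with $\Sigma$, $\Psi$ and $\Gamma$ well formed, $\Gamma$ at layer $i$). For $\Sigma;\Psi;\Gamma\vdash_iM_1,M_2:T$ define: \begin{itemize}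 \item $M_1\lesssim M_2$ if for all $\Sigma'\supseteq\Sigma$, $i'$, $T'$, every context $\Sigma'\vdash C:(\Psi;\Gamma;i;T)\to(\cdot;\cdot;i';T')$ and every heap $\Sigma';\cdot;\cdot\vdash h:\mathbf{heap}$, $(C[M_1],h)\Downarrow$ implies $(C[M_2],h)\Downarrow$. \item $M_1\lesssim^{\mathrm{CIU}}M_2$ if for all $\Sigma'\supseteq\Sigma$, $i'$, $T'$, every global substitution $\Sigma';\cdot\vdash\sigma:\Psi$, every local substitution $\Sigma';\cdot;\cdot\vdash_i\delta:\Gamma$ (of values), every evaluation context $\Sigma'\vdash K:(\cdot;\cdot;i;T)\to(\cdot;\cdot;i';T')$ and every heap $\Sigma';\cdot;\cdot\vdash h:\mathbf{heap}$, $(K[M_1[\sigma][\delta]],h)\Downarrow$ implies $(K[M_2[\sigma][\delta]],h)\Downarrow$. \end{itemize} \textbf{Theorem (CIU).} Let $i\in\{0,1\}$ and let $\Sigma;\Psi;\Gamma\vdash_iM_1,M_2:T$. Then $M_1\lesssim M_2$ if and only if $M_1\lesssim^{\mathrm{CIU}}M_2$. -/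

import Mathlib

/-! Layered Modal ML (LMML). Local and global variables are de Bruijn indices, so terms are
syntactically equal exactly when they agree up to renaming of variables. The variables of the
context `Γ` of a contextual type `□(Γ ⊢ T)` are the positions of the list `Γ`. -/

namespace LMML

/-! ### Types and typing contexts -/

/-- The two layers of the language, `zero` below `one`. -/
inductive Layer : Type
  | zero
  | one

instance : LE Layer := ⟨fun i j => i = Layer.zero ∨ j = Layer.one⟩

inductive Ty : Type
  | unit : Ty
  | int : Ty
  | arrow : Ty → Ty → Ty
  | ref : Ty → Ty
  | box : List Ty → Ty → Ty

/-- Local variable contexts; the variable with index `k` is declared in position `k`. -/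
abbrev LCtx : Type := List Ty

/-- Global variable contexts; an entry `(Γ, T)` declares a variable `u : (Γ ⊢ T)`. -/
abbrev GCtx : Type := List (LCtx × Ty)

/-- Store contexts: a finite partial map from locations; `ℓ ↦ T` stands for `ℓ : ref T`. -/
abbrev SCtx : Type := Finmap (fun _ : ℕ => Ty)

/-- `TyWF i T` is the judgement `⊢ᵢ T : typ`. -/
inductive TyWF : Layer → Ty → Prop
  | unit {i : Layer} : TyWF i Ty.unit
  | int {i : Layer} : TyWF i Ty.int
  | arrow {i : Layer} {T₁ T₂ : Ty} : TyWF i T₁ → TyWF i T₂ → TyWF i (Ty.arrow T₁ T₂)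
  | ref {i : Layer} {T : Ty} : TyWF i T → TyWF i (Ty.ref T)
  | box {Γ : LCtx} {T : Ty} : (∀ U ∈ Γ, TyWF Layer.zero U) → TyWF Layer.zero T →
      TyWF Layer.one (Ty.box Γ T)

/-- `⊢ᵢ Γ : lctx`. -/
def LCtxWF (i : Layer) (Γ : LCtx) : Prop := ∀ T ∈ Γ, TyWF i T

/-- `⊢ Ψ : gctx`. -/
def GCtxWF (Ψ : GCtx) : Prop := ∀ p ∈ Ψ, LCtxWF Layer.zero p.1 ∧ TyWF Layer.zero p.2

/-- `⊢ Σ : sctx`. The store is shared by both layers, so its types may be of layer one; the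
typing rule for locations restricts which of them can be used at layer zero. -/
def SCtxWF (S : SCtx) : Prop := ∀ (l : ℕ) (T : Ty), S.lookup l = some T → TyWF Layer.one T

/-- `Σ ⊆ Σ'`. -/
def SCtxSub (S S' : SCtx) : Prop := ∀ (l : ℕ) (T : Ty), S.lookup l = some T → S'.lookup l = some T

/-! ### Terms -/

inductive ArithOp : Type
  | add
  | sub
  | mul
  | lt
  | eq

/-- The arithmetic operations on numerals; comparisons return `1` or `0`. -/
def ArithOp.eval : ArithOp → ℕ → ℕ → ℕ
  | add, m, n => m + n
  | sub, m, n => m - n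
  | mul, m, n => m * n
  | lt, m, n => if m < n then 1 else 0
  | eq, m, n => if m = n then 1 else 0

inductive Tm : Type
  | unit : Tm
  | num : ℕ → Tm
  | var : ℕ → Tm
  /-- `gvar u n δ` is the global variable `u` with the explicit local substitution `δ`, which
  has one entry for each of the `n` local variables in the context of `u`. -/
  | gvar : ℕ → (n : ℕ) → (Fin n → Tm) → Tm
  | loc : ℕ → Tm
  /-- `lam M` is `λ x. M`, with `x` the index `0` in `M`. -/
  | lam : Tm → Tm
  | app : Tm → Tm → Tm
  /-- `recfn M` is `rec y(x). M`, with `x` the index `0` and `y` the index `1` in `M`. -/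
  | recfn : Tm → Tm
  | arith : ArithOp → Tm → Tm → Tm
  | ite : Tm → Tm → Tm → Tm
  | ref : Tm → Tm
  | deref : Tm → Tm
  | assign : Tm → Tm → Tm
  /-- `box M` binds all local variables of `M`. -/
  | box : Tm → Tm
  /-- `letbox M₁ M₂` is `letbox u = M₁ in M₂`, with `u` the global index `0` in `M₂`. -/
  | letbox : Tm → Tm → Tm

namespace Tm

inductive IsValue : Tm → Prop
  | unit : IsValue unit
  | num (n : ℕ) : IsValue (num n)
  | loc (l : ℕ) : IsValue (loc l)
  | var (x : ℕ) : IsValue (var x)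
  | lam (M : Tm) : IsValue (lam M)
  | recfn (M : Tm) : IsValue (recfn M)
  | box (M : Tm) : IsValue (box M)

/-- A renaming extended under one binder. -/
def upRen (ρ : ℕ → ℕ) : ℕ → ℕ
  | 0 => 0
  | k + 1 => ρ k + 1

/-- Renaming of the free local variables by `ρ` and of the free global variables by `ξ`. -/
def rename : (ℕ → ℕ) → (ℕ → ℕ) → Tm → Tm
  | _, _, unit => unit
  | _, _, num n => num n
  | ρ, _, var x => var (ρ x)
  | ρ, ξ, gvar u n δ => gvar (ξ u) n (fun k => rename ρ ξ (δ k))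
  | _, _, loc l => loc l
  | ρ, ξ, lam M => lam (rename (upRen ρ) ξ M)
  | ρ, ξ, app M₁ M₂ => app (rename ρ ξ M₁) (rename ρ ξ M₂)
  | ρ, ξ, recfn M => recfn (rename (upRen (upRen ρ)) ξ M)
  | ρ, ξ, arith o M₁ M₂ => arith o (rename ρ ξ M₁) (rename ρ ξ M₂)
  | ρ, ξ, ite M₁ M₂ M₃ => ite (rename ρ ξ M₁) (rename ρ ξ M₂) (rename ρ ξ M₃)
  | ρ, ξ, ref M => ref (rename ρ ξ M)
  | ρ, ξ, deref M => deref (rename ρ ξ M)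
  | ρ, ξ, assign M₁ M₂ => assign (rename ρ ξ M₁) (rename ρ ξ M₂)
  | _, ξ, box M => box (rename id ξ M)
  | ρ, ξ, letbox M₁ M₂ => letbox (rename ρ ξ M₁) (rename ρ (upRen ξ) M₂)

/-- `scons V τ` sends the local variable `0` to `V` and `k + 1` to `τ k`. -/
def scons (V : Tm) (τ : ℕ → Tm) : ℕ → Tm
  | 0 => V
  | k + 1 => τ k

/-- A local substitution extended under a binder for a local variable. -/
def upL (τ : ℕ → Tm) : ℕ → Tm := scons (var 0) (fun k => rename Nat.succ id (τ k))

/-- A local substitution moved under a binder for a global variable. -/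
def upG (τ : ℕ → Tm) : ℕ → Tm := fun k => rename id Nat.succ (τ k)

/-- Capture-avoiding application of a local substitution. -/
def lsubst : (ℕ → Tm) → Tm → Tm
  | _, unit => unit
  | _, num n => num n
  | τ, var x => τ x
  | τ, gvar u n δ => gvar u n (fun k => lsubst τ (δ k))
  | _, loc l => loc l
  | τ, lam M => lam (lsubst (upL τ) M)
  | τ, app M₁ M₂ => app (lsubst τ M₁) (lsubst τ M₂)
  | τ, recfn M => recfn (lsubst (upL (upL τ)) M)
  | τ, arith o M₁ M₂ => arith o (lsubst τ M₁) (lsubst τ M₂)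
  | τ, ite M₁ M₂ M₃ => ite (lsubst τ M₁) (lsubst τ M₂) (lsubst τ M₃)
  | τ, ref M => ref (lsubst τ M)
  | τ, deref M => deref (lsubst τ M)
  | τ, assign M₁ M₂ => assign (lsubst τ M₁) (lsubst τ M₂)
  | _, box M => box M
  | τ, letbox M₁ M₂ => letbox (lsubst τ M₁) (lsubst (upG τ) M₂)

/-- The total map given by a local substitution `δ` for the variables `0, …, n - 1`. -/
def ofFin {n : ℕ} (δ : Fin n → Tm) : ℕ → Tm :=
  fun x => if h : x < n then δ ⟨x, h⟩ else var (x - n)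

/-- Total global substitutions: `Sum.inl v` renames a global variable to `v`, and `Sum.inr N`
replaces it by `N`, a term whose local indices refer to the local context declared for that
global variable. -/
abbrev GSub : Type := ℕ → ℕ ⊕ Tm

/-- `gcons N σ` sends the global variable `0` to the term `N` and `k + 1` to `σ k`. -/
def gcons (N : Tm) (σ : GSub) : GSub
  | 0 => Sum.inr N
  | k + 1 => σ k

/-- A global substitution extended under a binder for a global variable. -/
def upGSub (σ : GSub) : GSub
  | 0 => Sum.inl 0
  | k + 1 => Sum.map Nat.succ (rename id Nat.succ) (σ k)

/-- Capture-avoiding application of a global substitution; `u^δ` becomes `σ(u)[δ[σ]]`. -/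
def gsubst : GSub → Tm → Tm
  | _, unit => unit
  | _, num n => num n
  | _, var x => var x
  | σ, gvar u n δ =>
      match σ u with
      | Sum.inl v => gvar v n (fun k => gsubst σ (δ k))
      | Sum.inr N => lsubst (ofFin fun k => gsubst σ (δ k)) N
  | _, loc l => loc l
  | σ, lam M => lam (gsubst σ M)
  | σ, app M₁ M₂ => app (gsubst σ M₁) (gsubst σ M₂)
  | σ, recfn M => recfn (gsubst σ M)
  | σ, arith o M₁ M₂ => arith o (gsubst σ M₁) (gsubst σ M₂)
  | σ, ite M₁ M₂ M₃ => ite (gsubst σ M₁) (gsubst σ M₂) (gsubst σ M₃)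
  | σ, ref M => ref (gsubst σ M)
  | σ, deref M => deref (gsubst σ M)
  | σ, assign M₁ M₂ => assign (gsubst σ M₁) (gsubst σ M₂)
  | σ, box M => box (gsubst σ M)
  | σ, letbox M₁ M₂ => letbox (gsubst σ M₁) (gsubst (upGSub σ) M₂)

/-- The total map given by a global substitution for the variables `0, …, m - 1`. -/
def gofFin {m : ℕ} (σ : Fin m → Tm) : GSub :=
  fun u => if h : u < m then Sum.inr (σ ⟨u, h⟩) else Sum.inl (u - m)

end Tm

/-- `HasTy S Ψ Γ i M T` is the judgement `S; Ψ; Γ ⊢ᵢ M : T`. -/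
inductive HasTy (S : SCtx) : GCtx → LCtx → Layer → Tm → Ty → Prop
  | unit {Ψ : GCtx} {Γ : LCtx} {i : Layer} :
      SCtxWF S → GCtxWF Ψ → LCtxWF i Γ → HasTy S Ψ Γ i Tm.unit Ty.unit
  | num {Ψ : GCtx} {Γ : LCtx} {i : Layer} (n : ℕ) :
      SCtxWF S → GCtxWF Ψ → LCtxWF i Γ → HasTy S Ψ Γ i (Tm.num n) Ty.int
  | var {Ψ : GCtx} {Γ : LCtx} {i : Layer} {x : ℕ} {T : Ty} :
      SCtxWF S → GCtxWF Ψ → LCtxWF i Γ → Γ[x]? = some T → HasTy S Ψ Γ i (Tm.var x) T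
  | gvar {Ψ : GCtx} {Γ Γ' : LCtx} {i : Layer} {u n : ℕ} {δ : Fin n → Tm} {T : Ty} :
      SCtxWF S → GCtxWF Ψ → LCtxWF i Γ →
      Γ'.length = n → (∀ k, (δ k).IsValue) →
      (∀ (k : Fin n) (U : Ty), Γ'[(k : ℕ)]? = some U → HasTy S Ψ Γ i (δ k) U) →
      Ψ[u]? = some (Γ', T) → HasTy S Ψ Γ i (Tm.gvar u n δ) T
  | loc {Ψ : GCtx} {Γ : LCtx} {i : Layer} {l : ℕ} {T : Ty} :
      SCtxWF S → GCtxWF Ψ → LCtxWF i Γ → S.lookup l = some T → TyWF i T →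
      HasTy S Ψ Γ i (Tm.loc l) (Ty.ref T)
  | lam {Ψ : GCtx} {Γ : LCtx} {i : Layer} {M : Tm} {T₁ T₂ : Ty} :
      HasTy S Ψ (T₁ :: Γ) i M T₂ → HasTy S Ψ Γ i (Tm.lam M) (Ty.arrow T₁ T₂)
  | app {Ψ : GCtx} {Γ : LCtx} {i : Layer} {M₁ M₂ : Tm} {T₁ T₂ : Ty} :
      HasTy S Ψ Γ i M₁ (Ty.arrow T₁ T₂) → HasTy S Ψ Γ i M₂ T₁ → HasTy S Ψ Γ i (Tm.app M₁ M₂) T₂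
  | recfn {Ψ : GCtx} {Γ : LCtx} {i : Layer} {M : Tm} {T₁ T₂ : Ty} :
      HasTy S Ψ (T₁ :: Ty.arrow T₁ T₂ :: Γ) i M T₂ →
      HasTy S Ψ Γ i (Tm.recfn M) (Ty.arrow T₁ T₂)
  | arith {Ψ : GCtx} {Γ : LCtx} {i : Layer} (o : ArithOp) {M₁ M₂ : Tm} :
      HasTy S Ψ Γ i M₁ Ty.int → HasTy S Ψ Γ i M₂ Ty.int → HasTy S Ψ Γ i (Tm.arith o M₁ M₂) Ty.int
  | ite {Ψ : GCtx} {Γ : LCtx} {i : Layer} {M₁ M₂ M₃ : Tm} {T : Ty} :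
      HasTy S Ψ Γ i M₁ Ty.int → HasTy S Ψ Γ i M₂ T → HasTy S Ψ Γ i M₃ T →
      HasTy S Ψ Γ i (Tm.ite M₁ M₂ M₃) T
  | ref {Ψ : GCtx} {Γ : LCtx} {i : Layer} {M : Tm} {T : Ty} :
      HasTy S Ψ Γ i M T → HasTy S Ψ Γ i (Tm.ref M) (Ty.ref T)
  | deref {Ψ : GCtx} {Γ : LCtx} {i : Layer} {M : Tm} {T : Ty} :
      HasTy S Ψ Γ i M (Ty.ref T) → HasTy S Ψ Γ i (Tm.deref M) T
  | assign {Ψ : GCtx} {Γ : LCtx} {i : Layer} {M₁ M₂ : Tm} {T : Ty} :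
      HasTy S Ψ Γ i M₁ (Ty.ref T) → HasTy S Ψ Γ i M₂ T →
      HasTy S Ψ Γ i (Tm.assign M₁ M₂) Ty.unit
  | box {Ψ : GCtx} {Γ Γ' : LCtx} {M : Tm} {T : Ty} :
      LCtxWF Layer.one Γ → HasTy S Ψ Γ' Layer.zero M T →
      HasTy S Ψ Γ Layer.one (Tm.box M) (Ty.box Γ' T)
  | letbox {Ψ : GCtx} {Γ Γ' : LCtx} {M₁ M₂ : Tm} {T T' : Ty} :
      HasTy S Ψ Γ Layer.one M₁ (Ty.box Γ' T) → HasTy S ((Γ', T) :: Ψ) Γ Layer.one M₂ T' →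
      HasTy S Ψ Γ Layer.one (Tm.letbox M₁ M₂) T'

/-- `S; Ψ; Γ ⊢ᵢ δ : Γ'` for a local substitution `δ`, whose entries are values. -/
def LSubstHasTy (S : SCtx) (Ψ : GCtx) (Γ : LCtx) (i : Layer) {n : ℕ} (δ : Fin n → Tm)
    (Γ' : LCtx) : Prop :=
  Γ'.length = n ∧ (∀ k, (δ k).IsValue) ∧
    ∀ (k : Fin n) (U : Ty), Γ'[(k : ℕ)]? = some U → HasTy S Ψ Γ i (δ k) U

/-- `S; Ψ ⊢ σ : Ψ'` for a global substitution `σ`, whose entries are terms of layer zero in the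
local contexts declared by `Ψ'`. -/
def GSubstHasTy (S : SCtx) (Ψ : GCtx) {m : ℕ} (σ : Fin m → Tm) (Ψ' : GCtx) : Prop :=
  Ψ'.length = m ∧
    ∀ (u : Fin m) (Γ : LCtx) (T : Ty), Ψ'[(u : ℕ)]? = some (Γ, T) →
      HasTy S Ψ Γ Layer.zero (σ u) T

/-! ### Heaps, evaluation contexts and reduction -/

abbrev Heap : Type := Finmap (fun _ : ℕ => Tm)

/-- `S; Ψ; Γ ⊢ h : heap`. Layer one is the more permissive layer. -/
def HeapHasTy (S : SCtx) (Ψ : GCtx) (Γ : LCtx) (h : Heap) : Prop :=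
  (∀ l : ℕ, l ∈ S ↔ l ∈ h) ∧
    ∀ (l : ℕ) (T : Ty) (V : Tm), S.lookup l = some T → h.lookup l = some V →
      V.IsValue ∧ HasTy S Ψ Γ Layer.one V T

/-- Evaluation contexts (call-by-value, left to right). -/
inductive ECtx : Type
  | hole : ECtx
  | appL : ECtx → Tm → ECtx
  | appR : (V : Tm) → V.IsValue → ECtx → ECtx
  | arithL : ArithOp → ECtx → Tm → ECtx
  | arithR : ArithOp → (V : Tm) → V.IsValue → ECtx → ECtx
  | ite : ECtx → Tm → Tm → ECtx
  | ref : ECtx → ECtx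
  | deref : ECtx → ECtx
  | assignL : ECtx → Tm → ECtx
  | assignR : (V : Tm) → V.IsValue → ECtx → ECtx
  | letbox : ECtx → Tm → ECtx

/-- `K.fill M` is `K[M]`. -/
def ECtx.fill : ECtx → Tm → Tm
  | hole, M => M
  | appL K N, M => Tm.app (K.fill M) N
  | appR V _ K, M => Tm.app V (K.fill M)
  | arithL o K N, M => Tm.arith o (K.fill M) N
  | arithR o V _ K, M => Tm.arith o V (K.fill M)
  | ite K N₁ N₂, M => Tm.ite (K.fill M) N₁ N₂
  | ref K, M => Tm.ref (K.fill M)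
  | deref K, M => Tm.deref (K.fill M)
  | assignL K N, M => Tm.assign (K.fill M) N
  | assignR V _ K, M => Tm.assign V (K.fill M)
  | letbox K N, M => Tm.letbox (K.fill M) N

/-- The reduction relation `(M, h) → (M', h')`. -/
inductive Step : Tm × Heap → Tm × Heap → Prop
  | beta {M V : Tm} {h : Heap} : V.IsValue →
      Step (Tm.app (Tm.lam M) V, h) (M.lsubst (Tm.scons V Tm.var), h)
  | arith (o : ArithOp) (m n : ℕ) {h : Heap} :
      Step (Tm.arith o (Tm.num m) (Tm.num n), h) (Tm.num (o.eval m n), h)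
  | iteTrue {n : ℕ} {M₁ M₂ : Tm} {h : Heap} : n ≠ 0 →
      Step (Tm.ite (Tm.num n) M₁ M₂, h) (M₁, h)
  | iteFalse {M₁ M₂ : Tm} {h : Heap} : Step (Tm.ite (Tm.num 0) M₁ M₂, h) (M₂, h)
  | ref {V : Tm} {h : Heap} {l : ℕ} : V.IsValue → l ∉ h →
      Step (Tm.ref V, h) (Tm.loc l, h.insert l V)
  | deref {l : ℕ} {V : Tm} {h : Heap} : h.lookup l = some V →
      Step (Tm.deref (Tm.loc l), h) (V, h)
  | assign {l : ℕ} {V : Tm} {h : Heap} : V.IsValue → l ∈ h →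
      Step (Tm.assign (Tm.loc l) V, h) (Tm.unit, h.insert l V)
  | recfn {M V : Tm} {h : Heap} : V.IsValue →
      Step (Tm.app (Tm.recfn M) V, h)
        (M.lsubst (Tm.scons V (Tm.scons (Tm.recfn M) Tm.var)), h)
  | letbox {M₁ M₂ : Tm} {h : Heap} :
      Step (Tm.letbox (Tm.box M₁) M₂, h) (M₂.gsubst (Tm.gcons M₁ Sum.inl), h)
  | ktx (K : ECtx) {M₁ M₂ : Tm} {h₁ h₂ : Heap} : Step (M₁, h₁) (M₂, h₂) →
      Step (K.fill M₁, h₁) (K.fill M₂, h₂)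

/-- `(M, h) ⇓`: some reduction sequence from `(M, h)` reaches a value. -/
def Converges (M : Tm) (h : Heap) : Prop :=
  ∃ (V : Tm) (h' : Heap), V.IsValue ∧ Relation.ReflTransGen Step (M, h) (V, h')

/-! ### Contexts -/

/-- Term contexts. Filling the hole may capture variables. The hole carries the
inclusion of the variables of the plugged term into those in scope at the hole. -/
inductive Ctx : Type
  | hole : (ℕ → ℕ) → (ℕ → ℕ) → Ctx
  | lam : Ctx → Ctx
  | appL : Ctx → Tm → Ctx
  | appR : Tm → Ctx → Ctx
  | recfn : Ctx → Ctx
  | arithL : ArithOp → Ctx → Tm → Ctx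
  | arithR : ArithOp → Tm → Ctx → Ctx
  | iteC : Ctx → Tm → Tm → Ctx
  | iteT : Tm → Ctx → Tm → Ctx
  | iteE : Tm → Tm → Ctx → Ctx
  | ref : Ctx → Ctx
  | deref : Ctx → Ctx
  | assignL : Ctx → Tm → Ctx
  | assignR : Tm → Ctx → Ctx
  | box : Ctx → Ctx
  | letboxL : Ctx → Tm → Ctx
  | letboxR : Tm → Ctx → Ctx

/-- `C.plug M` is `C[M]`. -/
def Ctx.plug : Ctx → Tm → Tm
  | hole ρ ξ, M => M.rename ρ ξ
  | lam C, M => Tm.lam (C.plug M)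
  | appL C N, M => Tm.app (C.plug M) N
  | appR N C, M => Tm.app N (C.plug M)
  | recfn C, M => Tm.recfn (C.plug M)
  | arithL o C N, M => Tm.arith o (C.plug M) N
  | arithR o N C, M => Tm.arith o N (C.plug M)
  | iteC C N₁ N₂, M => Tm.ite (C.plug M) N₁ N₂
  | iteT N₁ C N₂, M => Tm.ite N₁ (C.plug M) N₂
  | iteE N₁ N₂ C, M => Tm.ite N₁ N₂ (C.plug M)
  | ref C, M => Tm.ref (C.plug M)
  | deref C, M => Tm.deref (C.plug M)
  | assignL C N, M => Tm.assign (C.plug M) N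
  | assignR N C, M => Tm.assign N (C.plug M)
  | box C, M => Tm.box (C.plug M)
  | letboxL C N, M => Tm.letbox (C.plug M) N
  | letboxR N C, M => Tm.letbox N (C.plug M)

/-- `ρ` exhibits the declarations in the list `Δ'` as a subset of those in `Δ`. -/
def Incl {α : Type} (ρ : ℕ → ℕ) (Δ' Δ : List α) : Prop :=
  (∀ (x : ℕ) (a : α), Δ'[x]? = some a → Δ[ρ x]? = some a) ∧
    ∀ x y : ℕ, x < Δ'.length → y < Δ'.length → ρ x = ρ y → x = y

/-- `CtxHasTy S Ψ' Γ' i' T' C Ψ Γ i T` is the judgement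
`S ⊢ C : (Ψ'; Γ'; i'; T') → (Ψ; Γ; i; T)`. -/
inductive CtxHasTy (S : SCtx) (Ψ' : GCtx) (Γ' : LCtx) (i' : Layer) (T' : Ty) :
    Ctx → GCtx → LCtx → Layer → Ty → Prop
  | hole {Ψ : GCtx} {Γ : LCtx} {i : Layer} {ρ ξ : ℕ → ℕ} :
      SCtxWF S → GCtxWF Ψ → LCtxWF i Γ → Incl ξ Ψ' Ψ → Incl ρ Γ' Γ → i' ≤ i →
      CtxHasTy S Ψ' Γ' i' T' (Ctx.hole ρ ξ) Ψ Γ i T'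
  | lam {Ψ : GCtx} {Γ : LCtx} {i : Layer} {C : Ctx} {T₁ T₂ : Ty} :
      CtxHasTy S Ψ' Γ' i' T' C Ψ (T₁ :: Γ) i T₂ →
      CtxHasTy S Ψ' Γ' i' T' (Ctx.lam C) Ψ Γ i (Ty.arrow T₁ T₂)
  | appL {Ψ : GCtx} {Γ : LCtx} {i : Layer} {C : Ctx} {N : Tm} {T₁ T₂ : Ty} :
      CtxHasTy S Ψ' Γ' i' T' C Ψ Γ i (Ty.arrow T₁ T₂) → HasTy S Ψ Γ i N T₁ →
      CtxHasTy S Ψ' Γ' i' T' (Ctx.appL C N) Ψ Γ i T₂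
  | appR {Ψ : GCtx} {Γ : LCtx} {i : Layer} {C : Ctx} {N : Tm} {T₁ T₂ : Ty} :
      HasTy S Ψ Γ i N (Ty.arrow T₁ T₂) → CtxHasTy S Ψ' Γ' i' T' C Ψ Γ i T₁ →
      CtxHasTy S Ψ' Γ' i' T' (Ctx.appR N C) Ψ Γ i T₂
  | recfn {Ψ : GCtx} {Γ : LCtx} {i : Layer} {C : Ctx} {T₁ T₂ : Ty} :
      CtxHasTy S Ψ' Γ' i' T' C Ψ (T₁ :: Ty.arrow T₁ T₂ :: Γ) i T₂ →
      CtxHasTy S Ψ' Γ' i' T' (Ctx.recfn C) Ψ Γ i (Ty.arrow T₁ T₂)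
  | arithL {Ψ : GCtx} {Γ : LCtx} {i : Layer} (o : ArithOp) {C : Ctx} {N : Tm} :
      CtxHasTy S Ψ' Γ' i' T' C Ψ Γ i Ty.int → HasTy S Ψ Γ i N Ty.int →
      CtxHasTy S Ψ' Γ' i' T' (Ctx.arithL o C N) Ψ Γ i Ty.int
  | arithR {Ψ : GCtx} {Γ : LCtx} {i : Layer} (o : ArithOp) {C : Ctx} {N : Tm} :
      HasTy S Ψ Γ i N Ty.int → CtxHasTy S Ψ' Γ' i' T' C Ψ Γ i Ty.int →
      CtxHasTy S Ψ' Γ' i' T' (Ctx.arithR o N C) Ψ Γ i Ty.int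
  | iteC {Ψ : GCtx} {Γ : LCtx} {i : Layer} {C : Ctx} {N₁ N₂ : Tm} {T : Ty} :
      CtxHasTy S Ψ' Γ' i' T' C Ψ Γ i Ty.int → HasTy S Ψ Γ i N₁ T → HasTy S Ψ Γ i N₂ T →
      CtxHasTy S Ψ' Γ' i' T' (Ctx.iteC C N₁ N₂) Ψ Γ i T
  | iteT {Ψ : GCtx} {Γ : LCtx} {i : Layer} {C : Ctx} {N₁ N₂ : Tm} {T : Ty} :
      HasTy S Ψ Γ i N₁ Ty.int → CtxHasTy S Ψ' Γ' i' T' C Ψ Γ i T → HasTy S Ψ Γ i N₂ T →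
      CtxHasTy S Ψ' Γ' i' T' (Ctx.iteT N₁ C N₂) Ψ Γ i T
  | iteE {Ψ : GCtx} {Γ : LCtx} {i : Layer} {C : Ctx} {N₁ N₂ : Tm} {T : Ty} :
      HasTy S Ψ Γ i N₁ Ty.int → HasTy S Ψ Γ i N₂ T → CtxHasTy S Ψ' Γ' i' T' C Ψ Γ i T →
      CtxHasTy S Ψ' Γ' i' T' (Ctx.iteE N₁ N₂ C) Ψ Γ i T
  | ref {Ψ : GCtx} {Γ : LCtx} {i : Layer} {C : Ctx} {T : Ty} :
      CtxHasTy S Ψ' Γ' i' T' C Ψ Γ i T → CtxHasTy S Ψ' Γ' i' T' (Ctx.ref C) Ψ Γ i (Ty.ref T)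
  | deref {Ψ : GCtx} {Γ : LCtx} {i : Layer} {C : Ctx} {T : Ty} :
      CtxHasTy S Ψ' Γ' i' T' C Ψ Γ i (Ty.ref T) → CtxHasTy S Ψ' Γ' i' T' (Ctx.deref C) Ψ Γ i T
  | assignL {Ψ : GCtx} {Γ : LCtx} {i : Layer} {C : Ctx} {N : Tm} {T : Ty} :
      CtxHasTy S Ψ' Γ' i' T' C Ψ Γ i (Ty.ref T) → HasTy S Ψ Γ i N T →
      CtxHasTy S Ψ' Γ' i' T' (Ctx.assignL C N) Ψ Γ i Ty.unit
  | assignR {Ψ : GCtx} {Γ : LCtx} {i : Layer} {C : Ctx} {N : Tm} {T : Ty} :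
      HasTy S Ψ Γ i N (Ty.ref T) → CtxHasTy S Ψ' Γ' i' T' C Ψ Γ i T →
      CtxHasTy S Ψ' Γ' i' T' (Ctx.assignR N C) Ψ Γ i Ty.unit
  | box {Ψ : GCtx} {Γ Γ₁ : LCtx} {C : Ctx} {T : Ty} :
      LCtxWF Layer.one Γ → CtxHasTy S Ψ' Γ' i' T' C Ψ Γ₁ Layer.zero T →
      CtxHasTy S Ψ' Γ' i' T' (Ctx.box C) Ψ Γ Layer.one (Ty.box Γ₁ T)
  | letboxL {Ψ : GCtx} {Γ Γ₁ : LCtx} {C : Ctx} {N : Tm} {T T₁ : Ty} :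
      CtxHasTy S Ψ' Γ' i' T' C Ψ Γ Layer.one (Ty.box Γ₁ T₁) →
      HasTy S ((Γ₁, T₁) :: Ψ) Γ Layer.one N T →
      CtxHasTy S Ψ' Γ' i' T' (Ctx.letboxL C N) Ψ Γ Layer.one T
  | letboxR {Ψ : GCtx} {Γ Γ₁ : LCtx} {C : Ctx} {N : Tm} {T T₁ : Ty} :
      HasTy S Ψ Γ Layer.one N (Ty.box Γ₁ T₁) →
      CtxHasTy S Ψ' Γ' i' T' C ((Γ₁, T₁) :: Ψ) Γ Layer.one T →
      CtxHasTy S Ψ' Γ' i' T' (Ctx.letboxR N C) Ψ Γ Layer.one T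

/-- Evaluation contexts as contexts. -/
def ECtx.toCtx : ECtx → Ctx
  | hole => Ctx.hole id id
  | appL K N => Ctx.appL K.toCtx N
  | appR V _ K => Ctx.appR V K.toCtx
  | arithL o K N => Ctx.arithL o K.toCtx N
  | arithR o V _ K => Ctx.arithR o V K.toCtx
  | ite K N₁ N₂ => Ctx.iteC K.toCtx N₁ N₂
  | ref K => Ctx.ref K.toCtx
  | deref K => Ctx.deref K.toCtx
  | assignL K N => Ctx.assignL K.toCtx N
  | assignR V _ K => Ctx.assignR V K.toCtx
  | letbox K N => Ctx.letboxL K.toCtx N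

/-! ### The two preorders -/

/-- Contextual approximation of terms `M₁`, `M₂` with `S; Ψ; Γ ⊢ᵢ M₁, M₂ : T`. -/
def CtxApprox (S : SCtx) (Ψ : GCtx) (Γ : LCtx) (i : Layer) (T : Ty) (M₁ M₂ : Tm) : Prop :=
  ∀ (S' : SCtx) (C : Ctx) (i' : Layer) (T' : Ty) (h : Heap),
    SCtxSub S S' → CtxHasTy S' Ψ Γ i T C [] [] i' T' → HeapHasTy S' [] [] h →
    Converges (C.plug M₁) h → Converges (C.plug M₂) h

/-- Closed-instances-of-use approximation of terms `M₁`, `M₂` with `S; Ψ; Γ ⊢ᵢ M₁, M₂ : T`. -/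
def CIUApprox (S : SCtx) (Ψ : GCtx) (Γ : LCtx) (i : Layer) (T : Ty) (M₁ M₂ : Tm) : Prop :=
  ∀ (S' : SCtx) (m n : ℕ) (σ : Fin m → Tm) (δ : Fin n → Tm) (K : ECtx) (i' : Layer) (T' : Ty)
    (h : Heap),
    SCtxSub S S' → GSubstHasTy S' [] σ Ψ → LSubstHasTy S' [] [] i δ Γ →
    CtxHasTy S' [] [] i T K.toCtx [] [] i' T' → HeapHasTy S' [] [] h →
    Converges (K.fill ((M₁.gsubst (Tm.gofFin σ)).lsubst (Tm.ofFin δ))) h →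
    Converges (K.fill ((M₂.gsubst (Tm.gofFin σ)).lsubst (Tm.ofFin δ))) h

end LMML

/-! Contextual approximation implies CIU approximation because, up to reduction, a closed instance
of use is itself a context. A value for a local variable is supplied by a redex `(λx. C) V`, code
for a global variable by `letbox u = box N in C`, and `K` is placed around the result. Such contexts
live at layer one, which is allowed since a hole may be used at a layer above that of the plugged
term (`exists_ctx_subst`, `CtxApprox.ciuApprox`).

The converse is Howe's method. The closure `How` of CIU approximation under the term formers, with
one CIU step after each, is compatible by construction, including under `box`, and is closed under
substitution of related values and related code (`How.lsubst`, `How.gsubst`). The main lemma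
`Halts.how` says that if stacks, heaps and terms are Howe-related and the left machine halts, then
so does the right one. It goes by induction on the left run, discharging each CIU step by using the
right stack as a test. Plugging CIU-related terms into a context gives Howe-related programs
(`CtxHasTy.how`), hence contextual approximation. Evaluation is handled through the stack machine
`Halts`, in which the redex is always in focus and no decomposition of terms is needed.

The difficulty specific to layers is that a layer-zero hole may sit under layer-one binders, so its
variables may receive layer-one values, whereas CIU approximation at layer zero tests only
layer-zero values. The Howe argument therefore uses the stronger relation `Ciu`, whose local
substitutions are always typed at layer one, and `CIUApprox.ciu` shows that nothing is lost. A
closed layer-one value of a layer-zero type is either typable at layer zero or a function. A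
function `V` of type `A → B` can be stored at a fresh location `ℓ`: heap entries may be of layer
one, but `ℓ : ref (A → B)` is usable at layer zero, so `λx. (!ℓ) x` is a layer-zero substitute for
`V`. The simulations `Halts.eta` and `Halts.of_eta` show that the replacement does not affect
termination, and replacing one variable after another proves the claim. -/

namespace LMML
-- Substitution calculus on raw terms
namespace Tm

theorem upRen_id : upRen id = id := by
  funext k; cases k <;> rfl

theorem upRen_comp (ρ ρ' : ℕ → ℕ) : upRen ρ' ∘ upRen ρ = upRen (ρ' ∘ ρ) := by
  funext k; cases k <;> rfl

theorem rename_id (M : Tm) : M.rename id id = M := by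
  induction M <;> simp_all [rename, upRen_id]

theorem rename_rename (M : Tm) : ∀ (ρ ξ ρ' ξ' : ℕ → ℕ),
    (M.rename ρ ξ).rename ρ' ξ' = M.rename (ρ' ∘ ρ) (ξ' ∘ ξ) := by
  induction M <;> intro ρ ξ ρ' ξ' <;> simp_all [rename, upRen_comp]

theorem upL_comp_upRen (τ : ℕ → Tm) (ρ : ℕ → ℕ) : upL τ ∘ upRen ρ = upL (τ ∘ ρ) := by
  funext k; cases k <;> rfl

theorem upG_comp (τ : ℕ → Tm) (ρ : ℕ → ℕ) : upG τ ∘ ρ = upG (τ ∘ ρ) := rfl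

/-- The local renaming can be absorbed into `τ`, but the global one must stay on the term: the
entries of `τ` are inserted afterwards and are not affected by `ξ`. Under `box` both sides reduce to
the action of `ξ` alone. -/
theorem lsubst_rename (M : Tm) : ∀ (ρ ξ : ℕ → ℕ) (τ : ℕ → Tm),
    (M.rename ρ ξ).lsubst τ = (M.rename id ξ).lsubst (τ ∘ ρ) := by
  induction M with
  | lam M ih =>
    intro ρ ξ τ
    simp only [rename, lsubst]
    rw [ih, upL_comp_upRen, upRen_id]
  | recfn M ih =>
    intro ρ ξ τ
    simp only [rename, lsubst]
    rw [ih, upL_comp_upRen, upL_comp_upRen, upRen_id, upRen_id]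
  | letbox M N ihM ihN =>
    intro ρ ξ τ
    simp only [rename, lsubst]
    rw [ihM, ihN, upG_comp]
  | box M => intros; rfl
  | gvar u n δ ih =>
    intro ρ ξ τ
    simp only [rename, lsubst]
    congr 1; funext k; exact ih k ρ ξ τ
  | _ => intro ρ ξ τ; simp_all [rename, lsubst]

theorem rename_upL (τ : ℕ → Tm) (ρ ξ : ℕ → ℕ) :
    (fun x => (upL τ x).rename (upRen ρ) ξ) = upL (fun x => (τ x).rename ρ ξ) := by
  funext k
  cases k with
  | zero => rfl
  | succ k => simp only [upL, scons, rename_rename]; rfl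

theorem rename_upG (τ : ℕ → Tm) (ρ ξ : ℕ → ℕ) :
    (fun x => (upG τ x).rename ρ (upRen ξ)) = upG (fun x => (τ x).rename ρ ξ) := by
  funext k
  simp only [upG, rename_rename]; rfl

/-- Global variables occur both in `M` and in the entries of `τ`, so `ξ` acts on both, whereas the
local variables of `M` have been replaced and `ρ` acts on the entries only. -/
theorem rename_lsubst (M : Tm) : ∀ (τ : ℕ → Tm) (ρ ξ : ℕ → ℕ),
    (M.lsubst τ).rename ρ ξ = (M.rename id ξ).lsubst (fun x => (τ x).rename ρ ξ) := by
  induction M with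
  | lam M ih =>
    intro τ ρ ξ
    simp only [rename, lsubst, upRen_id]
    rw [ih, rename_upL]
  | recfn M ih =>
    intro τ ρ ξ
    simp only [rename, lsubst, upRen_id]
    rw [ih, rename_upL, rename_upL]
  | letbox M N ihM ihN =>
    intro τ ρ ξ
    simp only [rename, lsubst]
    rw [ihM, ihN, rename_upG]
  | box M => intros; rfl
  | gvar u n δ ih =>
    intro τ ρ ξ
    simp only [rename, lsubst]
    congr 1; funext k; exact ih k τ ρ ξ
  | _ => intro τ ρ ξ; simp_all [rename, lsubst]

theorem lsubst_upL (τ τ' : ℕ → Tm) :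
    (fun x => (upL τ x).lsubst (upL τ')) = upL (fun x => (τ x).lsubst τ') := by
  funext k
  cases k with
  | zero => rfl
  | succ k =>
    simp only [upL, scons]
    rw [lsubst_rename, rename_lsubst]
    rfl

theorem lsubst_upG (τ τ' : ℕ → Tm) :
    (fun x => (upG τ x).lsubst (upG τ')) = upG (fun x => (τ x).lsubst τ') := by
  funext k
  simp only [upG]
  rw [rename_lsubst]
  rfl

theorem lsubst_lsubst (M : Tm) : ∀ (τ τ' : ℕ → Tm),
    (M.lsubst τ).lsubst τ' = M.lsubst (fun x => (τ x).lsubst τ') := by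
  induction M with
  | lam M ih => intro τ τ'; simp only [lsubst]; rw [ih, lsubst_upL]
  | recfn M ih => intro τ τ'; simp only [lsubst]; rw [ih, lsubst_upL, lsubst_upL]
  | letbox M N ihM ihN => intro τ τ'; simp only [lsubst]; rw [ihM, ihN, lsubst_upG]
  | _ => intro τ τ'; simp_all [lsubst]

theorem upL_var (ρ : ℕ → ℕ) : upL (fun x => var (ρ x)) = fun x => var (upRen ρ x) := by
  funext k; cases k <;> rfl

theorem rename_eq_lsubst (M : Tm) : ∀ ρ : ℕ → ℕ, M.rename ρ id = M.lsubst (fun x => var (ρ x)) := by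
  induction M with
  | box M => intro ρ; simp [rename, lsubst, rename_id]
  | letbox M N ihM ihN =>
    intro ρ
    simp only [rename, lsubst, upRen_id, ihM, ihN]
    rfl
  | _ => intro ρ; simp_all [rename, lsubst, upL_var]

theorem lsubst_var (M : Tm) : M.lsubst var = M :=
  (rename_eq_lsubst M id).symm.trans (rename_id M)

theorem rename_scons (M V : Tm) (τ : ℕ → Tm) :
    (M.rename Nat.succ id).lsubst (scons V τ) = M.lsubst τ := by
  rw [lsubst_rename, rename_id]; rfl

theorem lsubst_upL_scons (M V : Tm) (τ : ℕ → Tm) :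
    (M.lsubst (upL τ)).lsubst (scons V var) = M.lsubst (scons V τ) := by
  rw [lsubst_lsubst]
  congr 1
  funext k
  cases k with
  | zero => rfl
  | succ k => simp only [upL, scons, rename_scons, lsubst_var]

/-- `f` has to fix variables because `ofFin` returns a variable outside the range of `δ`. -/
theorem ofFin_map {n : ℕ} (δ : Fin n → Tm) (f : Tm → Tm) (hf : ∀ x, f (var x) = var x) (x : ℕ) :
    ofFin (fun k => f (δ k)) x = f (ofFin δ x) := by
  unfold ofFin; split <;> simp [hf]

theorem upGSub_comp_upRen (σ : GSub) (ξ : ℕ → ℕ) : upGSub σ ∘ upRen ξ = upGSub (σ ∘ ξ) := by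
  funext k; cases k <;> rfl

/-- Only global renamings are treated here. A local renaming commutes with `gsubst` on typed terms
but not on raw ones; see `HasTy.gsubst_rename_local`. -/
theorem gsubst_rename (M : Tm) : ∀ (ξ : ℕ → ℕ) (σ : GSub),
    (M.rename id ξ).gsubst σ = M.gsubst (σ ∘ ξ) := by
  induction M with
  | letbox M N ihM ihN =>
    intro ξ σ; simp only [rename, gsubst, ihM, ihN, upGSub_comp_upRen]
  | _ => intro ξ σ; simp_all [rename, gsubst, upRen_id]

/-- Renaming of the global variables in the range of a global substitution. -/
def gmap (ξ : ℕ → ℕ) (σ : GSub) : GSub := fun u => Sum.map ξ (rename id ξ) (σ u)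

theorem gmap_upGSub (σ : GSub) (ξ : ℕ → ℕ) : gmap (upRen ξ) (upGSub σ) = upGSub (gmap ξ σ) := by
  funext k
  cases k with
  | zero => rfl
  | succ k =>
    simp only [gmap, upGSub]
    cases σ k with
    | inl v => rfl
    | inr N => simp only [Sum.map_inr, rename_rename]; rfl

theorem rename_gsubst (M : Tm) : ∀ (ξ : ℕ → ℕ) (σ : GSub),
    (M.gsubst σ).rename id ξ = M.gsubst (gmap ξ σ) := by
  induction M with
  | letbox M N ihM ihN =>
    intro ξ σ; simp only [rename, gsubst, ihM, ihN, gmap_upGSub]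
  | gvar u n δ ih =>
    intro ξ σ
    simp only [gsubst, gmap]
    cases σ u with
    | inl v => simp only [Sum.map_inl, rename, ih]
    | inr N =>
      simp only [Sum.map_inr]
      rw [rename_lsubst]
      congr 1
      funext x
      rw [← ofFin_map _ (rename id ξ) (fun _ => rfl)]
      simp only [ih]
  | _ => intro ξ σ; simp_all [rename, gsubst, upRen_id]

theorem upGSub_inl (ξ : ℕ → ℕ) :
    upGSub (fun u => Sum.inl (ξ u)) = fun u => Sum.inl (upRen ξ u) := by
  funext k; cases k <;> rfl

theorem rename_eq_gsubst (M : Tm) : ∀ ξ : ℕ → ℕ,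
    M.rename id ξ = M.gsubst (fun u => Sum.inl (ξ u)) := by
  induction M with
  | _ => intro ξ; simp_all [rename, gsubst, upRen_id, upGSub_inl]

theorem gsubst_inl (M : Tm) : M.gsubst Sum.inl = M :=
  (rename_eq_gsubst M id).symm.trans (rename_id M)

/-- Composition of global substitutions, `σ` first. -/
def gcomp (σ σ' : GSub) : GSub := fun u =>
  match σ u with
  | Sum.inl v => σ' v
  | Sum.inr N => Sum.inr (N.gsubst σ')

theorem upGSub_gcomp (σ σ' : GSub) : gcomp (upGSub σ) (upGSub σ') = upGSub (gcomp σ σ') := by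
  funext k
  cases k with
  | zero => rfl
  | succ k =>
    simp only [gcomp, upGSub]
    cases σ k with
    | inl v => rfl
    | inr N =>
      simp only [Sum.map_inr, gsubst_rename, rename_gsubst]
      rfl

/-- This is the identity behind the `letbox` rule: substituting under the binder and then inserting
the code amounts to one simultaneous substitution. -/
theorem gcomp_gcons (σ : GSub) (N : Tm) :
    gcomp (upGSub σ) (gcons N Sum.inl) = gcons N σ := by
  funext k
  cases k with
  | zero => rfl
  | succ k =>
    simp only [gcomp, upGSub, gcons]
    cases σ k with
    | inl v => rfl
    | inr N' => exact congrArg Sum.inr ((gsubst_rename N' _ _).trans (gsubst_inl N'))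

theorem IsValue.rename {V : Tm} (h : V.IsValue) (ρ ξ : ℕ → ℕ) : (V.rename ρ ξ).IsValue := by
  cases h <;> constructor

theorem IsValue.gsubst {V : Tm} (h : V.IsValue) (σ : GSub) : (V.gsubst σ).IsValue := by
  cases h <;> constructor

end Tm
open Tm

/-! ### Properties of typing -/

theorem Layer.le_one (i : Layer) : i ≤ Layer.one := Or.inr rfl

theorem TyWF.lift {i : Layer} {T : Ty} (h : TyWF i T) : TyWF Layer.one T := by
  induction h with
  | unit => exact .unit
  | int => exact .int
  | arrow _ _ ih₁ ih₂ => exact .arrow ih₁ ih₂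
  | ref _ ih => exact .ref ih
  | box h₁ h₂ _ _ => exact .box h₁ h₂

theorem LCtxWF.lift {i : Layer} {Γ : LCtx} (h : LCtxWF i Γ) : LCtxWF Layer.one Γ :=
  fun T hT => (h T hT).lift

theorem LCtxWF.nil {i : Layer} : LCtxWF i [] := fun _ h => nomatch h

theorem GCtxWF.nil : GCtxWF [] := fun _ h => nomatch h

theorem LCtxWF.cons {i : Layer} {T : Ty} {Γ : LCtx} (hT : TyWF i T) (h : LCtxWF i Γ) :
    LCtxWF i (T :: Γ) := by
  intro U hU
  rcases List.mem_cons.1 hU with rfl | hU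
  exacts [hT, h U hU]

theorem LCtxWF.tail {i : Layer} {T : Ty} {Γ : LCtx} (h : LCtxWF i (T :: Γ)) : LCtxWF i Γ :=
  fun U hU => h U (List.mem_cons_of_mem _ hU)

theorem LCtxWF.head {i : Layer} {T : Ty} {Γ : LCtx} (h : LCtxWF i (T :: Γ)) : TyWF i T :=
  h T List.mem_cons_self

theorem LCtxWF.get {i : Layer} {Γ : LCtx} (h : LCtxWF i Γ) {x : ℕ} {T : Ty}
    (hx : Γ[x]? = some T) : TyWF i T :=
  h T (List.mem_of_getElem? hx)

theorem GCtxWF.cons {p : LCtx × Ty} {Ψ : GCtx} (h₁ : LCtxWF Layer.zero p.1)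
    (h₂ : TyWF Layer.zero p.2) (h : GCtxWF Ψ) : GCtxWF (p :: Ψ) := by
  intro q hq
  rcases List.mem_cons.1 hq with rfl | hq
  exacts [⟨h₁, h₂⟩, h q hq]

theorem GCtxWF.tail {p : LCtx × Ty} {Ψ : GCtx} (h : GCtxWF (p :: Ψ)) : GCtxWF Ψ :=
  fun q hq => h q (List.mem_cons_of_mem _ hq)

theorem GCtxWF.get {Ψ : GCtx} (h : GCtxWF Ψ) {u : ℕ} {Γ : LCtx} {T : Ty}
    (hu : Ψ[u]? = some (Γ, T)) : LCtxWF Layer.zero Γ ∧ TyWF Layer.zero T :=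
  h (Γ, T) (List.mem_of_getElem? hu)

theorem TyWF.of_zero {i : Layer} {T : Ty} (h : TyWF Layer.zero T) : TyWF i T := by
  cases i
  exacts [h, h.lift]

namespace HasTy

variable {S : SCtx} {Ψ : GCtx} {Γ : LCtx} {i : Layer} {M : Tm} {T : Ty}

theorem wf (h : HasTy S Ψ Γ i M T) : SCtxWF S ∧ GCtxWF Ψ ∧ LCtxWF i Γ ∧ TyWF i T := by
  induction h with
  | unit h₁ h₂ h₃ => exact ⟨h₁, h₂, h₃, .unit⟩
  | num n h₁ h₂ h₃ => exact ⟨h₁, h₂, h₃, .int⟩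
  | var h₁ h₂ h₃ h => exact ⟨h₁, h₂, h₃, h₃.get h⟩
  | gvar h₁ h₂ h₃ _ _ _ h _ => exact ⟨h₁, h₂, h₃, (h₂.get h).2.of_zero⟩
  | loc h₁ h₂ h₃ _ h => exact ⟨h₁, h₂, h₃, .ref h⟩
  | lam _ ih => exact ⟨ih.1, ih.2.1, ih.2.2.1.tail, .arrow ih.2.2.1.head ih.2.2.2⟩
  | app _ _ ih _ =>
    obtain ⟨h₁, h₂, h₃, h⟩ := ih
    cases h with
    | arrow _ h => exact ⟨h₁, h₂, h₃, h⟩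
  | recfn _ ih =>
    exact ⟨ih.1, ih.2.1, ih.2.2.1.tail.tail, .arrow ih.2.2.1.head ih.2.2.2⟩
  | arith o _ _ ih _ => exact ih
  | ite _ _ _ _ ih _ => exact ih
  | ref _ ih => exact ⟨ih.1, ih.2.1, ih.2.2.1, .ref ih.2.2.2⟩
  | deref _ ih =>
    obtain ⟨h₁, h₂, h₃, h⟩ := ih
    cases h with
    | ref h => exact ⟨h₁, h₂, h₃, h⟩
  | assign _ _ ih _ => exact ⟨ih.1, ih.2.1, ih.2.2.1, .unit⟩
  | box h _ ih => exact ⟨ih.1, ih.2.1, h, .box ih.2.2.1 ih.2.2.2⟩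
  | letbox _ _ ih₁ ih₂ => exact ⟨ih₁.1, ih₁.2.1, ih₁.2.2.1, ih₂.2.2.2⟩

theorem sctxWF (h : HasTy S Ψ Γ i M T) : SCtxWF S := h.wf.1
theorem gctxWF (h : HasTy S Ψ Γ i M T) : GCtxWF Ψ := h.wf.2.1
theorem lctxWF (h : HasTy S Ψ Γ i M T) : LCtxWF i Γ := h.wf.2.2.1
theorem tyWF (h : HasTy S Ψ Γ i M T) : TyWF i T := h.wf.2.2.2

/-- Layers are cumulative since every rule available at layer zero is also available at layer one;
the rules for `box` and `letbox` already conclude at layer one. This is what lets layer-zero code be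
inserted at a layer-one occurrence of a global variable. -/
theorem lift (h : HasTy S Ψ Γ i M T) : HasTy S Ψ Γ Layer.one M T := by
  induction h with
  | unit h₁ h₂ h₃ => exact .unit h₁ h₂ h₃.lift
  | num n h₁ h₂ h₃ => exact .num n h₁ h₂ h₃.lift
  | var h₁ h₂ h₃ h => exact .var h₁ h₂ h₃.lift h
  | gvar h₁ h₂ h₃ hl hv _ h ih => exact .gvar h₁ h₂ h₃.lift hl hv ih h
  | loc h₁ h₂ h₃ hl h => exact .loc h₁ h₂ h₃.lift hl h.lift
  | lam _ ih => exact .lam ih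
  | app _ _ ih₁ ih₂ => exact .app ih₁ ih₂
  | recfn _ ih => exact .recfn ih
  | arith o _ _ ih₁ ih₂ => exact .arith o ih₁ ih₂
  | ite _ _ _ ih₁ ih₂ ih₃ => exact .ite ih₁ ih₂ ih₃
  | ref _ ih => exact .ref ih
  | deref _ ih => exact .deref ih
  | assign _ _ ih₁ ih₂ => exact .assign ih₁ ih₂
  | box h h' _ => exact .box h h'
  | letbox _ _ ih₁ ih₂ => exact .letbox ih₁ ih₂

theorem of_zero (h : HasTy S Ψ Γ Layer.zero M T) : HasTy S Ψ Γ i M T := by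
  cases i
  exacts [h, h.lift]

theorem mono_store {S' : SCtx} (h : HasTy S Ψ Γ i M T) (hS : SCtxSub S S') (hw : SCtxWF S') :
    HasTy S' Ψ Γ i M T := by
  induction h with
  | unit h₁ h₂ h₃ => exact .unit hw h₂ h₃
  | num n h₁ h₂ h₃ => exact .num n hw h₂ h₃
  | var h₁ h₂ h₃ h => exact .var hw h₂ h₃ h
  | gvar h₁ h₂ h₃ hl hv _ h ih => exact .gvar hw h₂ h₃ hl hv ih h
  | loc h₁ h₂ h₃ hl h => exact .loc hw h₂ h₃ (hS _ _ hl) h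
  | lam _ ih => exact .lam ih
  | app _ _ ih₁ ih₂ => exact .app ih₁ ih₂
  | recfn _ ih => exact .recfn ih
  | arith o _ _ ih₁ ih₂ => exact .arith o ih₁ ih₂
  | ite _ _ _ ih₁ ih₂ ih₃ => exact .ite ih₁ ih₂ ih₃
  | ref _ ih => exact .ref ih
  | deref _ ih => exact .deref ih
  | assign _ _ ih₁ ih₂ => exact .assign ih₁ ih₂
  | box h _ ih => exact .box h ih
  | letbox _ _ ih₁ ih₂ => exact .letbox ih₁ ih₂

end HasTy

/-- `ρ` maps the declarations in `Δ` to declarations in `Δ'`. -/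
def RenTy {α : Type} (ρ : ℕ → ℕ) (Δ Δ' : List α) : Prop :=
  ∀ (x : ℕ) (a : α), Δ[x]? = some a → Δ'[ρ x]? = some a

namespace RenTy

variable {α : Type} {ρ : ℕ → ℕ} {Δ Δ' : List α}

theorem refl : RenTy id Δ Δ := fun _ _ h => h

theorem of_nil : RenTy ρ [] Δ := fun x a h => by simp at h

theorem succ {a : α} : RenTy Nat.succ Δ (a :: Δ) := fun x b h => by simpa using h

theorem up (h : RenTy ρ Δ Δ') (a : α) : RenTy (upRen ρ) (a :: Δ) (a :: Δ') := by
  intro x b hx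
  cases x with
  | zero => simpa [upRen] using hx
  | succ x => simpa [upRen] using h x b (by simpa using hx)

end RenTy

theorem HasTy.rename {S : SCtx} {Ψ : GCtx} {Γ : LCtx} {i : Layer} {M : Tm} {T : Ty}
    (h : HasTy S Ψ Γ i M T) : ∀ {Ψ' : GCtx} {Γ' : LCtx} {ρ ξ : ℕ → ℕ},
    RenTy ρ Γ Γ' → RenTy ξ Ψ Ψ' → LCtxWF i Γ' → GCtxWF Ψ' →
    HasTy S Ψ' Γ' i (M.rename ρ ξ) T := by
  induction h with
  | unit h₁ h₂ h₃ => intro _ _ _ _ hρ hξ hΓ hΨ; exact .unit h₁ hΨ hΓ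
  | num n h₁ h₂ h₃ => intro _ _ _ _ hρ hξ hΓ hΨ; exact .num n h₁ hΨ hΓ
  | var h₁ h₂ h₃ h => intro _ _ _ _ hρ hξ hΓ hΨ; exact .var h₁ hΨ hΓ (hρ _ _ h)
  | gvar h₁ h₂ h₃ hl hv _ h ih =>
    intro _ _ _ _ hρ hξ hΓ hΨ
    exact .gvar h₁ hΨ hΓ hl (fun k => (hv k).rename _ _) (fun k U hU => ih k U hU hρ hξ hΓ hΨ)
      (hξ _ _ h)
  | loc h₁ h₂ h₃ hl h => intro _ _ _ _ hρ hξ hΓ hΨ; exact .loc h₁ hΨ hΓ hl h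
  | lam h ih => intro _ _ _ _ hρ hξ hΓ hΨ; exact .lam (ih (hρ.up _) hξ (hΓ.cons h.lctxWF.head) hΨ)
  | app _ _ ih₁ ih₂ =>
    intro _ _ _ _ hρ hξ hΓ hΨ; exact .app (ih₁ hρ hξ hΓ hΨ) (ih₂ hρ hξ hΓ hΨ)
  | recfn h ih =>
    intro _ _ _ _ hρ hξ hΓ hΨ
    exact .recfn (ih ((hρ.up _).up _) hξ ((hΓ.cons h.lctxWF.tail.head).cons h.lctxWF.head) hΨ)
  | arith o _ _ ih₁ ih₂ =>
    intro _ _ _ _ hρ hξ hΓ hΨ; exact .arith o (ih₁ hρ hξ hΓ hΨ) (ih₂ hρ hξ hΓ hΨ)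
  | ite _ _ _ ih₁ ih₂ ih₃ =>
    intro _ _ _ _ hρ hξ hΓ hΨ
    exact .ite (ih₁ hρ hξ hΓ hΨ) (ih₂ hρ hξ hΓ hΨ) (ih₃ hρ hξ hΓ hΨ)
  | ref _ ih => intro _ _ _ _ hρ hξ hΓ hΨ; exact .ref (ih hρ hξ hΓ hΨ)
  | deref _ ih => intro _ _ _ _ hρ hξ hΓ hΨ; exact .deref (ih hρ hξ hΓ hΨ)
  | assign _ _ ih₁ ih₂ =>
    intro _ _ _ _ hρ hξ hΓ hΨ; exact .assign (ih₁ hρ hξ hΓ hΨ) (ih₂ hρ hξ hΓ hΨ)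
  | box h h' ih => intro _ _ _ _ hρ hξ hΓ hΨ; exact .box hΓ (ih RenTy.refl hξ h'.lctxWF hΨ)
  | letbox _ h ih₁ ih₂ =>
    intro _ _ _ _ hρ hξ hΓ hΨ
    have hw := h.gctxWF _ List.mem_cons_self
    exact .letbox (ih₁ hρ hξ hΓ hΨ) (ih₂ hρ (hξ.up _) hΓ (hΨ.cons hw.1 hw.2))

/-- `S; Ψ; Γ' ⊢ᵢ τ : Γ` for a total substitution `τ`, which is arbitrary outside of `Γ`. -/
def LSubTy (S : SCtx) (Ψ : GCtx) (Γ' : LCtx) (i : Layer) (τ : ℕ → Tm) (Γ : LCtx) : Prop :=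
  ∀ (x : ℕ) (T : Ty), Γ[x]? = some T → (τ x).IsValue ∧ HasTy S Ψ Γ' i (τ x) T

/-- `S; Ψ' ⊢ σ : Ψ` for a total substitution `σ`, which is arbitrary outside of `Ψ` and may
also rename global variables. -/
def GSubTy (S : SCtx) (Ψ' : GCtx) (σ : GSub) (Ψ : GCtx) : Prop :=
  ∀ (u : ℕ) (Γ : LCtx) (T : Ty), Ψ[u]? = some (Γ, T) →
    (∃ v, σ u = Sum.inl v ∧ Ψ'[v]? = some (Γ, T)) ∨
      ∃ N, σ u = Sum.inr N ∧ HasTy S Ψ' Γ Layer.zero N T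

/-! ### Typing under local and global substitution -/

section Substitution

variable {S : SCtx} {Ψ Ψ' : GCtx} {Γ Γ' : LCtx} {i : Layer} {M : Tm} {T : Ty} {τ τ' : ℕ → Tm}
  {σ σ' : GSub}

theorem LSubTy.up (h : LSubTy S Ψ Γ' i τ Γ) {U : Ty} (hS : SCtxWF S) (hΨ : GCtxWF Ψ)
    (hΓ : LCtxWF i (U :: Γ')) : LSubTy S Ψ (U :: Γ') i (upL τ) (U :: Γ) := by
  intro x T hx
  cases x with
  | zero =>
    refine ⟨.var 0, .var hS hΨ hΓ ?_⟩
    simpa using hx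
  | succ x =>
    obtain ⟨h₁, h₂⟩ := h x T (by simpa using hx)
    exact ⟨h₁.rename _ _, h₂.rename RenTy.succ RenTy.refl hΓ hΨ⟩

theorem LSubTy.upG (h : LSubTy S Ψ Γ' i τ Γ) {p : LCtx × Ty} (hΨ : GCtxWF (p :: Ψ))
    (hΓ : LCtxWF i Γ') : LSubTy S (p :: Ψ) Γ' i (upG τ) Γ := by
  intro x T hx
  obtain ⟨h₁, h₂⟩ := h x T hx
  exact ⟨h₁.rename _ _, h₂.rename RenTy.refl RenTy.succ hΓ hΨ⟩

theorem LSubTy.nil : LSubTy S Ψ Γ' i τ [] := fun x T h => by simp at h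

theorem LSubTy.var {ρ : ℕ → ℕ} (hS : SCtxWF S) (hΨ : GCtxWF Ψ) (hΓ : LCtxWF i Γ')
    (h : RenTy ρ Γ Γ') : LSubTy S Ψ Γ' i (fun x => Tm.var (ρ x)) Γ :=
  fun x T hx => ⟨.var _, .var hS hΨ hΓ (h x T hx)⟩

theorem LSubTy.lift (h : LSubTy S Ψ Γ' i τ Γ) : LSubTy S Ψ Γ' Layer.one τ Γ :=
  fun x T hx => ⟨(h x T hx).1, (h x T hx).2.lift⟩

theorem LSubTy.mono_store {S' : SCtx} (h : LSubTy S Ψ Γ' i τ Γ) (hS : SCtxSub S S')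
    (hw : SCtxWF S') : LSubTy S' Ψ Γ' i τ Γ :=
  fun x T hx => ⟨(h x T hx).1, (h x T hx).2.mono_store hS hw⟩

theorem GSubTy.mono_store {S' : SCtx} (h : GSubTy S Ψ' σ Ψ) (hS : SCtxSub S S')
    (hw : SCtxWF S') : GSubTy S' Ψ' σ Ψ := by
  intro u Γ T hu
  rcases h u Γ T hu with h | ⟨N, h₁, h₂⟩
  exacts [.inl h, .inr ⟨N, h₁, h₂.mono_store hS hw⟩]

theorem GSubTy.up (h : GSubTy S Ψ' σ Ψ) {p : LCtx × Ty} (hΨ : GCtxWF (p :: Ψ')) :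
    GSubTy S (p :: Ψ') (upGSub σ) (p :: Ψ) := by
  intro u Γ T hu
  cases u with
  | zero => exact .inl ⟨0, rfl, by simpa using hu⟩
  | succ u =>
    rcases h u Γ T (by simpa using hu) with ⟨v, h₁, h₂⟩ | ⟨N, h₁, h₂⟩
    · exact .inl ⟨v + 1, by simp [upGSub, h₁], by simpa using h₂⟩
    · exact .inr ⟨_, by simp [upGSub, h₁], h₂.rename RenTy.refl RenTy.succ h₂.lctxWF hΨ⟩

theorem GSubTy.inl {ξ : ℕ → ℕ} (h : RenTy ξ Ψ Ψ') : GSubTy S Ψ' (fun u => Sum.inl (ξ u)) Ψ :=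
  fun u _ _ hu => .inl ⟨ξ u, rfl, h u _ hu⟩

theorem GSubTy.cons {N : Tm} {Γ : LCtx} {T : Ty} (hN : HasTy S Ψ' Γ Layer.zero N T)
    (h : GSubTy S Ψ' σ Ψ) : GSubTy S Ψ' (gcons N σ) ((Γ, T) :: Ψ) := by
  intro u Γ₁ T₁ hu
  cases u with
  | zero =>
    obtain ⟨rfl, rfl⟩ : Γ = Γ₁ ∧ T = T₁ := by simpa using hu
    exact .inr ⟨N, rfl, hN⟩
  | succ u => exact h u Γ₁ T₁ (by simpa using hu)

theorem GSubTy.nil : GSubTy S Ψ' σ [] := fun u _ _ h => by simp at h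

/-- Variables count as values, so `τ` must send them to values. It is known to do so only on `Γ`,
and typing confines `V` to `Γ`. This keeps the entries of explicit substitutions values. -/
theorem IsValue_lsubst {V : Tm} (hV : V.IsValue) (h : HasTy S Ψ Γ i V T)
    (hτ : ∀ x T, Γ[x]? = some T → (τ x).IsValue) : (V.lsubst τ).IsValue := by
  cases hV with
  | var x => cases h with | var _ _ _ h => exact hτ x _ h
  | _ => constructor

theorem LSubTy.ofFin {n : ℕ} {δ : Fin n → Tm} (hn : Γ.length = n) (hv : ∀ k, (δ k).IsValue)
    (h : ∀ (k : Fin n) (U : Ty), Γ[(k : ℕ)]? = some U → HasTy S Ψ Γ' i (δ k) U) :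
    LSubTy S Ψ Γ' i (ofFin δ) Γ := by
  intro x T hx
  have hlt : x < n := hn ▸ (List.getElem?_eq_some_iff.1 hx).1
  simp only [Tm.ofFin, hlt, dif_pos]
  exact ⟨hv _, h ⟨x, hlt⟩ T hx⟩

theorem HasTy.lsubst (h : HasTy S Ψ Γ i M T) : ∀ {Γ' : LCtx} {τ : ℕ → Tm},
    LSubTy S Ψ Γ' i τ Γ → LCtxWF i Γ' → HasTy S Ψ Γ' i (M.lsubst τ) T := by
  induction h with
  | unit h₁ h₂ h₃ => intro _ _ hτ hΓ; exact .unit h₁ h₂ hΓ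
  | num n h₁ h₂ h₃ => intro _ _ hτ hΓ; exact .num n h₁ h₂ hΓ
  | var h₁ h₂ h₃ h => intro _ _ hτ hΓ; exact (hτ _ _ h).2
  | @gvar _ _ Γ₁ _ _ n δ _ h₁ h₂ h₃ hl hv hδ h ih =>
    intro _ _ hτ hΓ
    refine .gvar h₁ h₂ hΓ hl (fun k => ?_) (fun k U hU => ih k U hU hτ hΓ) h
    -- The typing of `δ` is stated for positions with a declared type; the length equation provides
    -- one for every `k`.
    have hk : Γ₁[(k : ℕ)]? = some _ := List.getElem?_eq_getElem (by omega)
    exact IsValue_lsubst (hv k) (hδ k _ hk) fun x T hx => (hτ x T hx).1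
  | loc h₁ h₂ h₃ hl h => intro _ _ hτ hΓ; exact .loc h₁ h₂ hΓ hl h
  | lam h ih =>
    intro _ _ hτ hΓ
    have hw := hΓ.cons h.lctxWF.head
    exact .lam (ih (hτ.up h.sctxWF h.gctxWF hw) hw)
  | app _ _ ih₁ ih₂ => intro _ _ hτ hΓ; exact .app (ih₁ hτ hΓ) (ih₂ hτ hΓ)
  | recfn h ih =>
    intro _ _ hτ hΓ
    have hw := hΓ.cons h.lctxWF.tail.head
    have hw' := hw.cons h.lctxWF.head
    exact .recfn (ih ((hτ.up h.sctxWF h.gctxWF hw).up h.sctxWF h.gctxWF hw') hw')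
  | arith o _ _ ih₁ ih₂ => intro _ _ hτ hΓ; exact .arith o (ih₁ hτ hΓ) (ih₂ hτ hΓ)
  | ite _ _ _ ih₁ ih₂ ih₃ => intro _ _ hτ hΓ; exact .ite (ih₁ hτ hΓ) (ih₂ hτ hΓ) (ih₃ hτ hΓ)
  | ref _ ih => intro _ _ hτ hΓ; exact .ref (ih hτ hΓ)
  | deref _ ih => intro _ _ hτ hΓ; exact .deref (ih hτ hΓ)
  | assign _ _ ih₁ ih₂ => intro _ _ hτ hΓ; exact .assign (ih₁ hτ hΓ) (ih₂ hτ hΓ)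
  | box h h' ih => intro _ _ hτ hΓ; exact .box hΓ h'
  | letbox _ h ih₁ ih₂ =>
    intro _ _ hτ hΓ; exact .letbox (ih₁ hτ hΓ) (ih₂ (hτ.upG h.gctxWF hΓ) hΓ)

theorem HasTy.gsubst (h : HasTy S Ψ Γ i M T) : ∀ {Ψ' : GCtx} {σ : GSub},
    GSubTy S Ψ' σ Ψ → GCtxWF Ψ' → HasTy S Ψ' Γ i (M.gsubst σ) T := by
  induction h with
  | unit h₁ h₂ h₃ => intro _ _ hσ hΨ; exact .unit h₁ hΨ h₃
  | num n h₁ h₂ h₃ => intro _ _ hσ hΨ; exact .num n h₁ hΨ h₃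
  | var h₁ h₂ h₃ h => intro _ _ hσ hΨ; exact .var h₁ hΨ h₃ h
  | gvar h₁ h₂ h₃ hl hv _ h ih =>
    intro Ψ' σ hσ hΨ
    rcases hσ _ _ _ h with ⟨v, e, hN⟩ | ⟨N, e, hN⟩
    · simp only [Tm.gsubst, e]
      exact .gvar h₁ hΨ h₃ hl (fun k => (hv k).gsubst σ) (fun k U hU => ih k U hU hσ hΨ) hN
    · simp only [Tm.gsubst, e]
      -- The inserted code is typed at layer zero and is first lifted to the layer of the
      -- occurrence; its local variables are then instantiated by `δ[σ]`.
      exact hN.of_zero.lsubst (LSubTy.ofFin hl (fun k => (hv k).gsubst σ)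
        (fun k U hU => ih k U hU hσ hΨ)) h₃
  | loc h₁ h₂ h₃ hl h => intro _ _ hσ hΨ; exact .loc h₁ hΨ h₃ hl h
  | lam _ ih => intro _ _ hσ hΨ; exact .lam (ih hσ hΨ)
  | app _ _ ih₁ ih₂ => intro _ _ hσ hΨ; exact .app (ih₁ hσ hΨ) (ih₂ hσ hΨ)
  | recfn _ ih => intro _ _ hσ hΨ; exact .recfn (ih hσ hΨ)
  | arith o _ _ ih₁ ih₂ => intro _ _ hσ hΨ; exact .arith o (ih₁ hσ hΨ) (ih₂ hσ hΨ)
  | ite _ _ _ ih₁ ih₂ ih₃ => intro _ _ hσ hΨ; exact .ite (ih₁ hσ hΨ) (ih₂ hσ hΨ) (ih₃ hσ hΨ)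
  | ref _ ih => intro _ _ hσ hΨ; exact .ref (ih hσ hΨ)
  | deref _ ih => intro _ _ hσ hΨ; exact .deref (ih hσ hΨ)
  | assign _ _ ih₁ ih₂ => intro _ _ hσ hΨ; exact .assign (ih₁ hσ hΨ) (ih₂ hσ hΨ)
  | box h h' ih => intro _ _ hσ hΨ; exact .box h (ih hσ hΨ)
  | letbox _ h ih₁ ih₂ =>
    intro _ _ hσ hΨ
    have hw := h.gctxWF _ List.mem_cons_self
    have hw' := hΨ.cons hw.1 hw.2
    exact .letbox (ih₁ hσ hΨ) (ih₂ (hσ.up hw') hw')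

theorem LSubTy.comp_gsubst (h : LSubTy S Ψ Γ' i τ Γ) (hσ : GSubTy S Ψ' σ Ψ) (hΨ : GCtxWF Ψ') :
    LSubTy S Ψ' Γ' i (fun x => (τ x).gsubst σ) Γ :=
  fun x T hx => ⟨(h x T hx).1.gsubst σ, (h x T hx).2.gsubst hσ hΨ⟩

theorem LSubTy.comp_lsubst {Γ₂ : LCtx} (h : LSubTy S Ψ Γ' i τ Γ) (h' : LSubTy S Ψ Γ₂ i τ' Γ')
    (hΓ : LCtxWF i Γ₂) : LSubTy S Ψ Γ₂ i (fun x => (τ x).lsubst τ') Γ :=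
  fun x T hx => ⟨IsValue_lsubst (h x T hx).1 (h x T hx).2 fun y U hy => (h' y U hy).1,
    (h x T hx).2.lsubst h' hΓ⟩

theorem GSubTy.comp {Ψ₂ : GCtx} (h : GSubTy S Ψ' σ Ψ) (h' : GSubTy S Ψ₂ σ' Ψ')
    (hΨ : GCtxWF Ψ₂) : GSubTy S Ψ₂ (gcomp σ σ') Ψ := by
  intro u Γ T hu
  rcases h u Γ T hu with ⟨v, e, hv⟩ | ⟨N, e, hN⟩
  · simp only [gcomp, e]
    exact h' v Γ T hv
  · exact .inr ⟨N.gsubst σ', by simp [gcomp, e], hN.gsubst h' hΨ⟩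

/-! ### Equations between substitutions on typed terms -/

theorem upL_congr (h : ∀ x T, Γ[x]? = some T → τ x = τ' x) (U : Ty) (x : ℕ) (T : Ty)
    (hx : (U :: Γ)[x]? = some T) : upL τ x = upL τ' x := by
  cases x with
  | zero => rfl
  | succ x => exact congrArg (Tm.rename Nat.succ id) (h x T (by simpa using hx))

/-- Total substitutions are arbitrary outside the context; typed terms do not see the difference.
With the empty context this gives invariance of closed terms. -/
theorem HasTy.lsubst_congr (h : HasTy S Ψ Γ i M T) : ∀ {τ τ' : ℕ → Tm},
    (∀ x T, Γ[x]? = some T → τ x = τ' x) → M.lsubst τ = M.lsubst τ' := by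
  induction h with
  | var h₁ h₂ h₃ h => intro τ τ' e; exact e _ _ h
  | @gvar _ _ Γ₁ _ _ n δ _ h₁ h₂ h₃ hl hv hδ h ih =>
    intro τ τ' e
    simp only [Tm.lsubst]
    congr 1
    funext k
    have hk : Γ₁[(k : ℕ)]? = some _ := List.getElem?_eq_getElem (by omega)
    exact ih k _ hk e
  | lam _ ih => intro τ τ' e; exact congrArg Tm.lam (ih (upL_congr e _))
  | recfn _ ih => intro τ τ' e; exact congrArg Tm.recfn (ih (upL_congr (upL_congr e _) _))
  | letbox _ _ ih₁ ih₂ =>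
    intro τ τ' e
    simp only [Tm.lsubst]
    rw [ih₁ e, ih₂ (τ := upG τ) (τ' := upG τ')
      fun x T hx => congrArg (Tm.rename id Nat.succ) (e x T hx)]
  | app _ _ ih₁ ih₂ => intro τ τ' e; simp only [Tm.lsubst, ih₁ e, ih₂ e]
  | arith o _ _ ih₁ ih₂ => intro τ τ' e; simp only [Tm.lsubst, ih₁ e, ih₂ e]
  | assign _ _ ih₁ ih₂ => intro τ τ' e; simp only [Tm.lsubst, ih₁ e, ih₂ e]
  | ite _ _ _ ih₁ ih₂ ih₃ => intro τ τ' e; simp only [Tm.lsubst, ih₁ e, ih₂ e, ih₃ e]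
  | ref _ ih => intro τ τ' e; simp only [Tm.lsubst, ih e]
  | deref _ ih => intro τ τ' e; simp only [Tm.lsubst, ih e]
  | _ => intros; rfl

theorem HasTy.gsubst_congr (h : HasTy S Ψ Γ i M T) : ∀ {σ σ' : GSub},
    (∀ u p, Ψ[u]? = some p → σ u = σ' u) → M.gsubst σ = M.gsubst σ' := by
  induction h with
  | @gvar _ _ Γ₁ _ _ n δ _ h₁ h₂ h₃ hl hv hδ h ih =>
    intro τ τ' e
    have hδ : (fun k => (δ k).gsubst τ) = fun k => (δ k).gsubst τ' := by
      funext k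
      have hk : Γ₁[(k : ℕ)]? = some _ := List.getElem?_eq_getElem (by omega)
      exact ih k _ hk e
    simp only [Tm.gsubst, e _ _ h, hδ]
  | letbox _ _ ih₁ ih₂ =>
    intro τ τ' e
    simp only [Tm.gsubst]
    rw [ih₁ e, ih₂ fun u p hu => ?_]
    cases u with
    | zero => rfl
    | succ u => simp only [upGSub, e u p (by simpa using hu)]
  | app _ _ ih₁ ih₂ => intro τ τ' e; simp only [Tm.gsubst, ih₁ e, ih₂ e]
  | arith o _ _ ih₁ ih₂ => intro τ τ' e; simp only [Tm.gsubst, ih₁ e, ih₂ e]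
  | assign _ _ ih₁ ih₂ => intro τ τ' e; simp only [Tm.gsubst, ih₁ e, ih₂ e]
  | ite _ _ _ ih₁ ih₂ ih₃ => intro τ τ' e; simp only [Tm.gsubst, ih₁ e, ih₂ e, ih₃ e]
  | ref _ ih => intro τ τ' e; simp only [Tm.gsubst, ih e]
  | deref _ ih => intro τ τ' e; simp only [Tm.gsubst, ih e]
  | lam _ ih => intro τ τ' e; simp only [Tm.gsubst, ih e]
  | recfn _ ih => intro τ τ' e; simp only [Tm.gsubst, ih e]
  | box _ _ ih => intro τ τ' e; simp only [Tm.gsubst, ih e]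
  | _ => intros; rfl

theorem HasTy.lsubst_closed (h : HasTy S Ψ [] i M T) (τ : ℕ → Tm) : M.lsubst τ = M :=
  (h.lsubst_congr (fun x T hx => by simp at hx)).trans (lsubst_var M)

theorem HasTy.gsubst_closed (h : HasTy S [] Γ i M T) (σ : GSub) : M.gsubst σ = M :=
  (h.gsubst_congr (fun x T hx => by simp at hx)).trans (gsubst_inl M)

theorem HasTy.rename_closed (h : HasTy S [] [] i M T) (ρ ξ : ℕ → ℕ) : M.rename ρ ξ = M := by
  have e : M.rename ρ ξ = (M.rename ρ id).rename id ξ := by rw [rename_rename]; rfl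
  rw [e, rename_eq_lsubst, h.lsubst_closed, rename_eq_gsubst, h.gsubst_closed]

end Substitution

/-! ### Commutation and composition of substitutions on typed terms -/

section SubstitutionLaws

variable {S : SCtx} {Ψ Ψ' : GCtx} {Γ Γ' : LCtx} {i : Layer} {M : Tm} {T : Ty} {τ : ℕ → Tm}
  {σ σ' : GSub}

theorem ofFin_of_lt {n : ℕ} (δ : Fin n → Tm) {x : ℕ} (h : x < n) : ofFin δ x = δ ⟨x, h⟩ := by
  simp [ofFin, h]

theorem lt_of_getElem? {α : Type} {l : List α} {x n : ℕ} {a : α} (h : l[x]? = some a)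
    (hn : l.length = n) : x < n :=
  hn ▸ (List.getElem?_eq_some_iff.1 h).1

/-- Typing is essential at `u^δ`. If the code for `u` had local variables beyond the range of `δ`,
they would become free variables that a renaming of `δ` misses. Well-typed code has none. -/
theorem HasTy.gsubst_rename_local (h : HasTy S Ψ Γ i M T) : ∀ {Ψ' : GCtx} {σ : GSub} (ρ : ℕ → ℕ),
    GSubTy S Ψ' σ Ψ → GCtxWF Ψ' → (M.rename ρ id).gsubst σ = (M.gsubst σ).rename ρ id := by
  induction h with
  | @gvar _ _ Γ₁ _ _ n δ _ h₁ h₂ h₃ hl hv hδ h ih =>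
    intro Ψ' σ ρ hσ hΨ
    have hk : ∀ k : Fin n, ((δ k).rename ρ id).gsubst σ = ((δ k).gsubst σ).rename ρ id :=
      fun k => ih k _ (List.getElem?_eq_getElem (by omega)) ρ hσ hΨ
    rcases hσ _ _ _ h with ⟨v, e, hN⟩ | ⟨N, e, hN⟩
    · simp [Tm.gsubst, Tm.rename, e, hk]
    · simp only [Tm.gsubst, Tm.rename, id, e, hk]
      rw [rename_lsubst, rename_id]
      refine hN.lsubst_congr fun x T hx => ?_
      have hx := lt_of_getElem? hx hl
      simp only [ofFin_of_lt _ hx]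
  | letbox _ h ih₁ ih₂ =>
    intro Ψ' σ ρ hσ hΨ
    have hw := h.gctxWF _ List.mem_cons_self
    have hw' := hΨ.cons hw.1 hw.2
    simp only [Tm.gsubst, Tm.rename, upRen_id]
    rw [ih₁ ρ hσ hΨ, ih₂ ρ (hσ.up hw') hw']
  | app _ _ ih₁ ih₂ =>
    intro _ _ ρ hσ hΨ; simp only [Tm.gsubst, Tm.rename, ih₁ _ hσ hΨ, ih₂ _ hσ hΨ]
  | arith o _ _ ih₁ ih₂ =>
    intro _ _ ρ hσ hΨ; simp only [Tm.gsubst, Tm.rename, ih₁ _ hσ hΨ, ih₂ _ hσ hΨ]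
  | assign _ _ ih₁ ih₂ =>
    intro _ _ ρ hσ hΨ; simp only [Tm.gsubst, Tm.rename, ih₁ _ hσ hΨ, ih₂ _ hσ hΨ]
  | ite _ _ _ ih₁ ih₂ ih₃ =>
    intro _ _ ρ hσ hΨ
    simp only [Tm.gsubst, Tm.rename, ih₁ _ hσ hΨ, ih₂ _ hσ hΨ, ih₃ _ hσ hΨ]
  | ref _ ih => intro _ _ ρ hσ hΨ; simp only [Tm.gsubst, Tm.rename, ih _ hσ hΨ]
  | deref _ ih => intro _ _ ρ hσ hΨ; simp only [Tm.gsubst, Tm.rename, ih _ hσ hΨ]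
  | lam _ ih => intro _ _ ρ hσ hΨ; simp only [Tm.gsubst, Tm.rename, ih _ hσ hΨ]
  | recfn _ ih => intro _ _ ρ hσ hΨ; simp only [Tm.gsubst, Tm.rename, ih _ hσ hΨ]
  | box _ _ ih => intro _ _ ρ hσ hΨ; simp only [Tm.gsubst, Tm.rename, rename_id]
  | _ => intros; rfl

theorem HasTy.gsubst_upL (hτ : LSubTy S Ψ Γ' i τ Γ) (hσ : GSubTy S Ψ' σ Ψ) (hΨ : GCtxWF Ψ')
    (U : Ty) (x : ℕ) (T : Ty) (hx : (U :: Γ)[x]? = some T) :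
    (upL τ x).gsubst σ = upL (fun x => (τ x).gsubst σ) x := by
  cases x with
  | zero => rfl
  | succ x => exact (hτ x T (by simpa using hx)).2.gsubst_rename_local Nat.succ hσ hΨ

theorem gsubst_upG (τ : ℕ → Tm) (σ : GSub) :
    (fun x => (upG τ x).gsubst (upGSub σ)) = upG (fun x => (τ x).gsubst σ) := by
  funext x
  simp only [upG, gsubst_rename, rename_gsubst]
  rfl

/-- At a replaced global variable both sides are instances of the same code, with entries `δ[τ][σ]`
on one side and `δ[σ][τ[σ]]` on the other. The induction hypothesis identifies these entries, and
typing of the code makes all other indices irrelevant. -/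
theorem HasTy.gsubst_lsubst (h : HasTy S Ψ Γ i M T) : ∀ {Ψ' : GCtx} {Γ' : LCtx} {σ : GSub}
    {τ : ℕ → Tm}, LSubTy S Ψ Γ' i τ Γ → LCtxWF i Γ' → GSubTy S Ψ' σ Ψ → GCtxWF Ψ' →
    (M.lsubst τ).gsubst σ = (M.gsubst σ).lsubst (fun x => (τ x).gsubst σ) := by
  induction h with
  | @gvar _ _ Γ₁ _ _ n δ _ h₁ h₂ h₃ hl hv hδ h ih =>
    intro Ψ' Γ' σ τ hτ hΓ hσ hΨ
    have hk : ∀ k : Fin n, ((δ k).lsubst τ).gsubst σ =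
        ((δ k).gsubst σ).lsubst (fun x => (τ x).gsubst σ) :=
      fun k => ih k _ (List.getElem?_eq_getElem (by omega)) hτ hΓ hσ hΨ
    rcases hσ _ _ _ h with ⟨v, e, hN⟩ | ⟨N, e, hN⟩
    · simp [Tm.gsubst, Tm.lsubst, e, hk]
    · simp only [Tm.gsubst, Tm.lsubst, e, hk]
      rw [lsubst_lsubst]
      refine hN.lsubst_congr fun x T hx => ?_
      have hx := lt_of_getElem? hx hl
      simp only [ofFin_of_lt _ hx]
  | letbox _ h ih₁ ih₂ =>
    intro Ψ' Γ' σ τ hτ hΓ hσ hΨ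
    have hw := h.gctxWF _ List.mem_cons_self
    have hw' := hΨ.cons hw.1 hw.2
    simp only [Tm.gsubst, Tm.lsubst]
    rw [ih₁ hτ hΓ hσ hΨ, ih₂ (hτ.upG h.gctxWF hΓ) hΓ (hσ.up hw') hw', gsubst_upG]
  | app _ _ ih₁ ih₂ =>
    intro _ _ _ _ hτ hΓ hσ hΨ
    simp only [Tm.gsubst, Tm.lsubst, ih₁ hτ hΓ hσ hΨ, ih₂ hτ hΓ hσ hΨ]
  | arith o _ _ ih₁ ih₂ =>
    intro _ _ _ _ hτ hΓ hσ hΨ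
    simp only [Tm.gsubst, Tm.lsubst, ih₁ hτ hΓ hσ hΨ, ih₂ hτ hΓ hσ hΨ]
  | assign _ _ ih₁ ih₂ =>
    intro _ _ _ _ hτ hΓ hσ hΨ
    simp only [Tm.gsubst, Tm.lsubst, ih₁ hτ hΓ hσ hΨ, ih₂ hτ hΓ hσ hΨ]
  | ite _ _ _ ih₁ ih₂ ih₃ =>
    intro _ _ _ _ hτ hΓ hσ hΨ
    simp only [Tm.gsubst, Tm.lsubst, ih₁ hτ hΓ hσ hΨ, ih₂ hτ hΓ hσ hΨ, ih₃ hτ hΓ hσ hΨ]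
  | ref _ ih => intro _ _ _ _ hτ hΓ hσ hΨ; simp only [Tm.gsubst, Tm.lsubst, ih hτ hΓ hσ hΨ]
  | deref _ ih => intro _ _ _ _ hτ hΓ hσ hΨ; simp only [Tm.gsubst, Tm.lsubst, ih hτ hΓ hσ hΨ]
  | lam h ih =>
    intro _ _ _ _ hτ hΓ hσ hΨ
    have hw := hΓ.cons h.lctxWF.head
    simp only [Tm.gsubst, Tm.lsubst]
    rw [ih (hτ.up h.sctxWF h.gctxWF hw) hw hσ hΨ,
      (h.gsubst hσ hΨ).lsubst_congr (HasTy.gsubst_upL hτ hσ hΨ _)]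
  | recfn h ih =>
    intro _ _ _ _ hτ hΓ hσ hΨ
    have hw := hΓ.cons h.lctxWF.tail.head
    have hw' := hw.cons h.lctxWF.head
    have hτ' := hτ.up h.sctxWF h.gctxWF hw
    simp only [Tm.gsubst, Tm.lsubst]
    rw [ih (hτ'.up h.sctxWF h.gctxWF hw') hw' hσ hΨ,
      (h.gsubst hσ hΨ).lsubst_congr (HasTy.gsubst_upL hτ' hσ hΨ _),
      (h.gsubst hσ hΨ).lsubst_congr (upL_congr (HasTy.gsubst_upL hτ hσ hΨ _) _)]
  | _ => intros; rfl

/-- At a replaced global variable the second substitution meets code that has already been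
instantiated locally, so composition rests on `HasTy.gsubst_lsubst`. -/
theorem HasTy.gsubst_gsubst (h : HasTy S Ψ Γ i M T) : ∀ {Ψ' Ψ₂ : GCtx} {σ σ' : GSub},
    GSubTy S Ψ' σ Ψ → GCtxWF Ψ' → GSubTy S Ψ₂ σ' Ψ' → GCtxWF Ψ₂ →
    (M.gsubst σ).gsubst σ' = M.gsubst (gcomp σ σ') := by
  induction h with
  | @gvar _ _ Γ₁ _ _ n δ _ h₁ h₂ h₃ hl hv hδ h ih =>
    intro Ψ' Ψ₂ σ σ' hσ hΨ hσ' hΨ₂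
    have hk : ∀ k : Fin n, ((δ k).gsubst σ).gsubst σ' = (δ k).gsubst (gcomp σ σ') :=
      fun k => ih k _ (List.getElem?_eq_getElem (by omega)) hσ hΨ hσ' hΨ₂
    rcases hσ _ _ _ h with ⟨v, e, hN⟩ | ⟨N, e, hN⟩
    · simp only [Tm.gsubst, gcomp, e, hk]
    · have hδσ : LSubTy S Ψ' _ _ (ofFin fun k => (δ k).gsubst σ) Γ₁ :=
        LSubTy.ofFin hl (fun k => (hv k).gsubst σ) (fun k U hU => (hδ k U hU).gsubst hσ hΨ)
      simp only [Tm.gsubst, gcomp, e, ← hk]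
      rw [hN.of_zero.gsubst_lsubst hδσ h₃ hσ' hΨ₂]
      congr 1
      funext x
      exact (ofFin_map _ (Tm.gsubst σ') (fun _ => rfl) x).symm
  | letbox _ h ih₁ ih₂ =>
    intro Ψ' Ψ₂ σ σ' hσ hΨ hσ' hΨ₂
    have hw := h.gctxWF _ List.mem_cons_self
    have hw₁ := hΨ.cons hw.1 hw.2
    have hw₂ := hΨ₂.cons hw.1 hw.2
    simp only [Tm.gsubst]
    rw [ih₁ hσ hΨ hσ' hΨ₂, ih₂ (hσ.up hw₁) hw₁ (hσ'.up hw₂) hw₂, upGSub_gcomp]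
  | app _ _ ih₁ ih₂ =>
    intro _ _ _ _ hσ hΨ hσ' hΨ₂; simp only [Tm.gsubst, ih₁ hσ hΨ hσ' hΨ₂, ih₂ hσ hΨ hσ' hΨ₂]
  | arith o _ _ ih₁ ih₂ =>
    intro _ _ _ _ hσ hΨ hσ' hΨ₂; simp only [Tm.gsubst, ih₁ hσ hΨ hσ' hΨ₂, ih₂ hσ hΨ hσ' hΨ₂]
  | assign _ _ ih₁ ih₂ =>
    intro _ _ _ _ hσ hΨ hσ' hΨ₂; simp only [Tm.gsubst, ih₁ hσ hΨ hσ' hΨ₂, ih₂ hσ hΨ hσ' hΨ₂]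
  | ite _ _ _ ih₁ ih₂ ih₃ =>
    intro _ _ _ _ hσ hΨ hσ' hΨ₂
    simp only [Tm.gsubst, ih₁ hσ hΨ hσ' hΨ₂, ih₂ hσ hΨ hσ' hΨ₂, ih₃ hσ hΨ hσ' hΨ₂]
  | ref _ ih => intro _ _ _ _ hσ hΨ hσ' hΨ₂; simp only [Tm.gsubst, ih hσ hΨ hσ' hΨ₂]
  | deref _ ih => intro _ _ _ _ hσ hΨ hσ' hΨ₂; simp only [Tm.gsubst, ih hσ hΨ hσ' hΨ₂]
  | lam _ ih => intro _ _ _ _ hσ hΨ hσ' hΨ₂; simp only [Tm.gsubst, ih hσ hΨ hσ' hΨ₂]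
  | recfn _ ih => intro _ _ _ _ hσ hΨ hσ' hΨ₂; simp only [Tm.gsubst, ih hσ hΨ hσ' hΨ₂]
  | box _ _ ih => intro _ _ _ _ hσ hΨ hσ' hΨ₂; simp only [Tm.gsubst, ih hσ hΨ hσ' hΨ₂]
  | _ => intros; rfl

end SubstitutionLaws

/-! ### A stack machine -/

/-- The elementary evaluation contexts. -/
inductive Frame : Type
  | appL : Tm → Frame
  | appR : Tm → Frame
  | arithL : ArithOp → Tm → Frame
  | arithR : ArithOp → Tm → Frame
  | ite : Tm → Tm → Frame
  | ref : Frame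
  | deref : Frame
  | assignL : Tm → Frame
  | assignR : Tm → Frame
  | letbox : Tm → Frame

/-- `Halts K M h`: the evaluation of `M` in the stack `K`, whose head is the innermost frame,
terminates from the heap `h`. -/
inductive Halts : List Frame → Tm → Heap → Prop
  | done {V : Tm} {h : Heap} : V.IsValue → Halts [] V h
  | app {K : List Frame} {M N : Tm} {h : Heap} :
      Halts (.appL N :: K) M h → Halts K (.app M N) h
  | arith {K : List Frame} {o : ArithOp} {M N : Tm} {h : Heap} :
      Halts (.arithL o N :: K) M h → Halts K (.arith o M N) h
  | ite {K : List Frame} {M N₁ N₂ : Tm} {h : Heap} :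
      Halts (.ite N₁ N₂ :: K) M h → Halts K (.ite M N₁ N₂) h
  | ref {K : List Frame} {M : Tm} {h : Heap} : Halts (.ref :: K) M h → Halts K (.ref M) h
  | deref {K : List Frame} {M : Tm} {h : Heap} : Halts (.deref :: K) M h → Halts K (.deref M) h
  | assign {K : List Frame} {M N : Tm} {h : Heap} :
      Halts (.assignL N :: K) M h → Halts K (.assign M N) h
  | letbox {K : List Frame} {M N : Tm} {h : Heap} :
      Halts (.letbox N :: K) M h → Halts K (.letbox M N) h
  | appL {K : List Frame} {V N : Tm} {h : Heap} : V.IsValue →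
      Halts (.appR V :: K) N h → Halts (.appL N :: K) V h
  | beta {K : List Frame} {M V : Tm} {h : Heap} : V.IsValue →
      Halts K (M.lsubst (scons V var)) h → Halts (.appR (.lam M) :: K) V h
  | recfn {K : List Frame} {M V : Tm} {h : Heap} : V.IsValue →
      Halts K (M.lsubst (scons V (scons (.recfn M) var))) h →
      Halts (.appR (.recfn M) :: K) V h
  | arithL {K : List Frame} {o : ArithOp} {V N : Tm} {h : Heap} : V.IsValue →
      Halts (.arithR o V :: K) N h → Halts (.arithL o N :: K) V h
  | arithR {K : List Frame} {o : ArithOp} {m n : ℕ} {h : Heap} :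
      Halts K (.num (o.eval m n)) h → Halts (.arithR o (.num m) :: K) (.num n) h
  | iteTrue {K : List Frame} {n : ℕ} {N₁ N₂ : Tm} {h : Heap} : n ≠ 0 →
      Halts K N₁ h → Halts (.ite N₁ N₂ :: K) (.num n) h
  | iteFalse {K : List Frame} {N₁ N₂ : Tm} {h : Heap} :
      Halts K N₂ h → Halts (.ite N₁ N₂ :: K) (.num 0) h
  | alloc {K : List Frame} {V : Tm} {h : Heap} {l : ℕ} : V.IsValue → l ∉ h →
      Halts K (.loc l) (h.insert l V) → Halts (.ref :: K) V h
  | load {K : List Frame} {V : Tm} {h : Heap} {l : ℕ} : h.lookup l = some V →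
      Halts K V h → Halts (.deref :: K) (.loc l) h
  | assignL {K : List Frame} {V N : Tm} {h : Heap} : V.IsValue →
      Halts (.assignR V :: K) N h → Halts (.assignL N :: K) V h
  | assignR {K : List Frame} {V : Tm} {h : Heap} {l : ℕ} : V.IsValue → l ∈ h →
      Halts K .unit (h.insert l V) → Halts (.assignR (.loc l) :: K) V h
  | unbox {K : List Frame} {M N : Tm} {h : Heap} :
      Halts K (N.gsubst (gcons M Sum.inl)) h → Halts (.letbox N :: K) (.box M) h

/-- `Frame.Wf F`: the terms in the positions of values are values. -/
def Frame.Wf : Frame → Prop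
  | appR V => V.IsValue
  | arithR _ V => V.IsValue
  | assignR V => V.IsValue
  | _ => True

/-- The term obtained by filling a frame. -/
def Frame.fill : Frame → Tm → Tm
  | appL N, M => .app M N
  | appR V, M => .app V M
  | arithL o N, M => .arith o M N
  | arithR o V, M => .arith o V M
  | ite N₁ N₂, M => .ite M N₁ N₂
  | ref, M => .ref M
  | deref, M => .deref M
  | assignL N, M => .assign M N
  | assignR V, M => .assign V M
  | letbox N, M => .letbox M N

/-- The term obtained by filling a stack. -/
def fillStack (K : List Frame) (M : Tm) : Tm := K.foldl (fun M F => F.fill M) M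

theorem Frame.not_isValue_fill (F : Frame) (M : Tm) : ¬ (F.fill M).IsValue := by
  intro h
  cases F <;> cases h

/-- Filling and pushing a frame agree for the machine. For frames with a value on the left, the
machine passes through the corresponding left frame, where that value is immediately returned. -/
theorem halts_frame {F : Frame} (hF : F.Wf) (K : List Frame) (M : Tm) (h : Heap) :
    Halts K (F.fill M) h ↔ Halts (F :: K) M h := by
  have hn := F.not_isValue_fill M
  constructor
  · intro H
    cases F with
    | appR V =>
      cases H with
      -- `V` is now in focus under a left frame. Since it is a value, only the rule passing to the
      -- right frame remains; the rules that decompose a term contradict `hF`.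
      | app H => cases H <;> first | assumption | cases hF
      | _ => exact absurd (by assumption) hn
    | arithR o V =>
      cases H with
      | arith H => cases H <;> first | assumption | cases hF
      | _ => exact absurd (by assumption) hn
    | assignR V =>
      cases H with
      | assign H => cases H <;> first | assumption | cases hF
      | _ => exact absurd (by assumption) hn
    | _ => cases H <;> first | assumption | exact absurd (by assumption) hn
  · intro H
    cases F with
    | appR V => exact .app (.appL hF H)
    | arithR o V => exact .arith (.arithL hF H)
    | assignR V => exact .assign (.assignL hF H)
    | appL => exact .app H
    | arithL => exact .arith H
    | ite => exact .ite H
    | ref => exact .ref H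
    | deref => exact .deref H
    | assignL => exact .assign H
    | letbox => exact .letbox H

/-- The stack of an evaluation context on top of `Ks`. -/
def ECtx.stack : ECtx → List Frame → List Frame
  | hole, Ks => Ks
  | appL K N, Ks => K.stack (.appL N :: Ks)
  | appR V _ K, Ks => K.stack (.appR V :: Ks)
  | arithL o K N, Ks => K.stack (.arithL o N :: Ks)
  | arithR o V _ K, Ks => K.stack (.arithR o V :: Ks)
  | ite K N₁ N₂, Ks => K.stack (.ite N₁ N₂ :: Ks)
  | ref K, Ks => K.stack (.ref :: Ks)
  | deref K, Ks => K.stack (.deref :: Ks)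
  | assignL K N, Ks => K.stack (.assignL N :: Ks)
  | assignR V _ K, Ks => K.stack (.assignR V :: Ks)
  | letbox K N, Ks => K.stack (.letbox N :: Ks)

theorem halts_fill (K : ECtx) (M : Tm) (h : Heap) : ∀ Ks : List Frame,
    Halts Ks (K.fill M) h ↔ Halts (K.stack Ks) M h := by
  induction K with
  | hole => exact fun _ => Iff.rfl
  | appL K N ih => exact fun Ks => (halts_frame (F := .appL N) trivial _ _ _).trans (ih _)
  | appR V hV K ih => exact fun Ks => (halts_frame (F := .appR V) hV _ _ _).trans (ih _)
  | arithL o K N ih => exact fun Ks => (halts_frame (F := .arithL o N) trivial _ _ _).trans (ih _)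
  | arithR o V hV K ih => exact fun Ks => (halts_frame (F := .arithR o V) hV _ _ _).trans (ih _)
  | ite K N₁ N₂ ih => exact fun Ks => (halts_frame (F := .ite N₁ N₂) trivial _ _ _).trans (ih _)
  | ref K ih => exact fun Ks => (halts_frame (F := .ref) trivial _ _ _).trans (ih _)
  | deref K ih => exact fun Ks => (halts_frame (F := .deref) trivial _ _ _).trans (ih _)
  | assignL K N ih => exact fun Ks => (halts_frame (F := .assignL N) trivial _ _ _).trans (ih _)
  | assignR V hV K ih => exact fun Ks => (halts_frame (F := .assignR V) hV _ _ _).trans (ih _)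
  | letbox K N ih => exact fun Ks => (halts_frame (F := .letbox N) trivial _ _ _).trans (ih _)

/-- Halting is closed under backward reduction in every stack, so no determinism is needed; in
particular the free choice of locations in allocation is harmless. -/
theorem Step.halts {c c' : Tm × Heap} (h : Step c c') : ∀ Ks : List Frame,
    Halts Ks c'.1 c'.2 → Halts Ks c.1 c.2 := by
  induction h with
  | beta hV => exact fun Ks H => .app (.appL (.lam _) (.beta hV H))
  | arith o m n => exact fun Ks H => .arith (.arithL (.num _) (.arithR H))
  | iteTrue hn => exact fun Ks H => .ite (.iteTrue hn H)
  | iteFalse => exact fun Ks H => .ite (.iteFalse H)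
  | ref hV hl => exact fun Ks H => .ref (.alloc hV hl H)
  | deref hl => exact fun Ks H => .deref (.load hl H)
  | assign hV hl => exact fun Ks H => .assign (.assignL (.loc _) (.assignR hV hl H))
  | recfn hV => exact fun Ks H => .app (.appL (.recfn _) (.recfn hV H))
  | letbox => exact fun Ks H => .letbox (.unbox H)
  | ktx K _ ih => exact fun Ks H => (halts_fill _ _ _ _).2 (ih _ ((halts_fill _ _ _ _).1 H))

theorem Converges.halts {M : Tm} {h : Heap} (H : Converges M h) : Halts [] M h := by
  obtain ⟨V, h', hV, H⟩ := H
  have key : ∀ c : Tm × Heap, Relation.ReflTransGen Step c (V, h') → Halts [] c.1 c.2 := by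
    intro c hc
    induction hc using Relation.ReflTransGen.head_induction_on with
    | refl => exact .done hV
    | head h₁ _ ih => exact h₁.halts _ ih
  exact key _ H

theorem Step.fill_frame {F : Frame} (hF : F.Wf) {M M' : Tm} {h h' : Heap}
    (H : Step (M, h) (M', h')) : Step (F.fill M, h) (F.fill M', h') := by
  cases F with
  | appL N => exact .ktx (.appL .hole N) H
  | appR V => exact .ktx (.appR V hF .hole) H
  | arithL o N => exact .ktx (.arithL o .hole N) H
  | arithR o V => exact .ktx (.arithR o V hF .hole) H
  | ite N₁ N₂ => exact .ktx (.ite .hole N₁ N₂) H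
  | ref => exact .ktx (.ref .hole) H
  | deref => exact .ktx (.deref .hole) H
  | assignL N => exact .ktx (.assignL .hole N) H
  | assignR V => exact .ktx (.assignR V hF .hole) H
  | letbox N => exact .ktx (.letbox .hole N) H

theorem Step.fillStack {K : List Frame} : ∀ {M M' : Tm} {h h' : Heap},
    (∀ F ∈ K, F.Wf) → Step (M, h) (M', h') → Step (fillStack K M, h) (fillStack K M', h') := by
  induction K with
  | nil => exact fun _ H => H
  | cons F K ih =>
    exact fun hK H => ih (fun G hG => hK G (List.mem_cons_of_mem _ hG))
      (H.fill_frame (hK F List.mem_cons_self))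

theorem Converges.step {M M' : Tm} {h h' : Heap} (H : Step (M, h) (M', h'))
    (H' : Converges M' h') : Converges M h := by
  obtain ⟨V, h₁, hV, H'⟩ := H'
  exact ⟨V, h₁, hV, .head H H'⟩

theorem Converges.step_frame {F : Frame} {K : List Frame} {V M : Tm} {h h' : Heap}
    (hK : ∀ G ∈ F :: K, G.Wf) (H : Step (F.fill V, h) (M, h'))
    (ih : (∀ G ∈ K, G.Wf) → Converges (fillStack K M) h') :
    Converges (fillStack (F :: K) V) h :=
  have hK := (List.forall_mem_cons.1 hK).2
  show Converges (fillStack K (F.fill V)) h from .step (Step.fillStack hK H) (ih hK)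

/-- Rules that move the focus leave the filled term unchanged; the other rules are single reductions
inside the stack. Well-formed frames are needed for the stack to be an evaluation context. -/
theorem Halts.converges {K : List Frame} {M : Tm} {h : Heap} (H : Halts K M h) :
    (∀ F ∈ K, F.Wf) → Converges (fillStack K M) h := by
  induction H with
  | done hV => exact fun _ => ⟨_, _, hV, .refl⟩
  | app _ ih => exact fun hK => ih (List.forall_mem_cons.2 ⟨trivial, hK⟩)
  | arith _ ih => exact fun hK => ih (List.forall_mem_cons.2 ⟨trivial, hK⟩)
  | ite _ ih => exact fun hK => ih (List.forall_mem_cons.2 ⟨trivial, hK⟩)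
  | ref _ ih => exact fun hK => ih (List.forall_mem_cons.2 ⟨trivial, hK⟩)
  | deref _ ih => exact fun hK => ih (List.forall_mem_cons.2 ⟨trivial, hK⟩)
  | assign _ ih => exact fun hK => ih (List.forall_mem_cons.2 ⟨trivial, hK⟩)
  | letbox _ ih => exact fun hK => ih (List.forall_mem_cons.2 ⟨trivial, hK⟩)
  | appL hV _ ih =>
    exact fun hK => ih (List.forall_mem_cons.2 ⟨hV, (List.forall_mem_cons.1 hK).2⟩)
  | arithL hV _ ih =>
    exact fun hK => ih (List.forall_mem_cons.2 ⟨hV, (List.forall_mem_cons.1 hK).2⟩)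
  | assignL hV _ ih =>
    exact fun hK => ih (List.forall_mem_cons.2 ⟨hV, (List.forall_mem_cons.1 hK).2⟩)
  | beta hV _ ih => exact fun hK => .step_frame hK (.beta hV) ih
  | recfn hV _ ih => exact fun hK => .step_frame hK (.recfn hV) ih
  | arithR _ ih => exact fun hK => .step_frame hK (.arith _ _ _) ih
  | iteTrue hn _ ih => exact fun hK => .step_frame hK (.iteTrue hn) ih
  | iteFalse _ ih => exact fun hK => .step_frame hK .iteFalse ih
  | alloc hV hl _ ih => exact fun hK => .step_frame hK (.ref hV hl) ih
  | load hl _ ih => exact fun hK => .step_frame hK (.deref hl) ih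
  | assignR hV hl _ ih => exact fun hK => .step_frame hK (.assign hV hl) ih
  | unbox _ ih => exact fun hK => .step_frame hK .letbox ih

theorem converges_iff_halts (M : Tm) (h : Heap) : Converges M h ↔ Halts [] M h :=
  ⟨Converges.halts, fun H => H.converges (fun _ h => nomatch h)⟩

/-! ### Closed instances of use for the stack machine -/

/-- The extension to frames of a relation between terms without free local variables. -/
inductive FrameRel (R : GCtx → Tm → Tm → Ty → Prop) : Frame → Frame → Ty → Ty → Prop
  | appL {N N' : Tm} {A B : Ty} : R [] N N' A → FrameRel R (.appL N) (.appL N') (.arrow A B) B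
  | appR {V V' : Tm} {A B : Ty} : V.IsValue → V'.IsValue → R [] V V' (.arrow A B) →
      FrameRel R (.appR V) (.appR V') A B
  | arithL {o : ArithOp} {N N' : Tm} : R [] N N' .int →
      FrameRel R (.arithL o N) (.arithL o N') .int .int
  | arithR {o : ArithOp} {V V' : Tm} : V.IsValue → V'.IsValue → R [] V V' .int →
      FrameRel R (.arithR o V) (.arithR o V') .int .int
  | ite {N₁ N₁' N₂ N₂' : Tm} {T : Ty} : R [] N₁ N₁' T → R [] N₂ N₂' T →
      FrameRel R (.ite N₁ N₂) (.ite N₁' N₂') .int T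
  | ref {T : Ty} : FrameRel R .ref .ref T (.ref T)
  | deref {T : Ty} : FrameRel R .deref .deref (.ref T) T
  | assignL {N N' : Tm} {T : Ty} : R [] N N' T →
      FrameRel R (.assignL N) (.assignL N') (.ref T) .unit
  | assignR {V V' : Tm} {T : Ty} : V.IsValue → V'.IsValue → R [] V V' (.ref T) →
      FrameRel R (.assignR V) (.assignR V') T .unit
  | letbox {N N' : Tm} {Γ : LCtx} {T T' : Ty} : R [(Γ, T)] N N' T' →
      FrameRel R (.letbox N) (.letbox N') (.box Γ T) T'

/-- The extension to stacks of a relation between terms without free local variables. -/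
inductive StackRel (R : GCtx → Tm → Tm → Ty → Prop) : List Frame → List Frame → Ty → Prop
  | nil {T : Ty} : StackRel R [] [] T
  | cons {F F' : Frame} {K K' : List Frame} {A B : Ty} :
      FrameRel R F F' A B → StackRel R K K' B → StackRel R (F :: K) (F' :: K') A

section StackRel

variable {R R' : GCtx → Tm → Tm → Ty → Prop}

theorem FrameRel.mono (h : ∀ Ψ M N T, R Ψ M N T → R' Ψ M N T) {F F' : Frame} {A B : Ty}
    (H : FrameRel R F F' A B) : FrameRel R' F F' A B := by
  cases H with
  | appL h₁ => exact .appL (h _ _ _ _ h₁)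
  | appR hV hV' h₁ => exact .appR hV hV' (h _ _ _ _ h₁)
  | arithL h₁ => exact .arithL (h _ _ _ _ h₁)
  | arithR hV hV' h₁ => exact .arithR hV hV' (h _ _ _ _ h₁)
  | ite h₁ h₂ => exact .ite (h _ _ _ _ h₁) (h _ _ _ _ h₂)
  | ref => exact .ref
  | deref => exact .deref
  | assignL h₁ => exact .assignL (h _ _ _ _ h₁)
  | assignR hV hV' h₁ => exact .assignR hV hV' (h _ _ _ _ h₁)
  | letbox h₁ => exact .letbox (h _ _ _ _ h₁)

theorem StackRel.mono (h : ∀ Ψ M N T, R Ψ M N T → R' Ψ M N T) {K K' : List Frame} {T : Ty}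
    (H : StackRel R K K' T) : StackRel R' K K' T := by
  induction H with
  | nil => exact .nil
  | cons hF _ ih => exact .cons (hF.mono h) ih

theorem FrameRel.right (h : ∀ Ψ M N T, R Ψ M N T → R' Ψ N N T) {F F' : Frame} {A B : Ty}
    (H : FrameRel R F F' A B) : FrameRel R' F' F' A B := by
  cases H with
  | appL h₁ => exact .appL (h _ _ _ _ h₁)
  | appR _ hV' h₁ => exact .appR hV' hV' (h _ _ _ _ h₁)
  | arithL h₁ => exact .arithL (h _ _ _ _ h₁)
  | arithR _ hV' h₁ => exact .arithR hV' hV' (h _ _ _ _ h₁)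
  | ite h₁ h₂ => exact .ite (h _ _ _ _ h₁) (h _ _ _ _ h₂)
  | ref => exact .ref
  | deref => exact .deref
  | assignL h₁ => exact .assignL (h _ _ _ _ h₁)
  | assignR _ hV' h₁ => exact .assignR hV' hV' (h _ _ _ _ h₁)
  | letbox h₁ => exact .letbox (h _ _ _ _ h₁)

theorem StackRel.right (h : ∀ Ψ M N T, R Ψ M N T → R' Ψ N N T) {K K' : List Frame} {T : Ty}
    (H : StackRel R K K' T) : StackRel R' K' K' T := by
  induction H with
  | nil => exact .nil
  | cons hF _ ih => exact .cons (hF.right h) ih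

end StackRel

/-- Typing of stacks by the type of the hole. -/
abbrev StackTy (S : SCtx) (K : List Frame) (T : Ty) : Prop :=
  StackRel (fun Ψ M _ T => HasTy S Ψ [] Layer.one M T) K K T

/-- Approximation of typed terms in all closed instances of use, where the local substitution is
typed at layer one irrespective of the layer of the terms. -/
def Ciu (S : SCtx) (Ψ : GCtx) (Γ : LCtx) (i : Layer) (M N : Tm) (T : Ty) : Prop :=
  HasTy S Ψ Γ i M T ∧ HasTy S Ψ Γ i N T ∧
    ∀ (S' : SCtx) (σ : GSub) (τ : ℕ → Tm) (K : List Frame) (h : Heap),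
      SCtxSub S S' → SCtxWF S' → GSubTy S' [] σ Ψ → LSubTy S' [] [] Layer.one τ Γ →
      StackTy S' K T → HeapHasTy S' [] [] h →
      Halts K ((M.gsubst σ).lsubst τ) h → Halts K ((N.gsubst σ).lsubst τ) h

theorem SCtxSub.refl (S : SCtx) : SCtxSub S S := fun _ _ h => h

theorem SCtxSub.trans {S S' S'' : SCtx} (h : SCtxSub S S') (h' : SCtxSub S' S'') :
    SCtxSub S S'' := fun l T hl => h' l T (h l T hl)

namespace Ciu

variable {S : SCtx} {Ψ Ψ' : GCtx} {Γ Γ' : LCtx} {i : Layer} {M N P : Tm} {T : Ty}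

theorem refl (h : HasTy S Ψ Γ i M T) : Ciu S Ψ Γ i M M T :=
  ⟨h, h, fun _ _ _ _ _ _ _ _ _ _ _ H => H⟩

theorem trans (h : Ciu S Ψ Γ i M N T) (h' : Ciu S Ψ Γ i N P T) : Ciu S Ψ Γ i M P T :=
  ⟨h.1, h'.2.1, fun S' σ τ K hp h₁ h₂ h₃ h₄ h₅ h₆ H =>
    h'.2.2 S' σ τ K hp h₁ h₂ h₃ h₄ h₅ h₆ (h.2.2 S' σ τ K hp h₁ h₂ h₃ h₄ h₅ h₆ H)⟩

/-- The tests in `Ciu` do not mention `i`, so only the typings change. This is the reason for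
testing with layer-one substitutions throughout. -/
theorem lift (h : Ciu S Ψ Γ i M N T) : Ciu S Ψ Γ Layer.one M N T :=
  ⟨h.1.lift, h.2.1.lift, h.2.2⟩

theorem mono_store {S' : SCtx} (h : Ciu S Ψ Γ i M N T) (hS : SCtxSub S S') (hw : SCtxWF S') :
    Ciu S' Ψ Γ i M N T :=
  ⟨h.1.mono_store hS hw, h.2.1.mono_store hS hw,
    fun S'' σ τ K hp h₁ => h.2.2 S'' σ τ K hp (hS.trans h₁)⟩

/-- A test `(σ, θ)` of the instances is the test `(σ, τ[σ][θ])` of the original terms. -/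
theorem lsubst {τ : ℕ → Tm} (h : Ciu S Ψ Γ i M N T) (hτ : LSubTy S Ψ Γ' i τ Γ)
    (hΓ : LCtxWF i Γ') : Ciu S Ψ Γ' i (M.lsubst τ) (N.lsubst τ) T := by
  refine ⟨h.1.lsubst hτ hΓ, h.2.1.lsubst hτ hΓ, fun S' σ θ K hp h₁ h₂ hσ hθ hK hh H => ?_⟩
  have hτ' := hτ.mono_store h₁ h₂
  have e : ∀ {P}, HasTy S Ψ Γ i P T → ((P.lsubst τ).gsubst σ).lsubst θ =
      (P.gsubst σ).lsubst (fun x => ((τ x).gsubst σ).lsubst θ) := fun hP => by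
    rw [(hP.mono_store h₁ h₂).gsubst_lsubst hτ' hΓ hσ GCtxWF.nil, lsubst_lsubst]
  rw [e h.1] at H
  rw [e h.2.1]
  exact h.2.2 S' σ _ K hp h₁ h₂ hσ
    ((hτ'.comp_gsubst hσ GCtxWF.nil).lift.comp_lsubst hθ LCtxWF.nil) hK hh H

/-- Again a test of the instances is a test of the original terms, now with the composed global
substitution. -/
theorem gsubst {σ : GSub} (h : Ciu S Ψ Γ i M N T) (hσ : GSubTy S Ψ' σ Ψ)
    (hΨ : GCtxWF Ψ') : Ciu S Ψ' Γ i (M.gsubst σ) (N.gsubst σ) T := by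
  refine ⟨h.1.gsubst hσ hΨ, h.2.1.gsubst hσ hΨ, fun S' σ' θ K hp h₁ h₂ hσ' hθ hK hh H => ?_⟩
  have hσ₁ := hσ.mono_store h₁ h₂
  have e : ∀ {P}, HasTy S Ψ Γ i P T → (P.gsubst σ).gsubst σ' = P.gsubst (gcomp σ σ') :=
    fun hP => (hP.mono_store h₁ h₂).gsubst_gsubst hσ₁ hΨ hσ' GCtxWF.nil
  rw [e h.1] at H
  rw [e h.2.1]
  exact h.2.2 S' _ _ K hp h₁ h₂ (hσ₁.comp hσ' GCtxWF.nil) hθ hK hh H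

theorem rename {ρ ξ : ℕ → ℕ} (h : Ciu S Ψ Γ i M N T) (hρ : RenTy ρ Γ Γ') (hξ : RenTy ξ Ψ Ψ')
    (hΓ : LCtxWF i Γ') (hΨ : GCtxWF Ψ') : Ciu S Ψ' Γ' i (M.rename ρ ξ) (N.rename ρ ξ) T := by
  have e : ∀ P : Tm, P.rename ρ ξ =
      (P.gsubst (fun u => Sum.inl (ξ u))).lsubst (fun x => .var (ρ x)) := fun P => by
    rw [← rename_eq_gsubst, ← rename_eq_lsubst, rename_rename]; rfl
  rw [e, e]
  exact (h.gsubst (GSubTy.inl hξ) hΨ).lsubst (LSubTy.var h.1.sctxWF hΨ hΓ hρ) hΓ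

end Ciu

/-! ### The Howe closure -/

/-- The Howe closure of `Ciu`. -/
inductive How (S : SCtx) : GCtx → LCtx → Layer → Tm → Tm → Ty → Prop
  | unit {Ψ : GCtx} {Γ : LCtx} {i : Layer} {N : Tm} {T : Ty} :
      Ciu S Ψ Γ i .unit N T → How S Ψ Γ i .unit N T
  | num {Ψ : GCtx} {Γ : LCtx} {i : Layer} {N : Tm} {T : Ty} (n : ℕ) :
      Ciu S Ψ Γ i (.num n) N T → How S Ψ Γ i (.num n) N T
  | var {Ψ : GCtx} {Γ : LCtx} {i : Layer} {N : Tm} {T : Ty} {x : ℕ} :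
      Γ[x]? = some T → Ciu S Ψ Γ i (.var x) N T → How S Ψ Γ i (.var x) N T
  | gvar {Ψ : GCtx} {Γ Γ' : LCtx} {i : Layer} {u n : ℕ} {δ δ' : Fin n → Tm} {N : Tm} {T : Ty} :
      Γ'.length = n → (∀ k, (δ k).IsValue) → (∀ k, (δ' k).IsValue) →
      (∀ (k : Fin n) (U : Ty), Γ'[(k : ℕ)]? = some U → How S Ψ Γ i (δ k) (δ' k) U) →
      Ψ[u]? = some (Γ', T) → Ciu S Ψ Γ i (.gvar u n δ') N T → How S Ψ Γ i (.gvar u n δ) N T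
  | loc {Ψ : GCtx} {Γ : LCtx} {i : Layer} {N : Tm} {T : Ty} {l : ℕ} :
      Ciu S Ψ Γ i (.loc l) N T → How S Ψ Γ i (.loc l) N T
  | lam {Ψ : GCtx} {Γ : LCtx} {i : Layer} {M M' N : Tm} {A B : Ty} :
      How S Ψ (A :: Γ) i M M' B → Ciu S Ψ Γ i (.lam M') N (.arrow A B) →
      How S Ψ Γ i (.lam M) N (.arrow A B)
  | app {Ψ : GCtx} {Γ : LCtx} {i : Layer} {M₁ M₁' M₂ M₂' N : Tm} {A B : Ty} :
      How S Ψ Γ i M₁ M₁' (.arrow A B) → How S Ψ Γ i M₂ M₂' A →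
      Ciu S Ψ Γ i (.app M₁' M₂') N B → How S Ψ Γ i (.app M₁ M₂) N B
  | recfn {Ψ : GCtx} {Γ : LCtx} {i : Layer} {M M' N : Tm} {A B : Ty} :
      How S Ψ (A :: .arrow A B :: Γ) i M M' B → Ciu S Ψ Γ i (.recfn M') N (.arrow A B) →
      How S Ψ Γ i (.recfn M) N (.arrow A B)
  | arith {Ψ : GCtx} {Γ : LCtx} {i : Layer} {o : ArithOp} {M₁ M₁' M₂ M₂' N : Tm} :
      How S Ψ Γ i M₁ M₁' .int → How S Ψ Γ i M₂ M₂' .int →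
      Ciu S Ψ Γ i (.arith o M₁' M₂') N .int → How S Ψ Γ i (.arith o M₁ M₂) N .int
  | ite {Ψ : GCtx} {Γ : LCtx} {i : Layer} {M₁ M₁' M₂ M₂' M₃ M₃' N : Tm} {T : Ty} :
      How S Ψ Γ i M₁ M₁' .int → How S Ψ Γ i M₂ M₂' T → How S Ψ Γ i M₃ M₃' T →
      Ciu S Ψ Γ i (.ite M₁' M₂' M₃') N T → How S Ψ Γ i (.ite M₁ M₂ M₃) N T
  | ref {Ψ : GCtx} {Γ : LCtx} {i : Layer} {M M' N : Tm} {T : Ty} :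
      How S Ψ Γ i M M' T → Ciu S Ψ Γ i (.ref M') N (.ref T) →
      How S Ψ Γ i (.ref M) N (.ref T)
  | deref {Ψ : GCtx} {Γ : LCtx} {i : Layer} {M M' N : Tm} {T : Ty} :
      How S Ψ Γ i M M' (.ref T) → Ciu S Ψ Γ i (.deref M') N T →
      How S Ψ Γ i (.deref M) N T
  | assign {Ψ : GCtx} {Γ : LCtx} {i : Layer} {M₁ M₁' M₂ M₂' N : Tm} {T : Ty} :
      How S Ψ Γ i M₁ M₁' (.ref T) → How S Ψ Γ i M₂ M₂' T →
      Ciu S Ψ Γ i (.assign M₁' M₂') N .unit → How S Ψ Γ i (.assign M₁ M₂) N .unit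
  | box {Ψ : GCtx} {Γ Γ' : LCtx} {M M' N : Tm} {T : Ty} :
      How S Ψ Γ' Layer.zero M M' T → Ciu S Ψ Γ Layer.one (.box M') N (.box Γ' T) →
      How S Ψ Γ Layer.one (.box M) N (.box Γ' T)
  | letbox {Ψ : GCtx} {Γ Γ' : LCtx} {M₁ M₁' M₂ M₂' N : Tm} {T T' : Ty} :
      How S Ψ Γ Layer.one M₁ M₁' (.box Γ' T) →
      How S ((Γ', T) :: Ψ) Γ Layer.one M₂ M₂' T' →
      Ciu S Ψ Γ Layer.one (.letbox M₁' M₂') N T' → How S Ψ Γ Layer.one (.letbox M₁ M₂) N T'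

namespace How

variable {S : SCtx} {Ψ Ψ' : GCtx} {Γ Γ' : LCtx} {i : Layer} {M N P : Tm} {T : Ty}

theorem hasTy_right (h : How S Ψ Γ i M N T) : HasTy S Ψ Γ i N T := by
  cases h <;> exact (by assumption : Ciu _ _ _ _ _ _ _).2.1

/-- Every rule of `How` ends with a `Ciu` step, which absorbs a further one. -/
theorem trans_ciu (h : How S Ψ Γ i M N T) (h' : Ciu S Ψ Γ i N P T) : How S Ψ Γ i M P T := by
  cases h with
  | unit hc => exact .unit (hc.trans h')
  | num n hc => exact .num n (hc.trans h')
  | var hx hc => exact .var hx (hc.trans h')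
  | gvar h₁ h₂ h₃ h₄ h₅ hc => exact .gvar h₁ h₂ h₃ h₄ h₅ (hc.trans h')
  | loc hc => exact .loc (hc.trans h')
  | lam h₁ hc => exact .lam h₁ (hc.trans h')
  | app h₁ h₂ hc => exact .app h₁ h₂ (hc.trans h')
  | recfn h₁ hc => exact .recfn h₁ (hc.trans h')
  | arith h₁ h₂ hc => exact .arith h₁ h₂ (hc.trans h')
  | ite h₁ h₂ h₃ hc => exact .ite h₁ h₂ h₃ (hc.trans h')
  | ref h₁ hc => exact .ref h₁ (hc.trans h')
  | deref h₁ hc => exact .deref h₁ (hc.trans h')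
  | assign h₁ h₂ hc => exact .assign h₁ h₂ (hc.trans h')
  | box h₁ hc => exact .box h₁ (hc.trans h')
  | letbox h₁ h₂ hc => exact .letbox h₁ h₂ (hc.trans h')

theorem refl (h : HasTy S Ψ Γ i M T) : How S Ψ Γ i M M T := by
  induction h with
  | unit h₁ h₂ h₃ => exact .unit (.refl (.unit h₁ h₂ h₃))
  | num n h₁ h₂ h₃ => exact .num n (.refl (.num n h₁ h₂ h₃))
  | var h₁ h₂ h₃ h => exact .var h (.refl (.var h₁ h₂ h₃ h))
  | gvar h₁ h₂ h₃ hl hv hδ h ih =>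
    exact .gvar hl hv hv ih h (.refl (.gvar h₁ h₂ h₃ hl hv hδ h))
  | loc h₁ h₂ h₃ hl h => exact .loc (.refl (.loc h₁ h₂ h₃ hl h))
  | lam h ih => exact .lam ih (.refl (.lam h))
  | app h₁ h₂ ih₁ ih₂ => exact .app ih₁ ih₂ (.refl (.app h₁ h₂))
  | recfn h ih => exact .recfn ih (.refl (.recfn h))
  | arith o h₁ h₂ ih₁ ih₂ => exact .arith ih₁ ih₂ (.refl (.arith o h₁ h₂))
  | ite h₁ h₂ h₃ ih₁ ih₂ ih₃ => exact .ite ih₁ ih₂ ih₃ (.refl (.ite h₁ h₂ h₃))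
  | ref h ih => exact .ref ih (.refl (.ref h))
  | deref h ih => exact .deref ih (.refl (.deref h))
  | assign h₁ h₂ ih₁ ih₂ => exact .assign ih₁ ih₂ (.refl (.assign h₁ h₂))
  | box h h' ih => exact .box ih (.refl (.box h h'))
  | letbox h₁ h₂ ih₁ ih₂ => exact .letbox ih₁ ih₂ (.refl (.letbox h₁ h₂))

theorem lift (h : How S Ψ Γ i M N T) : How S Ψ Γ Layer.one M N T := by
  induction h with
  | unit hc => exact .unit hc.lift
  | num n hc => exact .num n hc.lift
  | var hx hc => exact .var hx hc.lift
  | gvar h₁ h₂ h₃ _ h₅ hc ih => exact .gvar h₁ h₂ h₃ ih h₅ hc.lift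
  | loc hc => exact .loc hc.lift
  | lam _ hc ih => exact .lam ih hc.lift
  | app _ _ hc ih₁ ih₂ => exact .app ih₁ ih₂ hc.lift
  | recfn _ hc ih => exact .recfn ih hc.lift
  | arith _ _ hc ih₁ ih₂ => exact .arith ih₁ ih₂ hc.lift
  | ite _ _ _ hc ih₁ ih₂ ih₃ => exact .ite ih₁ ih₂ ih₃ hc.lift
  | ref _ hc ih => exact .ref ih hc.lift
  | deref _ hc ih => exact .deref ih hc.lift
  | assign _ _ hc ih₁ ih₂ => exact .assign ih₁ ih₂ hc.lift
  | box h₁ hc _ => exact .box h₁ hc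
  | letbox _ _ hc ih₁ ih₂ => exact .letbox ih₁ ih₂ hc

theorem of_zero (h : How S Ψ Γ Layer.zero M N T) : How S Ψ Γ i M N T := by
  cases i
  exacts [h, h.lift]

theorem mono_store {S' : SCtx} (h : How S Ψ Γ i M N T) (hS : SCtxSub S S') (hw : SCtxWF S') :
    How S' Ψ Γ i M N T := by
  induction h with
  | unit hc => exact .unit (hc.mono_store hS hw)
  | num n hc => exact .num n (hc.mono_store hS hw)
  | var hx hc => exact .var hx (hc.mono_store hS hw)
  | gvar h₁ h₂ h₃ _ h₅ hc ih => exact .gvar h₁ h₂ h₃ ih h₅ (hc.mono_store hS hw)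
  | loc hc => exact .loc (hc.mono_store hS hw)
  | lam _ hc ih => exact .lam ih (hc.mono_store hS hw)
  | app _ _ hc ih₁ ih₂ => exact .app ih₁ ih₂ (hc.mono_store hS hw)
  | recfn _ hc ih => exact .recfn ih (hc.mono_store hS hw)
  | arith _ _ hc ih₁ ih₂ => exact .arith ih₁ ih₂ (hc.mono_store hS hw)
  | ite _ _ _ hc ih₁ ih₂ ih₃ => exact .ite ih₁ ih₂ ih₃ (hc.mono_store hS hw)
  | ref _ hc ih => exact .ref ih (hc.mono_store hS hw)
  | deref _ hc ih => exact .deref ih (hc.mono_store hS hw)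
  | assign _ _ hc ih₁ ih₂ => exact .assign ih₁ ih₂ (hc.mono_store hS hw)
  | box _ hc ih => exact .box ih (hc.mono_store hS hw)
  | letbox _ _ hc ih₁ ih₂ => exact .letbox ih₁ ih₂ (hc.mono_store hS hw)

theorem rename (h : How S Ψ Γ i M N T) : ∀ {Ψ' : GCtx} {Γ' : LCtx} {ρ ξ : ℕ → ℕ},
    RenTy ρ Γ Γ' → RenTy ξ Ψ Ψ' → LCtxWF i Γ' → GCtxWF Ψ' →
    How S Ψ' Γ' i (M.rename ρ ξ) (N.rename ρ ξ) T := by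
  induction h with
  | unit hc => intro _ _ _ _ hρ hξ hΓ hΨ; exact .unit (hc.rename hρ hξ hΓ hΨ)
  | num n hc => intro _ _ _ _ hρ hξ hΓ hΨ; exact .num n (hc.rename hρ hξ hΓ hΨ)
  | var hx hc => intro _ _ _ _ hρ hξ hΓ hΨ; exact .var (hρ _ _ hx) (hc.rename hρ hξ hΓ hΨ)
  | gvar h₁ h₂ h₃ _ h₅ hc ih =>
    intro _ _ _ _ hρ hξ hΓ hΨ
    exact .gvar h₁ (fun k => (h₂ k).rename _ _) (fun k => (h₃ k).rename _ _)
      (fun k U hU => ih k U hU hρ hξ hΓ hΨ) (hξ _ _ h₅) (hc.rename hρ hξ hΓ hΨ)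
  | loc hc => intro _ _ _ _ hρ hξ hΓ hΨ; exact .loc (hc.rename hρ hξ hΓ hΨ)
  | lam h₁ hc ih =>
    intro _ _ _ _ hρ hξ hΓ hΨ
    exact .lam (ih (hρ.up _) hξ (hΓ.cons h₁.hasTy_right.lctxWF.head) hΨ) (hc.rename hρ hξ hΓ hΨ)
  | app _ _ hc ih₁ ih₂ =>
    intro _ _ _ _ hρ hξ hΓ hΨ
    exact .app (ih₁ hρ hξ hΓ hΨ) (ih₂ hρ hξ hΓ hΨ) (hc.rename hρ hξ hΓ hΨ)
  | recfn h₁ hc ih =>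
    intro _ _ _ _ hρ hξ hΓ hΨ
    have hw := h₁.hasTy_right.lctxWF
    exact .recfn (ih ((hρ.up _).up _) hξ ((hΓ.cons hw.tail.head).cons hw.head) hΨ)
      (hc.rename hρ hξ hΓ hΨ)
  | arith _ _ hc ih₁ ih₂ =>
    intro _ _ _ _ hρ hξ hΓ hΨ
    exact .arith (ih₁ hρ hξ hΓ hΨ) (ih₂ hρ hξ hΓ hΨ) (hc.rename hρ hξ hΓ hΨ)
  | ite _ _ _ hc ih₁ ih₂ ih₃ =>
    intro _ _ _ _ hρ hξ hΓ hΨ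
    exact .ite (ih₁ hρ hξ hΓ hΨ) (ih₂ hρ hξ hΓ hΨ) (ih₃ hρ hξ hΓ hΨ) (hc.rename hρ hξ hΓ hΨ)
  | ref _ hc ih =>
    intro _ _ _ _ hρ hξ hΓ hΨ; exact .ref (ih hρ hξ hΓ hΨ) (hc.rename hρ hξ hΓ hΨ)
  | deref _ hc ih =>
    intro _ _ _ _ hρ hξ hΓ hΨ; exact .deref (ih hρ hξ hΓ hΨ) (hc.rename hρ hξ hΓ hΨ)
  | assign _ _ hc ih₁ ih₂ =>
    intro _ _ _ _ hρ hξ hΓ hΨ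
    exact .assign (ih₁ hρ hξ hΓ hΨ) (ih₂ hρ hξ hΓ hΨ) (hc.rename hρ hξ hΓ hΨ)
  | box h₁ hc ih =>
    intro _ _ _ _ hρ hξ hΓ hΨ
    exact .box (ih RenTy.refl hξ h₁.hasTy_right.lctxWF hΨ) (hc.rename hρ hξ hΓ hΨ)
  | letbox _ h₂ hc ih₁ ih₂ =>
    intro _ _ _ _ hρ hξ hΓ hΨ
    have hw := h₂.hasTy_right.gctxWF _ List.mem_cons_self
    exact .letbox (ih₁ hρ hξ hΓ hΨ) (ih₂ hρ (hξ.up _) hΓ (hΨ.cons hw.1 hw.2))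
      (hc.rename hρ hξ hΓ hΨ)

end How

/-- Local substitutions whose entries are values related by the Howe closure. -/
def HowLSub (S : SCtx) (Ψ : GCtx) (Γ' : LCtx) (i : Layer) (τ τ' : ℕ → Tm) (Γ : LCtx) : Prop :=
  ∀ (x : ℕ) (T : Ty), Γ[x]? = some T →
    (τ x).IsValue ∧ (τ' x).IsValue ∧ How S Ψ Γ' i (τ x) (τ' x) T

/-- Global substitutions whose entries are related by the Howe closure. -/
def HowGSub (S : SCtx) (Ψ' : GCtx) (σ σ' : GSub) (Ψ : GCtx) : Prop :=
  ∀ (u : ℕ) (Γ : LCtx) (T : Ty), Ψ[u]? = some (Γ, T) →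
    (∃ v, σ u = Sum.inl v ∧ σ' u = Sum.inl v ∧ Ψ'[v]? = some (Γ, T)) ∨
      ∃ N N', σ u = Sum.inr N ∧ σ' u = Sum.inr N' ∧ How S Ψ' Γ Layer.zero N N' T

/-! ### Substitutivity of the Howe closure -/

section HowSub

variable {S : SCtx} {Ψ Ψ' : GCtx} {Γ Γ' : LCtx} {i : Layer} {M N : Tm} {T : Ty} {τ τ' : ℕ → Tm}
  {σ σ' : GSub}

theorem HowLSub.right (h : HowLSub S Ψ Γ' i τ τ' Γ) : LSubTy S Ψ Γ' i τ' Γ :=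
  fun x T hx => ⟨(h x T hx).2.1, (h x T hx).2.2.hasTy_right⟩

theorem HowGSub.right (h : HowGSub S Ψ' σ σ' Ψ) : GSubTy S Ψ' σ' Ψ := by
  intro u Γ T hu
  rcases h u Γ T hu with ⟨v, _, e, hv⟩ | ⟨N, N', _, e, hN⟩
  exacts [.inl ⟨v, e, hv⟩, .inr ⟨N', e, hN.hasTy_right⟩]

theorem HowLSub.up (h : HowLSub S Ψ Γ' i τ τ' Γ) {U : Ty} (hS : SCtxWF S) (hΨ : GCtxWF Ψ)
    (hΓ : LCtxWF i (U :: Γ')) : HowLSub S Ψ (U :: Γ') i (upL τ) (upL τ') (U :: Γ) := by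
  intro x T hx
  cases x with
  | zero => exact ⟨.var 0, .var 0, .refl (.var hS hΨ hΓ (by simpa using hx))⟩
  | succ x =>
    obtain ⟨h₁, h₂, h₃⟩ := h x T (by simpa using hx)
    exact ⟨h₁.rename _ _, h₂.rename _ _, h₃.rename RenTy.succ RenTy.refl hΓ hΨ⟩

theorem HowLSub.upG (h : HowLSub S Ψ Γ' i τ τ' Γ) {p : LCtx × Ty} (hΨ : GCtxWF (p :: Ψ))
    (hΓ : LCtxWF i Γ') : HowLSub S (p :: Ψ) Γ' i (upG τ) (upG τ') Γ := by
  intro x T hx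
  obtain ⟨h₁, h₂, h₃⟩ := h x T hx
  exact ⟨h₁.rename _ _, h₂.rename _ _, h₃.rename RenTy.refl RenTy.succ hΓ hΨ⟩

theorem HowLSub.cons {V V' : Tm} {U : Ty} (hV : V.IsValue) (hV' : V'.IsValue)
    (hU : How S Ψ Γ' i V V' U) (h : HowLSub S Ψ Γ' i τ τ' Γ) :
    HowLSub S Ψ Γ' i (scons V τ) (scons V' τ') (U :: Γ) := by
  intro x T hx
  cases x with
  | zero =>
    obtain rfl : U = T := by simpa using hx
    exact ⟨hV, hV', hU⟩
  | succ x => exact h x T (by simpa using hx)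

theorem HowLSub.nil : HowLSub S Ψ Γ' i τ τ' [] := fun x T h => by simp at h

theorem HowLSub.ofFin {n : ℕ} {δ δ' : Fin n → Tm} (hn : Γ.length = n)
    (hv : ∀ k, (δ k).IsValue) (hv' : ∀ k, (δ' k).IsValue)
    (h : ∀ (k : Fin n) (U : Ty), Γ[(k : ℕ)]? = some U → How S Ψ Γ' i (δ k) (δ' k) U) :
    HowLSub S Ψ Γ' i (ofFin δ) (ofFin δ') Γ := by
  intro x T hx
  have hlt : x < n := lt_of_getElem? hx hn
  simp only [ofFin_of_lt _ hlt]
  exact ⟨hv _, hv' _, h ⟨x, hlt⟩ T hx⟩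

theorem HowGSub.up (h : HowGSub S Ψ' σ σ' Ψ) {p : LCtx × Ty} (hΨ : GCtxWF (p :: Ψ')) :
    HowGSub S (p :: Ψ') (upGSub σ) (upGSub σ') (p :: Ψ) := by
  intro u Γ T hu
  cases u with
  | zero => exact .inl ⟨0, rfl, rfl, by simpa using hu⟩
  | succ u =>
    rcases h u Γ T (by simpa using hu) with ⟨v, e, e', hv⟩ | ⟨N, N', e, e', hN⟩
    · exact .inl ⟨v + 1, by simp [upGSub, e], by simp [upGSub, e'], by simpa using hv⟩
    · exact .inr ⟨_, _, by simp [upGSub, e], by simp [upGSub, e'],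
        hN.rename RenTy.refl RenTy.succ hN.hasTy_right.lctxWF hΨ⟩

theorem How.isValue_lsubst (h : How S Ψ Γ i M N T) (hM : M.IsValue)
    (hτ : ∀ x T, Γ[x]? = some T → (τ x).IsValue) : (M.lsubst τ).IsValue := by
  cases hM with
  | var x => cases h with | var h _ => exact hτ x _ h
  | _ => constructor

/-- The terms formed from the right-hand components are related to `N` by `Ciu`, which survives the
right substitution; at a variable the relation between the entries is followed by that step. Bodies
of boxes are untouched by local substitution and keep their derivation. -/
theorem How.lsubst (h : How S Ψ Γ i M N T) : ∀ {Γ' : LCtx} {τ τ' : ℕ → Tm},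
    HowLSub S Ψ Γ' i τ τ' Γ → LCtxWF i Γ' → How S Ψ Γ' i (M.lsubst τ) (N.lsubst τ') T := by
  induction h with
  | unit hc => intro _ _ _ hτ hΓ; exact .unit (hc.lsubst hτ.right hΓ)
  | num n hc => intro _ _ _ hτ hΓ; exact .num n (hc.lsubst hτ.right hΓ)
  | var hx hc => intro _ _ _ hτ hΓ; exact (hτ _ _ hx).2.2.trans_ciu (hc.lsubst hτ.right hΓ)
  | @gvar _ _ Γ₁ _ _ n δ δ' _ _ hl hv hv' hδ hu hc ih =>
    intro _ _ _ hτ hΓ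
    have hk : ∀ k : Fin n, Γ₁[(k : ℕ)]? = some _ := fun k => List.getElem?_eq_getElem (by omega)
    exact .gvar hl (fun k => (hδ k _ (hk k)).isValue_lsubst (hv k) fun x T hx => (hτ x T hx).1)
      (fun k => IsValue_lsubst (hv' k) (hδ k _ (hk k)).hasTy_right
        fun x T hx => (hτ x T hx).2.1)
      (fun k U hU => ih k U hU hτ hΓ) hu (hc.lsubst hτ.right hΓ)
  | loc hc => intro _ _ _ hτ hΓ; exact .loc (hc.lsubst hτ.right hΓ)
  | lam h₁ hc ih =>
    intro _ _ _ hτ hΓ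
    have h₁ := h₁.hasTy_right
    have hw := hΓ.cons h₁.lctxWF.head
    exact .lam (ih (hτ.up h₁.sctxWF h₁.gctxWF hw) hw) (hc.lsubst hτ.right hΓ)
  | app _ _ hc ih₁ ih₂ =>
    intro _ _ _ hτ hΓ; exact .app (ih₁ hτ hΓ) (ih₂ hτ hΓ) (hc.lsubst hτ.right hΓ)
  | recfn h₁ hc ih =>
    intro _ _ _ hτ hΓ
    have h₁ := h₁.hasTy_right
    have hw := hΓ.cons h₁.lctxWF.tail.head
    have hw' := hw.cons h₁.lctxWF.head
    exact .recfn (ih ((hτ.up h₁.sctxWF h₁.gctxWF hw).up h₁.sctxWF h₁.gctxWF hw') hw')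
      (hc.lsubst hτ.right hΓ)
  | arith _ _ hc ih₁ ih₂ =>
    intro _ _ _ hτ hΓ; exact .arith (ih₁ hτ hΓ) (ih₂ hτ hΓ) (hc.lsubst hτ.right hΓ)
  | ite _ _ _ hc ih₁ ih₂ ih₃ =>
    intro _ _ _ hτ hΓ; exact .ite (ih₁ hτ hΓ) (ih₂ hτ hΓ) (ih₃ hτ hΓ) (hc.lsubst hτ.right hΓ)
  | ref _ hc ih => intro _ _ _ hτ hΓ; exact .ref (ih hτ hΓ) (hc.lsubst hτ.right hΓ)
  | deref _ hc ih => intro _ _ _ hτ hΓ; exact .deref (ih hτ hΓ) (hc.lsubst hτ.right hΓ)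
  | assign _ _ hc ih₁ ih₂ =>
    intro _ _ _ hτ hΓ; exact .assign (ih₁ hτ hΓ) (ih₂ hτ hΓ) (hc.lsubst hτ.right hΓ)
  | box h₁ hc _ => intro _ _ _ hτ hΓ; exact .box h₁ (hc.lsubst hτ.right hΓ)
  | letbox _ h₂ hc ih₁ ih₂ =>
    intro _ _ _ hτ hΓ
    exact .letbox (ih₁ hτ hΓ) (ih₂ (hτ.upG h₂.hasTy_right.gctxWF hΓ) hΓ)
      (hc.lsubst hτ.right hΓ)

/-- At a global variable the two pieces of code are related at layer zero and the two explicit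
substitutions entrywise. Hence this lemma needs `How.lsubst`, after lifting the code to the layer of
the occurrence. -/
theorem How.gsubst (h : How S Ψ Γ i M N T) : ∀ {Ψ' : GCtx} {σ σ' : GSub},
    HowGSub S Ψ' σ σ' Ψ → GCtxWF Ψ' → How S Ψ' Γ i (M.gsubst σ) (N.gsubst σ') T := by
  induction h with
  | unit hc => intro _ _ _ hσ hΨ; exact .unit (hc.gsubst hσ.right hΨ)
  | num n hc => intro _ _ _ hσ hΨ; exact .num n (hc.gsubst hσ.right hΨ)
  | var hx hc => intro _ _ _ hσ hΨ; exact .var hx (hc.gsubst hσ.right hΨ)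
  | gvar hl hv hv' hδ hu hc ih =>
    intro _ σ σ' hσ hΨ
    have hc' := hc.gsubst hσ.right hΨ
    rcases hσ _ _ _ hu with ⟨v, e, e', hN⟩ | ⟨N, N', e, e', hN⟩
    · simp only [Tm.gsubst, e, e'] at hc' ⊢
      exact .gvar hl (fun k => (hv k).gsubst σ) (fun k => (hv' k).gsubst σ')
        (fun k U hU => ih k U hU hσ hΨ) hN hc'
    · simp only [Tm.gsubst, e, e'] at hc' ⊢
      exact (hN.of_zero.lsubst (HowLSub.ofFin hl (fun k => (hv k).gsubst σ)
        (fun k => (hv' k).gsubst σ') (fun k U hU => ih k U hU hσ hΨ)) hc.1.lctxWF).trans_ciu hc'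
  | loc hc => intro _ _ _ hσ hΨ; exact .loc (hc.gsubst hσ.right hΨ)
  | lam _ hc ih => intro _ _ _ hσ hΨ; exact .lam (ih hσ hΨ) (hc.gsubst hσ.right hΨ)
  | app _ _ hc ih₁ ih₂ =>
    intro _ _ _ hσ hΨ; exact .app (ih₁ hσ hΨ) (ih₂ hσ hΨ) (hc.gsubst hσ.right hΨ)
  | recfn _ hc ih => intro _ _ _ hσ hΨ; exact .recfn (ih hσ hΨ) (hc.gsubst hσ.right hΨ)
  | arith _ _ hc ih₁ ih₂ =>
    intro _ _ _ hσ hΨ; exact .arith (ih₁ hσ hΨ) (ih₂ hσ hΨ) (hc.gsubst hσ.right hΨ)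
  | ite _ _ _ hc ih₁ ih₂ ih₃ =>
    intro _ _ _ hσ hΨ; exact .ite (ih₁ hσ hΨ) (ih₂ hσ hΨ) (ih₃ hσ hΨ) (hc.gsubst hσ.right hΨ)
  | ref _ hc ih => intro _ _ _ hσ hΨ; exact .ref (ih hσ hΨ) (hc.gsubst hσ.right hΨ)
  | deref _ hc ih => intro _ _ _ hσ hΨ; exact .deref (ih hσ hΨ) (hc.gsubst hσ.right hΨ)
  | assign _ _ hc ih₁ ih₂ =>
    intro _ _ _ hσ hΨ; exact .assign (ih₁ hσ hΨ) (ih₂ hσ hΨ) (hc.gsubst hσ.right hΨ)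
  | box _ hc ih => intro _ _ _ hσ hΨ; exact .box (ih hσ hΨ) (hc.gsubst hσ.right hΨ)
  | letbox _ h₂ hc ih₁ ih₂ =>
    intro _ _ _ hσ hΨ
    have hw := h₂.hasTy_right.gctxWF _ List.mem_cons_self
    have hw' := hΨ.cons hw.1 hw.2
    exact .letbox (ih₁ hσ hΨ) (ih₂ (hσ.up hw') hw') (hc.gsubst hσ.right hΨ)

end HowSub

/-! ### The Howe closure is preserved by evaluation -/

theorem Ciu.halts {S : SCtx} {M N : Tm} {T : Ty} {K : List Frame} {h : Heap}
    (hc : Ciu S [] [] Layer.one M N T) (hK : StackTy S K T) (hh : HeapHasTy S [] [] h)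
    (H : Halts K M h) : Halts K N h := by
  have := hc.2.2 S Sum.inl var K h (SCtxSub.refl S) hc.1.sctxWF GSubTy.nil LSubTy.nil hK hh
  simpa only [gsubst_inl, lsubst_var, H, true_implies] using this

/-- The last rule exhibits a term with the same outermost constructor as `V`, hence a value, that
lies `Ciu`-below `N`. The empty local context excludes variables. -/
theorem How.exists_value {S : SCtx} {Ψ : GCtx} {i : Layer} {V N : Tm} {T : Ty}
    (h : How S Ψ [] i V N T) (hV : V.IsValue) :
    ∃ V', V'.IsValue ∧ How S Ψ [] i V V' T ∧ Ciu S Ψ [] i V' N T := by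
  cases h with
  | unit hc => exact ⟨_, .unit, .unit (.refl hc.1), hc⟩
  | num n hc => exact ⟨_, .num n, .num n (.refl hc.1), hc⟩
  | var hx _ => simp at hx
  | loc hc => exact ⟨_, .loc _, .loc (.refl hc.1), hc⟩
  | lam h₁ hc => exact ⟨_, .lam _, .lam h₁ (.refl hc.1), hc⟩
  | recfn h₁ hc => exact ⟨_, .recfn _, .recfn h₁ (.refl hc.1), hc⟩
  | box h₁ hc => exact ⟨_, .box _, .box h₁ (.refl hc.1), hc⟩
  | _ => cases hV

/-- Heaps whose entries are values related by the Howe closure. -/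
def HowHeap (S : SCtx) (h h' : Heap) : Prop :=
  (∀ l : ℕ, l ∈ S ↔ l ∈ h) ∧ (∀ l : ℕ, l ∈ S ↔ l ∈ h') ∧
    ∀ (l : ℕ) (T : Ty) (V V' : Tm), S.lookup l = some T → h.lookup l = some V →
      h'.lookup l = some V' → V.IsValue ∧ V'.IsValue ∧ How S [] [] Layer.one V V' T

theorem exists_lookup_of_mem {β : Type} {h : Finmap (fun _ : ℕ => β)} {l : ℕ} (hl : l ∈ h) :
    ∃ v, h.lookup l = some v :=
  Option.isSome_iff_exists.1 (Finmap.lookup_isSome.2 hl)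

theorem mem_of_lookup {β : Type} {h : Finmap (fun _ : ℕ => β)} {l : ℕ} {v : β}
    (hl : h.lookup l = some v) : l ∈ h :=
  Finmap.lookup_isSome.1 (by simp [hl])

theorem SCtxSub.insert {S : SCtx} {l : ℕ} (hl : l ∉ S) (T : Ty) : SCtxSub S (S.insert l T) := by
  intro l' T' h
  have hne : l' ≠ l := by
    rintro rfl
    exact hl (mem_of_lookup h)
  rw [Finmap.lookup_insert_of_ne _ hne, h]

theorem SCtxWF.insert {S : SCtx} (h : SCtxWF S) (l : ℕ) {T : Ty} (hT : TyWF Layer.one T) :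
    SCtxWF (S.insert l T) := by
  intro l' T' hl'
  by_cases e : l' = l
  · subst e
    rw [Finmap.lookup_insert] at hl'
    cases hl'
    exact hT
  · rw [Finmap.lookup_insert_of_ne _ e] at hl'
    exact h l' T' hl'

theorem mem_insert_iff {α β : Type} {S : Finmap (fun _ : ℕ => α)} {h : Finmap (fun _ : ℕ => β)}
    (H : ∀ l : ℕ, l ∈ S ↔ l ∈ h) (l : ℕ) (a : α) (b : β) (l' : ℕ) :
    l' ∈ S.insert l a ↔ l' ∈ h.insert l b := by
  rw [Finmap.mem_insert, Finmap.mem_insert, H]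

theorem insert_mem_iff {α β : Type} {S : Finmap (fun _ : ℕ => α)} {h : Finmap (fun _ : ℕ => β)}
    (H : ∀ l : ℕ, l ∈ S ↔ l ∈ h) {l : ℕ} (hl : l ∈ S) (b : β) (l' : ℕ) :
    l' ∈ S ↔ l' ∈ h.insert l b := by
  rw [Finmap.mem_insert, ← H]
  constructor
  · exact Or.inr
  · rintro (rfl | h)
    exacts [hl, h]

namespace HowHeap

variable {S : SCtx} {h h' : Heap}

theorem right (H : HowHeap S h h') : HeapHasTy S [] [] h' := by
  refine ⟨H.2.1, fun l T V' hT hV' => ?_⟩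
  obtain ⟨V, hV⟩ := exists_lookup_of_mem ((H.1 l).1 (mem_of_lookup hT))
  obtain ⟨_, h₂, h₃⟩ := H.2.2 l T V V' hT hV hV'
  exact ⟨h₂, h₃.hasTy_right⟩

theorem refl (H : HeapHasTy S [] [] h) : HowHeap S h h := by
  refine ⟨H.1, H.1, fun l T V V' hT hV hV' => ?_⟩
  obtain rfl : V = V' := Option.some.inj (hV.symm.trans hV')
  obtain ⟨h₁, h₂⟩ := H.2 l T V hT hV
  exact ⟨h₁, h₁, .refl h₂⟩

/-- Related heaps have the same domain, so one location is fresh for both, and the old entries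
remain related in the larger store context. -/
theorem alloc (H : HowHeap S h h') {l : ℕ} {T : Ty} {V V' : Tm} (hl : l ∉ h) (hV : V.IsValue)
    (hV' : V'.IsValue) (hVV' : How S [] [] Layer.one V V' T) :
    HowHeap (S.insert l T) (h.insert l V) (h'.insert l V') := by
  have hw := hVV'.hasTy_right.sctxWF.insert l hVV'.hasTy_right.tyWF
  have hs : SCtxSub S (S.insert l T) := SCtxSub.insert (fun h => hl ((H.1 l).1 h)) T
  refine ⟨mem_insert_iff H.1 l T V, mem_insert_iff H.2.1 l T V', fun k U W W' hU hW hW' => ?_⟩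
  by_cases e : k = l
  · subst e
    rw [Finmap.lookup_insert] at hU hW hW'
    cases hU; cases hW; cases hW'
    exact ⟨hV, hV', hVV'.mono_store hs hw⟩
  · rw [Finmap.lookup_insert_of_ne _ e] at hU hW hW'
    obtain ⟨h₁, h₂, h₃⟩ := H.2.2 k U W W' hU hW hW'
    exact ⟨h₁, h₂, h₃.mono_store hs hw⟩

theorem update (H : HowHeap S h h') {l : ℕ} {T : Ty} {V V' : Tm} (hl : S.lookup l = some T)
    (hV : V.IsValue) (hV' : V'.IsValue) (hVV' : How S [] [] Layer.one V V' T) :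
    HowHeap S (h.insert l V) (h'.insert l V') := by
  have hm := mem_of_lookup hl
  refine ⟨insert_mem_iff H.1 hm V, insert_mem_iff H.2.1 hm V', fun k U W W' hU hW hW' => ?_⟩
  by_cases e : k = l
  · subst e
    rw [Finmap.lookup_insert] at hW hW'
    rw [hl] at hU
    cases hU; cases hW; cases hW'
    exact ⟨hV, hV', hVV'⟩
  · rw [Finmap.lookup_insert_of_ne _ e] at hW hW'
    exact H.2.2 k U W W' hU hW hW'

end HowHeap

/-- A `Ciu` step can only be applied to the term in focus. This brings a function waiting in a frame
back into focus, so that it can be replaced there. -/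
theorem halts_appR {K : List Frame} {V W : Tm} {h : Heap} (hV : V.IsValue)
    (H : Halts (.appL W :: K) V h) : Halts (.appR V :: K) W h :=
  (halts_frame (F := .appR V) hV K W h).1 ((halts_frame (F := .appL W) trivial K V h).2 H)

theorem halts_arithR {K : List Frame} {o : ArithOp} {V W : Tm} {h : Heap} (hV : V.IsValue)
    (H : Halts (.arithL o W :: K) V h) : Halts (.arithR o V :: K) W h :=
  (halts_frame (F := .arithR o V) hV K W h).1
    ((halts_frame (F := .arithL o W) trivial K V h).2 H)

theorem halts_assignR {K : List Frame} {V W : Tm} {h : Heap} (hV : V.IsValue)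
    (H : Halts (.assignL W :: K) V h) : Halts (.assignR V :: K) W h :=
  (halts_frame (F := .assignR V) hV K W h).1
    ((halts_frame (F := .assignL W) trivial K V h).2 H)

/-- Stacks related by the Howe closure. -/
abbrev HowStack (S : SCtx) (K K' : List Frame) (T : Ty) : Prop :=
  StackRel (fun Ψ M N T => How S Ψ [] Layer.one M N T) K K' T

theorem HowStack.right {S : SCtx} {K K' : List Frame} {T : Ty} (h : HowStack S K K' T) :
    StackTy S K' T :=
  StackRel.right (R' := fun Ψ M _ T => HasTy S Ψ [] Layer.one M T)
    (fun _ _ _ _ h => h.hasTy_right) h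

theorem HasTy.lookup_of_loc {S : SCtx} {Ψ : GCtx} {Γ : LCtx} {i : Layer} {l : ℕ} {T : Ty}
    (h : HasTy S Ψ Γ i (.loc l) (.ref T)) : S.lookup l = some T := by
  cases h with
  | loc _ _ _ h _ => exact h

/-- Induction on the left run. A focused value is related to a value `V'` with `V'` below `N`; by
the `Ciu` step, tested in the typed right stack, `N` may be replaced by `V'`, and the right machine
then makes the matching move. A function, number or location stored in a frame is treated in the
same way after moving it into focus. Substitutivity of `How` restores the relation after `beta`,
`recfn` and `unbox`. -/
theorem Halts.how {K₁ : List Frame} {P : Tm} {h₁ : Heap} (H : Halts K₁ P h₁) :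
    ∀ {S : SCtx} {K₂ : List Frame} {N : Tm} {h₂ : Heap} {T : Ty}, HowStack S K₁ K₂ T →
      HowHeap S h₁ h₂ → How S [] [] Layer.one P N T → Halts K₂ N h₂ := by
  induction H with
  | done hV =>
    intro S K₂ N h₂ T hK hh hN
    cases hK
    obtain ⟨V', hV', -, hc⟩ := hN.exists_value hV
    exact hc.halts .nil hh.right (.done hV')
  | app _ ih =>
    intro S K₂ N h₂ T hK hh hN
    cases hN with
    | app h₁ h₂ hc => exact hc.halts (HowStack.right hK) hh.right (.app (ih (.cons (.appL h₂) hK) hh h₁))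
  | arith _ ih =>
    intro S K₂ N h₂ T hK hh hN
    cases hN with
    | arith h₁ h₂ hc =>
      exact hc.halts (HowStack.right hK) hh.right (.arith (ih (.cons (.arithL h₂) hK) hh h₁))
  | ite _ ih =>
    intro S K₂ N h₂ T hK hh hN
    cases hN with
    | ite h₁ h₂ h₃ hc =>
      exact hc.halts (HowStack.right hK) hh.right (.ite (ih (.cons (.ite h₂ h₃) hK) hh h₁))
  | ref _ ih =>
    intro S K₂ N h₂ T hK hh hN
    cases hN with
    | ref h₁ hc => exact hc.halts (HowStack.right hK) hh.right (.ref (ih (.cons .ref hK) hh h₁))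
  | deref _ ih =>
    intro S K₂ N h₂ T hK hh hN
    cases hN with
    | deref h₁ hc => exact hc.halts (HowStack.right hK) hh.right (.deref (ih (.cons .deref hK) hh h₁))
  | assign _ ih =>
    intro S K₂ N h₂ T hK hh hN
    cases hN with
    | assign h₁ h₂ hc =>
      exact hc.halts (HowStack.right hK) hh.right (.assign (ih (.cons (.assignL h₂) hK) hh h₁))
  | letbox _ ih =>
    intro S K₂ N h₂ T hK hh hN
    cases hN with
    | letbox h₁ h₂ hc =>
      exact hc.halts (HowStack.right hK) hh.right (.letbox (ih (.cons (.letbox h₂) hK) hh h₁))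
  | appL hV _ ih =>
    intro S K₂ N h₂ T hK hh hN
    obtain ⟨V', hV', hVV', hc⟩ := hN.exists_value hV
    refine hc.halts (HowStack.right hK) hh.right ?_
    cases hK with
    | cons hF hK =>
      cases hF with
      | appL h₂ => exact .appL hV' (ih (.cons (.appR hV hV' hVV') hK) hh h₂)
  | arithL hV _ ih =>
    intro S K₂ N h₂ T hK hh hN
    obtain ⟨V', hV', hVV', hc⟩ := hN.exists_value hV
    refine hc.halts (HowStack.right hK) hh.right ?_
    cases hK with
    | cons hF hK =>
      cases hF with
      | arithL h₂ => exact .arithL hV' (ih (.cons (.arithR hV hV' hVV') hK) hh h₂)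
  | assignL hV _ ih =>
    intro S K₂ N h₂ T hK hh hN
    obtain ⟨V', hV', hVV', hc⟩ := hN.exists_value hV
    refine hc.halts (HowStack.right hK) hh.right ?_
    cases hK with
    | cons hF hK =>
      cases hF with
      | assignL h₂ => exact .assignL hV' (ih (.cons (.assignR hV hV' hVV') hK) hh h₂)
  | beta hV _ ih =>
    intro S K₂ N h₂ T hK hh hN
    obtain ⟨V', hV', hVV', hc⟩ := hN.exists_value hV
    refine hc.halts (HowStack.right hK) hh.right ?_
    cases hK with
    | cons hF hK =>
      cases hF with
      | appR _ hW hF =>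
        cases hF with
        | lam h₁ hc =>
          refine halts_appR hW (hc.halts (.cons (.appL hVV'.hasTy_right) (HowStack.right hK)) hh.right ?_)
          exact .appL (.lam _) (.beta hV' (ih hK hh
            (h₁.lsubst (HowLSub.cons hV hV' hVV' HowLSub.nil) LCtxWF.nil)))
  | recfn hV _ ih =>
    intro S K₂ N h₂ T hK hh hN
    obtain ⟨V', hV', hVV', hc⟩ := hN.exists_value hV
    refine hc.halts (HowStack.right hK) hh.right ?_
    cases hK with
    | cons hF hK =>
      cases hF with
      | appR _ hW hF =>
        cases hF with
        | recfn h₁ hc =>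
          refine halts_appR hW (hc.halts (.cons (.appL hVV'.hasTy_right) (HowStack.right hK)) hh.right ?_)
          -- The unfolded body mentions the recursive function itself, so the two `recfn` terms are
          -- also supplied as related values.
          exact .appL (.recfn _) (.recfn hV' (ih hK hh (h₁.lsubst (HowLSub.cons hV hV' hVV'
            (HowLSub.cons (.recfn _) (.recfn _) (.recfn h₁ (.refl hc.1)) HowLSub.nil))
            LCtxWF.nil)))
  | arithR _ ih =>
    intro S K₂ N h₂ T hK hh hN
    cases hN with
    | num n hc₂ =>
      refine hc₂.halts (HowStack.right hK) hh.right ?_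
      cases hK with
      | cons hF hK =>
        cases hF with
        | arithR _ hW hF =>
          cases hF with
          | num m hc =>
            refine halts_arithR hW (hc.halts (.cons (.arithL hc₂.1) (HowStack.right hK)) hh.right ?_)
            exact .arithL (.num _) (.arithR (ih hK hh
              (.refl (.num _ hc.1.sctxWF GCtxWF.nil LCtxWF.nil))))
  | iteTrue hn _ ih =>
    intro S K₂ N h₂ T hK hh hN
    cases hN with
    | num n hc =>
      refine hc.halts (HowStack.right hK) hh.right ?_
      cases hK with
      | cons hF hK =>
        cases hF with
        | ite h₁ h₂ => exact .iteTrue hn (ih hK hh h₁)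
  | iteFalse _ ih =>
    intro S K₂ N h₂ T hK hh hN
    cases hN with
    | num n hc =>
      refine hc.halts (HowStack.right hK) hh.right ?_
      cases hK with
      | cons hF hK =>
        cases hF with
        | ite h₁ h₂ => exact .iteFalse (ih hK hh h₂)
  | @alloc K V h l hV hl _ ih =>
    intro S K₂ N h₂ T hK hh hN
    obtain ⟨V', hV', hVV', hc⟩ := hN.exists_value hV
    refine hc.halts (HowStack.right hK) hh.right ?_
    cases hK with
    | cons hF hK =>
      cases hF with
      | ref =>
        have hty := hVV'.hasTy_right
        have hw := hty.sctxWF.insert l hty.tyWF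
        have hlS : l ∉ S := fun h => hl ((hh.1 l).1 h)
        have hs : SCtxSub S (S.insert l T) := SCtxSub.insert hlS T
        -- The right machine allocates the same location as the left one.
        refine .alloc hV' (fun h => hlS ((hh.2.1 l).2 h)) (ih
          (StackRel.mono (fun _ _ _ _ h => h.mono_store hs hw) hK) (hh.alloc hl hV hV' hVV') ?_)
        exact .refl (.loc hw GCtxWF.nil LCtxWF.nil (Finmap.lookup_insert _) hty.tyWF)
  | load hl _ ih =>
    intro S K₂ N h₂ T hK hh hN
    cases hN with
    | loc hc =>
      refine hc.halts (HowStack.right hK) hh.right ?_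
      cases hK with
      | cons hF hK =>
        cases hF with
        | deref =>
          have hT := hc.1.lookup_of_loc
          obtain ⟨V', hV'⟩ := exists_lookup_of_mem ((hh.2.1 _).1 (mem_of_lookup hT))
          exact .load hV' (ih hK hh (hh.2.2 _ _ _ _ hT hl hV').2.2)
  | assignR hV hl _ ih =>
    intro S K₂ N h₂ T hK hh hN
    obtain ⟨V', hV', hVV', hc₂⟩ := hN.exists_value hV
    refine hc₂.halts (HowStack.right hK) hh.right ?_
    cases hK with
    | cons hF hK =>
      cases hF with
      | assignR _ hW hF =>
        cases hF with
        | loc hc =>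
          have hT := hc.1.lookup_of_loc
          refine halts_assignR hW (hc.halts (.cons (.assignL hc₂.1) (HowStack.right hK)) hh.right ?_)
          exact .assignL (.loc _) (.assignR hV' ((hh.2.1 _).1 (mem_of_lookup hT)) (ih hK
            (hh.update hT hV hV' hVV') (.refl (.unit hc.1.sctxWF GCtxWF.nil LCtxWF.nil))))
  | unbox _ ih =>
    intro S K₂ N h₂ T hK hh hN
    cases hN with
    | box h₁ hc =>
      refine hc.halts (HowStack.right hK) hh.right ?_
      cases hK with
      | cons hF hK =>
        cases hF with
        | letbox hN =>
          -- Both sides insert one piece of code, and the bodies of the two boxes are related at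
          -- layer zero as `HowGSub` demands.
          refine .unbox (ih hK hh (hN.gsubst (fun u Γ T hu => ?_) GCtxWF.nil))
          cases u with
          | zero =>
            cases hu
            exact .inr ⟨_, _, rfl, rfl, h₁⟩
          | succ u => simp at hu

/-! ### From the Howe closure to contextual approximation -/

theorem Ciu.of_le {S : SCtx} {Ψ : GCtx} {Γ : LCtx} {i i' : Layer} {M N : Tm} {T : Ty}
    (h : Ciu S Ψ Γ i M N T) (hi : i ≤ i') : Ciu S Ψ Γ i' M N T := by
  rcases hi with rfl | rfl
  · cases i'
    exacts [h, h.lift]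
  · exact h.lift

theorem CtxHasTy.how {S : SCtx} {Ψ Ψ' : GCtx} {Γ Γ' : LCtx} {i i' : Layer} {T T' : Ty} {C : Ctx}
    {M N : Tm} (hM : Ciu S Ψ' Γ' i' M N T') (hC : CtxHasTy S Ψ' Γ' i' T' C Ψ Γ i T) :
    How S Ψ Γ i (C.plug M) (C.plug N) T := by
  induction hC with
  | hole h₁ h₂ h₃ hξ hρ hi =>
    -- The hole may weaken the contexts and raise the layer; raising the layer is where `Ciu` rather
    -- than layer-zero CIU approximation is required.
    have h := (hM.of_le hi).rename hρ.1 hξ.1 h₃ h₂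
    exact (How.refl h.1).trans_ciu h
  | lam _ ih => exact .lam ih (.refl (.lam ih.hasTy_right))
  | appL _ hN ih => exact .app ih (.refl hN) (.refl (.app ih.hasTy_right hN))
  | appR hN _ ih => exact .app (.refl hN) ih (.refl (.app hN ih.hasTy_right))
  | recfn _ ih => exact .recfn ih (.refl (.recfn ih.hasTy_right))
  | arithL o _ hN ih => exact .arith ih (.refl hN) (.refl (.arith o ih.hasTy_right hN))
  | arithR o hN _ ih => exact .arith (.refl hN) ih (.refl (.arith o hN ih.hasTy_right))
  | iteC _ h₁ h₂ ih => exact .ite ih (.refl h₁) (.refl h₂) (.refl (.ite ih.hasTy_right h₁ h₂))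
  | iteT h₁ _ h₂ ih => exact .ite (.refl h₁) ih (.refl h₂) (.refl (.ite h₁ ih.hasTy_right h₂))
  | iteE h₁ h₂ _ ih => exact .ite (.refl h₁) (.refl h₂) ih (.refl (.ite h₁ h₂ ih.hasTy_right))
  | ref _ ih => exact .ref ih (.refl (.ref ih.hasTy_right))
  | deref _ ih => exact .deref ih (.refl (.deref ih.hasTy_right))
  | assignL _ hN ih => exact .assign ih (.refl hN) (.refl (.assign ih.hasTy_right hN))
  | assignR hN _ ih => exact .assign (.refl hN) ih (.refl (.assign hN ih.hasTy_right))
  | box h _ ih => exact .box ih (.refl (.box h ih.hasTy_right))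
  | letboxL _ hN ih => exact .letbox ih (.refl hN) (.refl (.letbox ih.hasTy_right hN))
  | letboxR hN _ ih => exact .letbox (.refl hN) ih (.refl (.letbox hN ih.hasTy_right))

theorem CtxHasTy.sctxWF {S : SCtx} {Ψ Ψ' : GCtx} {Γ Γ' : LCtx} {i i' : Layer} {T T' : Ty}
    {C : Ctx} (hC : CtxHasTy S Ψ' Γ' i' T' C Ψ Γ i T) : SCtxWF S := by
  induction hC with
  | hole h => exact h
  | _ => assumption

theorem Ciu.ctxApprox {S : SCtx} {Ψ : GCtx} {Γ : LCtx} {i : Layer} {T : Ty} {M N : Tm}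
    (h : Ciu S Ψ Γ i M N T) : CtxApprox S Ψ Γ i T M N := by
  intro S' C i' T' hp hS hC hh H
  -- The program may be of layer zero, while the machine lemma is stated at layer one.
  have hH := (hC.how (h.mono_store hS hC.sctxWF)).lift
  exact (converges_iff_halts _ _).2
    (((converges_iff_halts _ _).1 H).how .nil (HowHeap.refl hh) hH)

/-! ### Eta expansion through the heap -/

/-- `Eta V ℓ P M M'`: `M'` arises from `M` by renaming locations along `P` and by replacing some
occurrences of the closed value `V` by the function `λ x. (!ℓ) x`. -/
inductive Eta (V : Tm) (ℓ : ℕ) (P : ℕ → ℕ → Prop) : Tm → Tm → Prop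
  | eta {M : Tm} : M = V → Eta V ℓ P M (.lam (.app (.deref (.loc ℓ)) (.var 0)))
  | unit : Eta V ℓ P .unit .unit
  | num (n : ℕ) : Eta V ℓ P (.num n) (.num n)
  | var (x : ℕ) : Eta V ℓ P (.var x) (.var x)
  | gvar {u n : ℕ} {δ δ' : Fin n → Tm} : (∀ k, Eta V ℓ P (δ k) (δ' k)) →
      Eta V ℓ P (.gvar u n δ) (.gvar u n δ')
  | loc {l l' : ℕ} : P l l' → Eta V ℓ P (.loc l) (.loc l')
  | lam {M M' : Tm} : Eta V ℓ P M M' → Eta V ℓ P (.lam M) (.lam M')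
  | app {M M' N N' : Tm} : Eta V ℓ P M M' → Eta V ℓ P N N' → Eta V ℓ P (.app M N) (.app M' N')
  | recfn {M M' : Tm} : Eta V ℓ P M M' → Eta V ℓ P (.recfn M) (.recfn M')
  | arith {o : ArithOp} {M M' N N' : Tm} : Eta V ℓ P M M' → Eta V ℓ P N N' →
      Eta V ℓ P (.arith o M N) (.arith o M' N')
  | ite {M M' N N' Q Q' : Tm} : Eta V ℓ P M M' → Eta V ℓ P N N' → Eta V ℓ P Q Q' →
      Eta V ℓ P (.ite M N Q) (.ite M' N' Q')
  | ref {M M' : Tm} : Eta V ℓ P M M' → Eta V ℓ P (.ref M) (.ref M')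
  | deref {M M' : Tm} : Eta V ℓ P M M' → Eta V ℓ P (.deref M) (.deref M')
  | assign {M M' N N' : Tm} : Eta V ℓ P M M' → Eta V ℓ P N N' →
      Eta V ℓ P (.assign M N) (.assign M' N')
  | box {M M' : Tm} : Eta V ℓ P M M' → Eta V ℓ P (.box M) (.box M')
  | letbox {M M' N N' : Tm} : Eta V ℓ P M M' → Eta V ℓ P N N' →
      Eta V ℓ P (.letbox M N) (.letbox M' N')

/-- `V` is invariant under renaming and substitution. -/
structure Invariant (V : Tm) : Prop where
  rename : ∀ ρ ξ, V.rename ρ ξ = V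
  lsubst : ∀ τ, V.lsubst τ = V
  gsubst : ∀ σ, V.gsubst σ = V

theorem HasTy.invariant {S : SCtx} {i : Layer} {V : Tm} {T : Ty} (h : HasTy S [] [] i V T) :
    Invariant V :=
  ⟨h.rename_closed, h.lsubst_closed, h.gsubst_closed⟩

namespace Eta

variable {V : Tm} {ℓ : ℕ} {P P' : ℕ → ℕ → Prop} {M M' : Tm}

theorem mono (hP : ∀ l l', P l l' → P' l l') (h : Eta V ℓ P M M') : Eta V ℓ P' M M' := by
  induction h with
  | eta e => exact .eta e
  | unit => exact .unit
  | num n => exact .num n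
  | var x => exact .var x
  | gvar _ ih => exact .gvar ih
  | loc h => exact .loc (hP _ _ h)
  | lam _ ih => exact .lam ih
  | app _ _ ih₁ ih₂ => exact .app ih₁ ih₂
  | recfn _ ih => exact .recfn ih
  | arith _ _ ih₁ ih₂ => exact .arith ih₁ ih₂
  | ite _ _ _ ih₁ ih₂ ih₃ => exact .ite ih₁ ih₂ ih₃
  | ref _ ih => exact .ref ih
  | deref _ ih => exact .deref ih
  | assign _ _ ih₁ ih₂ => exact .assign ih₁ ih₂
  | box _ ih => exact .box ih
  | letbox _ _ ih₁ ih₂ => exact .letbox ih₁ ih₂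

/-- All locations of a typed term belong to its store context, so a location outside `S` is never a
partner under this relation. -/
theorem refl {S : SCtx} {Ψ : GCtx} {Γ : LCtx} {i : Layer} {T : Ty} (h : HasTy S Ψ Γ i M T) :
    Eta V ℓ (fun l l' => l = l' ∧ l ∈ S) M M := by
  induction h with
  | unit => exact .unit
  | num n => exact .num n
  | var => exact .var _
  | gvar _ _ _ hl _ _ _ ih => exact .gvar fun k => ih k _ (List.getElem?_eq_getElem (by omega))
  | loc _ _ _ h => exact .loc ⟨rfl, mem_of_lookup h⟩
  | lam _ ih => exact .lam ih
  | app _ _ ih₁ ih₂ => exact .app ih₁ ih₂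
  | recfn _ ih => exact .recfn ih
  | arith _ _ _ ih₁ ih₂ => exact .arith ih₁ ih₂
  | ite _ _ _ ih₁ ih₂ ih₃ => exact .ite ih₁ ih₂ ih₃
  | ref _ ih => exact .ref ih
  | deref _ ih => exact .deref ih
  | assign _ _ ih₁ ih₂ => exact .assign ih₁ ih₂
  | box _ _ ih => exact .box ih
  | letbox _ _ ih₁ ih₂ => exact .letbox ih₁ ih₂

theorem rename (hV : Invariant V) (h : Eta V ℓ P M M') : ∀ ρ ξ : ℕ → ℕ,
    Eta V ℓ P (M.rename ρ ξ) (M'.rename ρ ξ) := by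
  induction h with
  | eta e => exact fun ρ ξ => .eta (e ▸ hV.rename ρ ξ)
  | unit => exact fun _ _ => .unit
  | num n => exact fun _ _ => .num n
  | var x => exact fun _ _ => .var _
  | gvar _ ih => exact fun _ _ => .gvar fun k => ih k _ _
  | loc h => exact fun _ _ => .loc h
  | lam _ ih => exact fun _ _ => .lam (ih _ _)
  | app _ _ ih₁ ih₂ => exact fun _ _ => .app (ih₁ _ _) (ih₂ _ _)
  | recfn _ ih => exact fun _ _ => .recfn (ih _ _)
  | arith _ _ ih₁ ih₂ => exact fun _ _ => .arith (ih₁ _ _) (ih₂ _ _)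
  | ite _ _ _ ih₁ ih₂ ih₃ => exact fun _ _ => .ite (ih₁ _ _) (ih₂ _ _) (ih₃ _ _)
  | ref _ ih => exact fun _ _ => .ref (ih _ _)
  | deref _ ih => exact fun _ _ => .deref (ih _ _)
  | assign _ _ ih₁ ih₂ => exact fun _ _ => .assign (ih₁ _ _) (ih₂ _ _)
  | box _ ih => exact fun _ _ => .box (ih _ _)
  | letbox _ _ ih₁ ih₂ => exact fun _ _ => .letbox (ih₁ _ _) (ih₂ _ _)

theorem scons {N N' : Tm} {τ τ' : ℕ → Tm} (h : Eta V ℓ P N N')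
    (hτ : ∀ x, Eta V ℓ P (τ x) (τ' x)) (x : ℕ) : Eta V ℓ P (scons N τ x) (scons N' τ' x) := by
  cases x
  exacts [h, hτ _]

theorem upL (hV : Invariant V) {τ τ' : ℕ → Tm} (hτ : ∀ x, Eta V ℓ P (τ x) (τ' x)) :
    ∀ x, Eta V ℓ P (upL τ x) (upL τ' x) :=
  scons (.var 0) fun k => (hτ k).rename hV _ _

theorem lsubst (hV : Invariant V) (h : Eta V ℓ P M M') : ∀ {τ τ' : ℕ → Tm},
    (∀ x, Eta V ℓ P (τ x) (τ' x)) → Eta V ℓ P (M.lsubst τ) (M'.lsubst τ') := by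
  induction h with
  | eta e => exact fun _ => .eta (by rw [e, hV.lsubst])
  | unit => exact fun _ => .unit
  | num n => exact fun _ => .num n
  | var x => exact fun hτ => hτ x
  | gvar _ ih => exact fun hτ => .gvar fun k => ih k hτ
  | loc h => exact fun _ => .loc h
  | lam _ ih => exact fun hτ => .lam (ih (upL hV hτ))
  | app _ _ ih₁ ih₂ => exact fun hτ => .app (ih₁ hτ) (ih₂ hτ)
  | recfn _ ih => exact fun hτ => .recfn (ih (upL hV (upL hV hτ)))
  | arith _ _ ih₁ ih₂ => exact fun hτ => .arith (ih₁ hτ) (ih₂ hτ)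
  | ite _ _ _ ih₁ ih₂ ih₃ => exact fun hτ => .ite (ih₁ hτ) (ih₂ hτ) (ih₃ hτ)
  | ref _ ih => exact fun hτ => .ref (ih hτ)
  | deref _ ih => exact fun hτ => .deref (ih hτ)
  | assign _ _ ih₁ ih₂ => exact fun hτ => .assign (ih₁ hτ) (ih₂ hτ)
  | box h _ => exact fun _ => .box h
  | letbox _ _ ih₁ ih₂ =>
    exact fun hτ => .letbox (ih₁ hτ) (ih₂ fun x => (hτ x).rename hV _ _)

theorem ofFin {n : ℕ} {δ δ' : Fin n → Tm} (h : ∀ k, Eta V ℓ P (δ k) (δ' k)) (x : ℕ) :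
    Eta V ℓ P (ofFin δ x) (ofFin δ' x) := by
  unfold Tm.ofFin
  split
  exacts [h _, .var _]

/-- Global substitutions related pointwise. -/
inductive GSubEntry (V : Tm) (ℓ : ℕ) (P : ℕ → ℕ → Prop) : ℕ ⊕ Tm → ℕ ⊕ Tm → Prop
  | inl (v : ℕ) : GSubEntry V ℓ P (.inl v) (.inl v)
  | inr {N N' : Tm} : Eta V ℓ P N N' → GSubEntry V ℓ P (.inr N) (.inr N')

theorem gsubst (hV : Invariant V) (h : Eta V ℓ P M M') : ∀ {σ σ' : GSub},
    (∀ u, GSubEntry V ℓ P (σ u) (σ' u)) → Eta V ℓ P (M.gsubst σ) (M'.gsubst σ') := by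
  induction h with
  | eta e => exact fun _ => .eta (by rw [e, hV.gsubst])
  | unit => exact fun _ => .unit
  | num n => exact fun _ => .num n
  | var x => exact fun hσ => .var x
  | @gvar u n δ δ' _ ih =>
    intro σ σ' hσ
    simp only [Tm.gsubst]
    have hu := hσ u
    revert hu
    generalize σ u = a
    generalize σ' u = b
    intro hu
    cases hu with
    | inl v => exact .gvar fun k => ih k hσ
    | inr hN => exact hN.lsubst hV (ofFin fun k => ih k hσ)
  | loc h => exact fun _ => .loc h
  | lam _ ih => exact fun hσ => .lam (ih hσ)
  | app _ _ ih₁ ih₂ => exact fun hσ => .app (ih₁ hσ) (ih₂ hσ)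
  | recfn _ ih => exact fun hσ => .recfn (ih hσ)
  | arith _ _ ih₁ ih₂ => exact fun hσ => .arith (ih₁ hσ) (ih₂ hσ)
  | ite _ _ _ ih₁ ih₂ ih₃ => exact fun hσ => .ite (ih₁ hσ) (ih₂ hσ) (ih₃ hσ)
  | ref _ ih => exact fun hσ => .ref (ih hσ)
  | deref _ ih => exact fun hσ => .deref (ih hσ)
  | assign _ _ ih₁ ih₂ => exact fun hσ => .assign (ih₁ hσ) (ih₂ hσ)
  | box _ ih => exact fun hσ => .box (ih hσ)
  | letbox _ _ ih₁ ih₂ =>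
    intro σ σ' hσ
    refine .letbox (ih₁ hσ) (ih₂ fun u => ?_)
    cases u with
    | zero => exact .inl 0
    | succ u =>
      simp only [upGSub]
      have hu := hσ u
      revert hu
      generalize σ u = a
      generalize σ' u = b
      intro hu
      cases hu with
      | inl v => exact .inl _
      | inr hN => exact .inr (hN.rename hV _ _)

theorem gsubst_gcons (hV : Invariant V) (h : Eta V ℓ P M M') {N N' : Tm}
    (hN : Eta V ℓ P N N') :
    Eta V ℓ P (M.gsubst (gcons N Sum.inl)) (M'.gsubst (gcons N' Sum.inl)) := by
  refine h.gsubst hV fun u => ?_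
  cases u
  exacts [.inr hN, .inl _]

/-- The two sides can differ in their outermost constructor only where `V` faces its expansion, and
both of these are values. -/
theorem isValue_iff (hV : V.IsValue) (h : Eta V ℓ P M M') : M.IsValue ↔ M'.IsValue := by
  cases h with
  | eta e => exact iff_of_true (e ▸ hV) (.lam _)
  | unit => exact Iff.rfl
  | num n => exact Iff.rfl
  | var x => exact Iff.rfl
  | loc => exact iff_of_true (.loc _) (.loc _)
  | lam => exact iff_of_true (.lam _) (.lam _)
  | recfn => exact iff_of_true (.recfn _) (.recfn _)
  | box => exact iff_of_true (.box _) (.box _)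
  | _ => constructor <;> intro h <;> cases h

end Eta

/-- The extension of `Eta` to frames. -/
inductive FrameEta (V : Tm) (ℓ : ℕ) (P : ℕ → ℕ → Prop) : Frame → Frame → Prop
  | appL {N N' : Tm} : Eta V ℓ P N N' → FrameEta V ℓ P (.appL N) (.appL N')
  | appR {N N' : Tm} : N.IsValue → Eta V ℓ P N N' → FrameEta V ℓ P (.appR N) (.appR N')
  | arithL {o : ArithOp} {N N' : Tm} : Eta V ℓ P N N' →
      FrameEta V ℓ P (.arithL o N) (.arithL o N')
  | arithR {o : ArithOp} {N N' : Tm} : Eta V ℓ P N N' →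
      FrameEta V ℓ P (.arithR o N) (.arithR o N')
  | ite {N N' Q Q' : Tm} : Eta V ℓ P N N' → Eta V ℓ P Q Q' →
      FrameEta V ℓ P (.ite N Q) (.ite N' Q')
  | ref : FrameEta V ℓ P .ref .ref
  | deref : FrameEta V ℓ P .deref .deref
  | assignL {N N' : Tm} : Eta V ℓ P N N' → FrameEta V ℓ P (.assignL N) (.assignL N')
  | assignR {N N' : Tm} : Eta V ℓ P N N' → FrameEta V ℓ P (.assignR N) (.assignR N')
  | letbox {N N' : Tm} : Eta V ℓ P N N' → FrameEta V ℓ P (.letbox N) (.letbox N')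

/-- The extension of `Eta` to stacks. -/
abbrev StackEta (V : Tm) (ℓ : ℕ) (P : ℕ → ℕ → Prop) : List Frame → List Frame → Prop :=
  List.Forall₂ (FrameEta V ℓ P)

theorem FrameEta.mono {V : Tm} {ℓ : ℕ} {P P' : ℕ → ℕ → Prop} (hP : ∀ l l', P l l' → P' l l')
    {F F' : Frame} (h : FrameEta V ℓ P F F') : FrameEta V ℓ P' F F' := by
  cases h with
  | appL h => exact .appL (h.mono hP)
  | appR hv h => exact .appR hv (h.mono hP)
  | arithL h => exact .arithL (h.mono hP)
  | arithR h => exact .arithR (h.mono hP)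
  | ite h h' => exact .ite (h.mono hP) (h'.mono hP)
  | ref => exact .ref
  | deref => exact .deref
  | assignL h => exact .assignL (h.mono hP)
  | assignR h => exact .assignR (h.mono hP)
  | letbox h => exact .letbox (h.mono hP)

theorem StackEta.mono {V : Tm} {ℓ : ℕ} {P P' : ℕ → ℕ → Prop} (hP : ∀ l l', P l l' → P' l l')
    {K K' : List Frame} (h : StackEta V ℓ P K K') : StackEta V ℓ P' K K' :=
  List.Forall₂.imp (fun _ _ => FrameEta.mono hP) h

theorem StackEta.refl {V : Tm} {ℓ : ℕ} {S : SCtx} {K : List Frame} : ∀ {T : Ty},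
    StackTy S K T → StackEta V ℓ (fun l l' => l = l' ∧ l ∈ S) K K := by
  induction K with
  | nil => exact fun _ => .nil
  | cons F K ih =>
    intro T hK
    cases hK with
    | cons hF hK =>
      refine .cons ?_ (ih hK)
      cases hF with
      | appL h => exact .appL (.refl h)
      | appR hV _ h => exact .appR hV (.refl h)
      | arithL h => exact .arithL (.refl h)
      | arithR _ _ h => exact .arithR (.refl h)
      | ite h h' => exact .ite (.refl h) (.refl h')
      | ref => exact .ref
      | deref => exact .deref
      | assignL h => exact .assignL (.refl h)
      | assignR _ _ h => exact .assignR (.refl h)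
      | letbox h => exact .letbox (.refl h)

/-- The relation between a heap and a heap in which in addition `ℓ` holds the function `V`. -/
structure HeapEta (V : Tm) (ℓ : ℕ) (P : ℕ → ℕ → Prop) (h h' : Heap) : Prop where
  entry : ∀ l l', P l l' → ∃ W W', h.lookup l = some W ∧ h'.lookup l' = some W' ∧ Eta V ℓ P W W'
  right_unique : ∀ l l' m', P l l' → P l m' → l' = m'
  left_unique : ∀ l m l', P l l' → P m l' → l = m
  ne : ∀ l l', P l l' → l' ≠ ℓ
  target : h'.lookup ℓ = some V
  body : ∃ M, (V = .lam M ∨ V = .recfn M) ∧ Eta V ℓ P M M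

namespace HeapEta

variable {V : Tm} {ℓ : ℕ} {P : ℕ → ℕ → Prop} {h h' : Heap}

theorem isValue (H : HeapEta V ℓ P h h') : V.IsValue := by
  obtain ⟨M, rfl | rfl, -⟩ := H.body
  exacts [.lam M, .recfn M]

theorem self (H : HeapEta V ℓ P h h') : Eta V ℓ P V V := by
  obtain ⟨M, e, hM⟩ := H.body
  rcases e with e | e
  · have := Eta.lam hM
    rwa [← e] at this
  · have := Eta.recfn hM
    rwa [← e] at this

/-- The run without `ℓ` is free to allocate the number `ℓ` itself, so the two runs cannot be forced
to use equal locations; the partial bijection `P` records the pairs instead. -/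
theorem alloc (H : HeapEta V ℓ P h h') {l l' : ℕ} {W W' : Tm} (hl : l ∉ h) (hl' : l' ∉ h')
    (hW : Eta V ℓ P W W') :
    HeapEta V ℓ (fun a b => P a b ∨ (a = l ∧ b = l')) (h.insert l W) (h'.insert l' W') := by
  have hP : ∀ a b, P a b → P a b ∨ (a = l ∧ b = l') := fun _ _ => Or.inl
  have h₁ : ∀ {a b}, P a b → a ≠ l := by
    rintro a b hab rfl
    obtain ⟨_, _, h₁, _⟩ := H.entry _ _ hab
    exact hl (mem_of_lookup h₁)
  have h₂ : ∀ {a b}, P a b → b ≠ l' := by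
    rintro a b hab rfl
    obtain ⟨_, _, _, h₁, _⟩ := H.entry _ _ hab
    exact hl' (mem_of_lookup h₁)
  have h₃ : ℓ ≠ l' := by
    rintro rfl
    exact hl' (mem_of_lookup H.target)
  refine ⟨?_, ?_, ?_, ?_, ?_, ?_⟩
  · rintro a b (hab | ⟨rfl, rfl⟩)
    · obtain ⟨X, X', e, e', hX⟩ := H.entry a b hab
      refine ⟨X, X', ?_, ?_, hX.mono hP⟩
      · rw [Finmap.lookup_insert_of_ne _ (h₁ hab), e]
      · rw [Finmap.lookup_insert_of_ne _ (h₂ hab), e']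
    · exact ⟨W, W', Finmap.lookup_insert _, Finmap.lookup_insert _, hW.mono hP⟩
  · rintro a b b' (hab | ⟨rfl, rfl⟩) (hab' | ⟨e, rfl⟩)
    · exact H.right_unique _ _ _ hab hab'
    · exact absurd e (h₁ hab)
    · exact absurd rfl (h₁ hab')
    · rfl
  · rintro a a' b (hab | ⟨rfl, rfl⟩) (hab' | ⟨rfl, e⟩)
    · exact H.left_unique _ _ _ hab hab'
    · exact absurd e (h₂ hab)
    · exact absurd rfl (h₂ hab')
    · rfl
  · rintro a b (hab | ⟨rfl, rfl⟩)
    exacts [H.ne a b hab, h₃.symm]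
  · rw [Finmap.lookup_insert_of_ne _ h₃, H.target]
  · obtain ⟨M, e, hM⟩ := H.body
    exact ⟨M, e, hM.mono hP⟩

/-- Assignment changes exactly one pair because `P` is injective in both directions, and it never
touches `ℓ` because `ℓ` has no partner. -/
theorem update (H : HeapEta V ℓ P h h') {l l' : ℕ} {W W' : Tm} (hl : P l l')
    (hW : Eta V ℓ P W W') : HeapEta V ℓ P (h.insert l W) (h'.insert l' W') := by
  refine ⟨fun a b hab => ?_, H.right_unique, H.left_unique, H.ne, ?_, H.body⟩
  · by_cases e : a = l
    · subst e
      obtain rfl := H.right_unique _ _ _ hl hab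
      exact ⟨W, W', Finmap.lookup_insert _, Finmap.lookup_insert _, hW⟩
    · have e' : b ≠ l' := by
        rintro rfl
        exact e (H.left_unique _ _ _ hab hl)
      rw [Finmap.lookup_insert_of_ne _ e, Finmap.lookup_insert_of_ne _ e']
      exact H.entry a b hab
  · rw [Finmap.lookup_insert_of_ne _ (H.ne _ _ hl).symm, H.target]

end HeapEta

/-! ### Simulations between a function and its expansion -/

theorem exists_notMem_heap (h : Heap) : ∃ l : ℕ, l ∉ h := by
  obtain ⟨l, hl⟩ := Infinite.exists_notMem_finset h.keys
  exact ⟨l, fun h => hl (Finmap.mem_keys.2 h)⟩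

theorem halts_eta {K : List Frame} {V W : Tm} {h : Heap} {ℓ : ℕ} (hV : V.IsValue)
    (hW : W.IsValue) (hl : h.lookup ℓ = some V) (H : Halts (.appR V :: K) W h) :
    Halts (.appR (.lam (.app (.deref (.loc ℓ)) (.var 0))) :: K) W h :=
  .beta hW (.app (.deref (.load hl (.appL hV H))))

/-- The runs agree step by step except when `V` is applied. There the expansion makes an extra call,
fetches `V` from `ℓ`, and then performs the same application; `ℓ` still holds `V` since no related
program can write to it. -/
theorem Halts.eta {V : Tm} (hI : Invariant V) {ℓ : ℕ} {K : List Frame} {M : Tm} {h : Heap}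
    (H : Halts K M h) : ∀ {P : ℕ → ℕ → Prop} {K' : List Frame} {M' : Tm} {h' : Heap},
      StackEta V ℓ P K K' → HeapEta V ℓ P h h' → Eta V ℓ P M M' → Halts K' M' h' := by
  induction H with
  | done hV =>
    intro P K' M' h' hK hh hM
    cases hK
    exact .done ((hM.isValue_iff hh.isValue).1 hV)
  | app _ ih =>
    intro P K' M' h' hK hh hM
    cases hM with
    | eta e => exact absurd (e ▸ hh.isValue) nofun
    | app h₁ h₂ => exact .app (ih (.cons (.appL h₂) hK) hh h₁)
  | arith _ ih =>
    intro P K' M' h' hK hh hM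
    cases hM with
    | eta e => exact absurd (e ▸ hh.isValue) nofun
    | arith h₁ h₂ => exact .arith (ih (.cons (.arithL h₂) hK) hh h₁)
  | ite _ ih =>
    intro P K' M' h' hK hh hM
    cases hM with
    | eta e => exact absurd (e ▸ hh.isValue) nofun
    | ite h₁ h₂ h₃ => exact .ite (ih (.cons (.ite h₂ h₃) hK) hh h₁)
  | ref _ ih =>
    intro P K' M' h' hK hh hM
    cases hM with
    | eta e => exact absurd (e ▸ hh.isValue) nofun
    | ref h₁ => exact .ref (ih (.cons .ref hK) hh h₁)
  | deref _ ih =>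
    intro P K' M' h' hK hh hM
    cases hM with
    | eta e => exact absurd (e ▸ hh.isValue) nofun
    | deref h₁ => exact .deref (ih (.cons .deref hK) hh h₁)
  | assign _ ih =>
    intro P K' M' h' hK hh hM
    cases hM with
    | eta e => exact absurd (e ▸ hh.isValue) nofun
    | assign h₁ h₂ => exact .assign (ih (.cons (.assignL h₂) hK) hh h₁)
  | letbox _ ih =>
    intro P K' M' h' hK hh hM
    cases hM with
    | eta e => exact absurd (e ▸ hh.isValue) nofun
    | letbox h₁ h₂ => exact .letbox (ih (.cons (.letbox h₂) hK) hh h₁)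
  | appL hV _ ih =>
    intro P K' M' h' hK hh hM
    have hV' := (hM.isValue_iff hh.isValue).1 hV
    cases hK with
    | cons hF hK =>
      cases hF with
      | appL hN => exact .appL hV' (ih (.cons (.appR hV hM) hK) hh hN)
  | arithL hV _ ih =>
    intro P K' M' h' hK hh hM
    have hV' := (hM.isValue_iff hh.isValue).1 hV
    cases hK with
    | cons hF hK =>
      cases hF with
      | arithL hN => exact .arithL hV' (ih (.cons (.arithR hM) hK) hh hN)
  | assignL hV _ ih =>
    intro P K' M' h' hK hh hM
    have hV' := (hM.isValue_iff hh.isValue).1 hV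
    cases hK with
    | cons hF hK =>
      cases hF with
      | assignL hN => exact .assignL hV' (ih (.cons (.assignR hM) hK) hh hN)
  | beta hV _ ih =>
    intro P K' M' h' hK hh hM
    have hV' := (hM.isValue_iff hh.isValue).1 hV
    cases hK with
    | cons hF hK =>
      cases hF with
      | appR _ hN =>
        cases hN with
        | lam hN => exact .beta hV' (ih hK hh (hN.lsubst hI (hM.scons .var)))
        | eta e =>
          obtain ⟨N, rfl | rfl, hN⟩ := hh.body
          · cases e
            -- After the detour the right machine applies `V` itself, whose body is related to
            -- itself by `hh.body`.
            exact halts_eta (.lam _) hV' hh.target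
              (.beta hV' (ih hK hh (hN.lsubst hI (hM.scons .var))))
          · cases e
  | recfn hV _ ih =>
    intro P K' M' h' hK hh hM
    have hV' := (hM.isValue_iff hh.isValue).1 hV
    cases hK with
    | cons hF hK =>
      cases hF with
      | appR _ hN =>
        cases hN with
        | recfn hN =>
          exact .recfn hV' (ih hK hh (hN.lsubst hI (hM.scons ((Eta.recfn hN).scons .var))))
        | eta e =>
          obtain ⟨N, rfl | rfl, hN⟩ := hh.body
          · cases e
          · cases e
            exact halts_eta (.recfn _) hV' hh.target
              (.recfn hV' (ih hK hh (hN.lsubst hI (hM.scons ((Eta.recfn hN).scons .var)))))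
  | arithR _ ih =>
    intro P K' M' h' hK hh hM
    cases hM with
    | eta e => obtain ⟨N, rfl | rfl, -⟩ := hh.body <;> cases e
    | num n =>
      cases hK with
      | cons hF hK =>
        cases hF with
        | arithR hN =>
          cases hN with
          | eta e => obtain ⟨N, rfl | rfl, -⟩ := hh.body <;> cases e
          | num m => exact .arithR (ih hK hh (.num _))
  | iteTrue hn _ ih =>
    intro P K' M' h' hK hh hM
    cases hM with
    | eta e => obtain ⟨N, rfl | rfl, -⟩ := hh.body <;> cases e
    | num n =>
      cases hK with
      | cons hF hK =>
        cases hF with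
        | ite h₁ h₂ => exact .iteTrue hn (ih hK hh h₁)
  | iteFalse _ ih =>
    intro P K' M' h' hK hh hM
    cases hM with
    | eta e => obtain ⟨N, rfl | rfl, -⟩ := hh.body <;> cases e
    | num n =>
      cases hK with
      | cons hF hK =>
        cases hF with
        | ite h₁ h₂ => exact .iteFalse (ih hK hh h₂)
  | alloc hV hl _ ih =>
    intro P K' M' h' hK hh hM
    have hV' := (hM.isValue_iff hh.isValue).1 hV
    obtain ⟨l', hl'⟩ := exists_notMem_heap h'
    cases hK with
    | cons hF hK =>
      cases hF with
      | ref =>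
        exact .alloc hV' hl' (ih (StackEta.mono (fun _ _ => Or.inl) hK) (hh.alloc hl hl' hM)
          (.loc (.inr ⟨rfl, rfl⟩)))
  | load hl _ ih =>
    intro P K' M' h' hK hh hM
    cases hM with
    | eta e => obtain ⟨N, rfl | rfl, -⟩ := hh.body <;> cases e
    | loc hP =>
      obtain ⟨W, W', e, e', hW⟩ := hh.entry _ _ hP
      obtain rfl := Option.some.inj (hl.symm.trans e)
      cases hK with
      | cons hF hK =>
        cases hF with
        | deref => exact .load e' (ih hK hh hW)
  | assignR hV hl _ ih =>
    intro P K' M' h' hK hh hM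
    have hV' := (hM.isValue_iff hh.isValue).1 hV
    cases hK with
    | cons hF hK =>
      cases hF with
      | assignR hN =>
        cases hN with
        | eta e => obtain ⟨N, rfl | rfl, -⟩ := hh.body <;> cases e
        | loc hP =>
          obtain ⟨W, W', e, e', hW⟩ := hh.entry _ _ hP
          exact .assignR hV' (mem_of_lookup e') (ih hK (hh.update hP hM) .unit)
  | unbox _ ih =>
    intro P K' M' h' hK hh hM
    cases hM with
    | eta e => obtain ⟨N, rfl | rfl, -⟩ := hh.body <;> cases e
    | box hM =>
      cases hK with
      | cons hF hK =>
        cases hF with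
        | letbox hN => exact .unbox (ih hK hh (hN.gsubst_gcons hI hM))

/-- Configurations with `V` and configurations with its expansion, including the states which
the machine passes through when the expansion of `V` is applied. -/
inductive ConfigEta (V : Tm) (ℓ : ℕ) (P : ℕ → ℕ → Prop) :
    List Frame → Tm → List Frame → Tm → Prop
  | main {K K' : List Frame} {M M' : Tm} : StackEta V ℓ P K K' → Eta V ℓ P M M' →
      ConfigEta V ℓ P K M K' M'
  | app {K K' : List Frame} {W W' : Tm} : StackEta V ℓ P K K' → Eta V ℓ P W W' →
      ConfigEta V ℓ P (.appR V :: K) W K' (.app (.deref (.loc ℓ)) W')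
  | deref {K K' : List Frame} {W W' : Tm} : StackEta V ℓ P K K' → Eta V ℓ P W W' →
      ConfigEta V ℓ P (.appR V :: K) W (.appL W' :: K') (.deref (.loc ℓ))
  | load {K K' : List Frame} {W W' : Tm} : StackEta V ℓ P K K' → Eta V ℓ P W W' →
      ConfigEta V ℓ P (.appR V :: K) W (.deref :: .appL W' :: K') (.loc ℓ)

/-- The induction now follows the run that contains the detour. `ConfigEta` names its intermediate
states, during which the other machine waits with `V` about to be applied to its argument. -/
theorem Halts.of_eta {V : Tm} (hI : Invariant V) {ℓ : ℕ} {K' : List Frame} {M' : Tm} {h' : Heap}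
    (H : Halts K' M' h') : ∀ {P : ℕ → ℕ → Prop} {K : List Frame} {M : Tm} {h : Heap},
      ConfigEta V ℓ P K M K' M' → HeapEta V ℓ P h h' → Halts K M h := by
  induction H with
  | done hV =>
    intro P K M h hC hh
    cases hC with
    | main hK hM =>
      cases hK
      exact .done ((hM.isValue_iff hh.isValue).2 hV)
    | app => cases hV
  | app _ ih =>
    intro P K M h hC hh
    cases hC with
    | main hK hM =>
      cases hM with
      | app h₁ h₂ => exact .app (ih (.main (.cons (.appL h₂) hK) h₁) hh)
    | app hK hW => exact ih (.deref hK hW) hh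
  | arith _ ih =>
    intro P K M h hC hh
    cases hC with
    | main hK hM =>
      cases hM with
      | arith h₁ h₂ => exact .arith (ih (.main (.cons (.arithL h₂) hK) h₁) hh)
  | ite _ ih =>
    intro P K M h hC hh
    cases hC with
    | main hK hM =>
      cases hM with
      | ite h₁ h₂ h₃ => exact .ite (ih (.main (.cons (.ite h₂ h₃) hK) h₁) hh)
  | ref _ ih =>
    intro P K M h hC hh
    cases hC with
    | main hK hM =>
      cases hM with
      | ref h₁ => exact .ref (ih (.main (.cons .ref hK) h₁) hh)
  | deref _ ih =>
    intro P K M h hC hh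
    cases hC with
    | main hK hM =>
      cases hM with
      | deref h₁ => exact .deref (ih (.main (.cons .deref hK) h₁) hh)
    | deref hK hW => exact ih (.load hK hW) hh
  | assign _ ih =>
    intro P K M h hC hh
    cases hC with
    | main hK hM =>
      cases hM with
      | assign h₁ h₂ => exact .assign (ih (.main (.cons (.assignL h₂) hK) h₁) hh)
  | letbox _ ih =>
    intro P K M h hC hh
    cases hC with
    | main hK hM =>
      cases hM with
      | letbox h₁ h₂ => exact .letbox (ih (.main (.cons (.letbox h₂) hK) h₁) hh)
  | appL hV _ ih =>
    intro P K M h hC hh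
    cases hC with
    | main hK hM =>
      have hV' := (hM.isValue_iff hh.isValue).2 hV
      cases hK with
      | cons hF hK =>
        cases hF with
        | appL hN => exact .appL hV' (ih (.main (.cons (.appR hV' hM) hK) hN) hh)
    | _ => cases hV
  | arithL hV _ ih =>
    intro P K M h hC hh
    cases hC with
    | main hK hM =>
      have hV' := (hM.isValue_iff hh.isValue).2 hV
      cases hK with
      | cons hF hK =>
        cases hF with
        | arithL hN => exact .arithL hV' (ih (.main (.cons (.arithR hM) hK) hN) hh)
    | _ => cases hV
  | assignL hV _ ih =>
    intro P K M h hC hh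
    cases hC with
    | main hK hM =>
      have hV' := (hM.isValue_iff hh.isValue).2 hV
      cases hK with
      | cons hF hK =>
        cases hF with
        | assignL hN => exact .assignL hV' (ih (.main (.cons (.assignR hM) hK) hN) hh)
    | _ => cases hV
  | beta hV _ ih =>
    intro P K M h hC hh
    cases hC with
    | main hK hM =>
      have hV' := (hM.isValue_iff hh.isValue).2 hV
      cases hK with
      | cons hF hK =>
        cases hF with
        | appR _ hN =>
          cases hN with
          | lam hN => exact .beta hV' (ih (.main hK (hN.lsubst hI (hM.scons .var))) hh)
          | eta e =>
            subst e
            -- The expansion has been called: the left machine does not move.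
            exact ih (.app hK hM) hh
    | _ => cases hV
  | recfn hV _ ih =>
    intro P K M h hC hh
    cases hC with
    | main hK hM =>
      have hV' := (hM.isValue_iff hh.isValue).2 hV
      cases hK with
      | cons hF hK =>
        cases hF with
        | appR _ hN =>
          cases hN with
          | recfn hN =>
            exact .recfn hV'
              (ih (.main hK (hN.lsubst hI (hM.scons ((Eta.recfn hN).scons .var)))) hh)
    | _ => cases hV
  | arithR _ ih =>
    intro P K M h hC hh
    cases hC with
    | main hK hM =>
      cases hM with
      | num n =>
        cases hK with
        | cons hF hK =>
          cases hF with
          | arithR hN =>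
            cases hN with
            | num m => exact .arithR (ih (.main hK (.num _)) hh)
  | iteTrue hn _ ih =>
    intro P K M h hC hh
    cases hC with
    | main hK hM =>
      cases hM with
      | num n =>
        cases hK with
        | cons hF hK =>
          cases hF with
          | ite h₁ h₂ => exact .iteTrue hn (ih (.main hK h₁) hh)
  | iteFalse _ ih =>
    intro P K M h hC hh
    cases hC with
    | main hK hM =>
      cases hM with
      | num n =>
        cases hK with
        | cons hF hK =>
          cases hF with
          | ite h₁ h₂ => exact .iteFalse (ih (.main hK h₂) hh)
  | alloc hV hl' _ ih =>
    intro P K M h hC hh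
    cases hC with
    | main hK hM =>
      have hV' := (hM.isValue_iff hh.isValue).2 hV
      obtain ⟨l, hl⟩ := exists_notMem_heap h
      cases hK with
      | cons hF hK =>
        cases hF with
        | ref =>
          exact .alloc hV' hl (ih (.main (StackEta.mono (fun _ _ => Or.inl) hK)
            (.loc (.inr ⟨rfl, rfl⟩))) (hh.alloc hl hl' hM))
    | _ => cases hV
  | load hl _ ih =>
    intro P K M h hC hh
    cases hC with
    | main hK hM =>
      cases hM with
      | loc hP =>
        obtain ⟨W, W', e, e', hW⟩ := hh.entry _ _ hP
        obtain rfl := Option.some.inj (hl.symm.trans e')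
        cases hK with
        | cons hF hK =>
          cases hF with
          | deref => exact .load e (ih (.main hK hW) hh)
    | load hK hW =>
      obtain rfl := Option.some.inj (hl.symm.trans hh.target)
      -- The detour ends with `V` loaded and in focus under the frame holding the argument. The left
      -- configuration is rewound to that form, where `V` is related to itself.
      exact halts_appR hh.isValue (ih (.main (.cons (.appL hW) hK) hh.self) hh)
  | assignR hV hl _ ih =>
    intro P K M h hC hh
    cases hC with
    | main hK hM =>
      have hV' := (hM.isValue_iff hh.isValue).2 hV
      cases hK with
      | cons hF hK =>
        cases hF with
        | assignR hN =>
          cases hN with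
          | loc hP =>
            obtain ⟨W, W', e, e', hW⟩ := hh.entry _ _ hP
            exact .assignR hV' (mem_of_lookup e) (ih (.main hK .unit) (hh.update hP hM))
    | _ => cases hV
  | unbox _ ih =>
    intro P K M h hC hh
    cases hC with
    | main hK hM =>
      cases hM with
      | box hM =>
        cases hK with
        | cons hF hK =>
          cases hF with
          | letbox hN => exact .unbox (ih (.main hK (hN.gsubst_gcons hI hM)) hh)

/-! ### Contextual approximation is contained in approximation of closed instances of use -/

theorem halts_app_lam {K : List Frame} {M V : Tm} {h : Heap} (hV : V.IsValue) :
    Halts K (.app (.lam M) V) h ↔ Halts K (M.lsubst (scons V var)) h := by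
  refine (halts_frame (F := .appR (.lam M)) (.lam M) K V h).trans
    ⟨fun H => ?_, fun H => .beta hV H⟩
  cases H with
  | beta _ H => exact H
  | _ => cases hV

theorem halts_letbox_box {K : List Frame} {M N : Tm} {h : Heap} :
    Halts K (.letbox (.box M) N) h ↔ Halts K (N.gsubst (gcons M Sum.inl)) h := by
  refine (halts_frame (F := .letbox N) trivial K (.box M) h).trans
    ⟨fun H => ?_, fun H => .unbox H⟩
  cases H with
  | unbox H => exact H

theorem Incl.refl {α : Type} (Δ : List α) : Incl id Δ Δ :=
  ⟨fun _ _ h => h, fun _ _ _ _ h => h⟩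

theorem HasTy.weaken_nil {S : SCtx} {Ψ : GCtx} {Γ : LCtx} {i : Layer} {M : Tm} {T : Ty}
    (h : HasTy S [] [] i M T) (hΨ : GCtxWF Ψ) (hΓ : LCtxWF i Γ) : HasTy S Ψ Γ i M T := by
  have := h.rename (ρ := id) (ξ := id) RenTy.of_nil RenTy.of_nil hΓ hΨ
  rwa [rename_id] at this

theorem HasTy.weaken_global {S : SCtx} {Ψ : GCtx} {Γ : LCtx} {i : Layer} {M : Tm} {T : Ty}
    (h : HasTy S [] Γ i M T) (hΨ : GCtxWF Ψ) : HasTy S Ψ Γ i M T := by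
  have := h.rename (ρ := id) (ξ := id) RenTy.refl RenTy.of_nil h.lctxWF hΨ
  rwa [rename_id] at this

/-! ### Contexts that carry out closing substitutions -/

section Closing

variable {S : SCtx} {Ψ Ψ₀ : GCtx} {Γ : LCtx} {i : Layer} {T T₀ : Ty}

theorem CtxHasTy.plug_hasTy {Γ₀ : LCtx} {i₀ : Layer} {C : Ctx} {M : Tm}
    (hC : CtxHasTy S Ψ Γ i T C Ψ₀ Γ₀ i₀ T₀) (hM : HasTy S Ψ Γ i M T) :
    HasTy S Ψ₀ Γ₀ i₀ (C.plug M) T₀ :=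
  (hC.how (Ciu.refl hM)).hasTy_right

/-- The context is wrapped in one `letbox u = box N` for each global variable. The code in `σ` has
no free global variables, so it weakens to the remaining context and is unchanged by the outer
substitutions; firing the redexes composes them to `σ`. -/
theorem exists_ctx_gsubst (σ : GSub) (hσ : GSubTy S [] σ Ψ₀) (hΨ : GCtxWF Ψ₀) (C : Ctx)
    (hC : CtxHasTy S Ψ Γ i T C Ψ₀ [] Layer.one T₀) :
    ∃ B, CtxHasTy S Ψ Γ i T B [] [] Layer.one T₀ ∧ ∀ M, HasTy S Ψ Γ i M T → ∀ K h,
      (Halts K (B.plug M) h ↔ Halts K ((C.plug M).gsubst σ) h) := by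
  induction Ψ₀ generalizing σ C with
  | nil =>
    refine ⟨C, hC, fun M hM K h => ?_⟩
    rw [(hC.plug_hasTy hM).gsubst_closed]
  | cons p Ψ₁ ih =>
    obtain ⟨Γ₁, T₁⟩ := p
    have hσ' : GSubTy S [] (fun u => σ (u + 1)) Ψ₁ := fun u Γ T hu =>
      hσ (u + 1) Γ T (by simpa using hu)
    rcases hσ 0 Γ₁ T₁ (by simp) with ⟨v, _, hv⟩ | ⟨N, e, hN⟩
    · simp at hv
    · have hN₁ : HasTy S Ψ₁ [] Layer.one (.box N) (.box Γ₁ T₁) :=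
        .box LCtxWF.nil (hN.weaken_global hΨ.tail)
      obtain ⟨B, hB, H⟩ := ih _ hσ' hΨ.tail (.letboxR (.box N) C) (.letboxR hN₁ hC)
      refine ⟨B, hB, fun M hM K h => (H M hM K h).trans ?_⟩
      have hw : GCtxWF [(Γ₁, T₁)] := GCtxWF.nil.cons hN.lctxWF hN.tyWF
      have hσ₁ : GSubTy S [] (gcons N Sum.inl) [(Γ₁, T₁)] := GSubTy.cons hN GSubTy.nil
      have hs : gcons N (fun u => σ (u + 1)) = σ := by
        funext u
        cases u
        exacts [e.symm, rfl]
      -- The outer letboxes act on `C` as `upGSub` of the tail of `σ`; firing the inner one then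
      -- adds `N`, which gives back `σ`.
      simp only [Ctx.plug, Tm.gsubst]
      rw [hN.gsubst_closed, halts_letbox_box,
        (hC.plug_hasTy hM).gsubst_gsubst (hσ'.up hw) hw hσ₁ GCtxWF.nil, gcomp_gcons, hs]

/-- One redex `(λx. C) V` is added for each local variable, and the letboxes are placed outside all
of them. The values are closed, so the global substitution passes over them. -/
theorem exists_ctx_subst {Γ₀ : LCtx} (σ : GSub) (hσ : GSubTy S [] σ Ψ₀) (τ : ℕ → Tm)
    (hτ : LSubTy S [] [] Layer.one τ Γ₀) (hΨ : GCtxWF Ψ₀) (hΓ : LCtxWF Layer.one Γ₀) (C : Ctx)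
    (hC : CtxHasTy S Ψ Γ i T C Ψ₀ Γ₀ Layer.one T₀) :
    ∃ B, CtxHasTy S Ψ Γ i T B [] [] Layer.one T₀ ∧ ∀ M, HasTy S Ψ Γ i M T → ∀ K h,
      (Halts K (B.plug M) h ↔ Halts K (((C.plug M).gsubst σ).lsubst τ) h) := by
  induction Γ₀ generalizing τ C with
  | nil =>
    obtain ⟨B, hB, H⟩ := exists_ctx_gsubst σ hσ hΨ C hC
    refine ⟨B, hB, fun M hM K h => (H M hM K h).trans ?_⟩
    rw [((hC.plug_hasTy hM).gsubst hσ GCtxWF.nil).lsubst_closed]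
  | cons A Γ₁ ih =>
    have hτ' : LSubTy S [] [] Layer.one (fun x => τ (x + 1)) Γ₁ := fun x T hx =>
      hτ (x + 1) T (by simpa using hx)
    obtain ⟨hV, hA⟩ := hτ 0 A (by simp)
    obtain ⟨B, hB, H⟩ := ih _ hτ' hΓ.tail (.appL (.lam C) (τ 0))
      (.appL (.lam hC) (hA.weaken_nil hΨ hΓ.tail))
    refine ⟨B, hB, fun M hM K h => (H M hM K h).trans ?_⟩
    have hs : scons (τ 0) (fun x => τ (x + 1)) = τ := by
      funext x
      cases x <;> rfl
    simp only [Ctx.plug, Tm.gsubst, Tm.lsubst]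
    rw [hA.gsubst_closed, hA.lsubst_closed, halts_app_lam hV, lsubst_upL_scons, hs]

end Closing

/-- The context obtained by placing a context in the hole of an evaluation context. -/
def ECtx.comp : ECtx → Ctx → Ctx
  | hole, B => B
  | appL K N, B => .appL (K.comp B) N
  | appR V _ K, B => .appR V (K.comp B)
  | arithL o K N, B => .arithL o (K.comp B) N
  | arithR o V _ K, B => .arithR o V (K.comp B)
  | ite K N₁ N₂, B => .iteC (K.comp B) N₁ N₂
  | ref K, B => .ref (K.comp B)
  | deref K, B => .deref (K.comp B)
  | assignL K N, B => .assignL (K.comp B) N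
  | assignR V _ K, B => .assignR V (K.comp B)
  | letbox K N, B => .letboxL (K.comp B) N

theorem ECtx.plug_comp (K : ECtx) (B : Ctx) (M : Tm) : (K.comp B).plug M = K.fill (B.plug M) := by
  induction K <;> simp_all [comp, Ctx.plug, fill]

/-- `K` has a hole of layer `i`, whereas the closing context has layer one, so all side terms of `K`
are lifted. -/
theorem ECtx.comp_hasTy {S : SCtx} {Ψ : GCtx} {Γ : LCtx} {i : Layer} {T : Ty} {B : Ctx}
    (hB : CtxHasTy S Ψ Γ i T B [] [] Layer.one T) (K : ECtx) : ∀ {j : Layer} {T' : Ty},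
    CtxHasTy S [] [] i T K.toCtx [] [] j T' →
    CtxHasTy S Ψ Γ i T (K.comp B) [] [] Layer.one T' := by
  induction K with
  | hole => intro j T' hK; cases hK; exact hB
  | appL K N ih => intro j T' hK; cases hK with | appL h hN => exact .appL (ih h) hN.lift
  | appR V _ K ih => intro j T' hK; cases hK with | appR hN h => exact .appR hN.lift (ih h)
  | arithL o K N ih =>
    intro j T' hK; cases hK with | arithL _ h hN => exact .arithL o (ih h) hN.lift
  | arithR o V _ K ih =>
    intro j T' hK; cases hK with | arithR _ hN h => exact .arithR o hN.lift (ih h)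
  | ite K N₁ N₂ ih =>
    intro j T' hK; cases hK with | iteC h h₁ h₂ => exact .iteC (ih h) h₁.lift h₂.lift
  | ref K ih => intro j T' hK; cases hK with | ref h => exact .ref (ih h)
  | deref K ih => intro j T' hK; cases hK with | deref h => exact .deref (ih h)
  | assignL K N ih =>
    intro j T' hK; cases hK with | assignL h hN => exact .assignL (ih h) hN.lift
  | assignR V _ K ih =>
    intro j T' hK; cases hK with | assignR hN h => exact .assignR hN.lift (ih h)
  | letbox K N ih => intro j T' hK; cases hK with | letboxL h hN => exact .letboxL (ih h) hN

theorem GSubstHasTy.gSubTy {S : SCtx} {Ψ : GCtx} {m : ℕ} {σ : Fin m → Tm}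
    (h : GSubstHasTy S [] σ Ψ) : GSubTy S [] (gofFin σ) Ψ := by
  intro u Γ T hu
  have hlt := lt_of_getElem? hu h.1
  exact .inr ⟨σ ⟨u, hlt⟩, by simp [gofFin, hlt], h.2 ⟨u, hlt⟩ Γ T hu⟩

theorem LSubstHasTy.lSubTy {S : SCtx} {Ψ : GCtx} {Γ Γ' : LCtx} {i : Layer} {n : ℕ}
    {δ : Fin n → Tm} (h : LSubstHasTy S Ψ Γ' i δ Γ) : LSubTy S Ψ Γ' i (ofFin δ) Γ :=
  LSubTy.ofFin h.1 h.2.1 h.2.2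

theorem CtxApprox.ciuApprox {S : SCtx} {Ψ : GCtx} {Γ : LCtx} {i : Layer} {T : Ty} {M N : Tm}
    (hM : HasTy S Ψ Γ i M T) (hN : HasTy S Ψ Γ i N T) (H : CtxApprox S Ψ Γ i T M N) :
    CIUApprox S Ψ Γ i T M N := by
  intro S' m n σ δ K i' T' h hS hσ hδ hK hh Hc
  have hw := hK.sctxWF
  have hM' := hM.mono_store hS hw
  have hN' := hN.mono_store hS hw
  obtain ⟨B, hB, HB⟩ := exists_ctx_subst (gofFin σ) hσ.gSubTy (ofFin δ) hδ.lSubTy.lift hM.gctxWF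
    hM.lctxWF.lift (.hole id id)
    (.hole hw hM.gctxWF hM.lctxWF.lift (Incl.refl Ψ) (Incl.refl Γ) (Layer.le_one i))
  have key : ∀ P, HasTy S' Ψ Γ i P T → (Converges ((K.comp B).plug P) h ↔
      Converges (K.fill ((P.gsubst (gofFin σ)).lsubst (ofFin δ))) h) := fun P hP => by
    rw [converges_iff_halts, converges_iff_halts, ECtx.plug_comp, halts_fill, halts_fill,
      HB P hP]
    simp only [Ctx.plug, rename_id]
  exact (key N hN').1 (H S' _ _ _ h hS (ECtx.comp_hasTy hB K hK) hh ((key M hM').2 Hc))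

/-! ### Approximation of closed instances of use is uniform in the layer -/

/-- Stacks list the innermost frame first while evaluation contexts are built from the outside, so
the context is accumulated in `E`. Its frames are typed at layer one although the hole keeps layer
`i`. -/
theorem exists_ectx {S : SCtx} {i : Layer} {T₀ : Ty} {K : List Frame} : ∀ {T : Ty} (E : ECtx),
    StackTy S K T → CtxHasTy S [] [] i T₀ E.toCtx [] [] Layer.one T →
    ∃ (E' : ECtx) (T' : Ty), CtxHasTy S [] [] i T₀ E'.toCtx [] [] Layer.one T' ∧
      ∀ M h, Halts K (E.fill M) h ↔ Halts [] (E'.fill M) h := by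
  induction K with
  | nil => exact fun {T} E _ hE => ⟨E, T, hE, fun _ _ => Iff.rfl⟩
  | cons F K ih =>
    intro T E hK hE
    have step : ∀ {T₁ : Ty} (E₁ : ECtx), StackTy S K T₁ →
        CtxHasTy S [] [] i T₀ E₁.toCtx [] [] Layer.one T₁ → F.Wf →
        (∀ M, E₁.fill M = F.fill (E.fill M)) →
        ∃ (E' : ECtx) (T' : Ty), CtxHasTy S [] [] i T₀ E'.toCtx [] [] Layer.one T' ∧
          ∀ M h, Halts (F :: K) (E.fill M) h ↔ Halts [] (E'.fill M) h := by
      intro T₁ E₁ hK₁ hE₁ hF e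
      obtain ⟨E', T', hE', H⟩ := ih E₁ hK₁ hE₁
      exact ⟨E', T', hE', fun M h => by rw [← halts_frame hF, ← e, H]⟩
    cases hK with
    | cons hF hK =>
      cases hF with
      | appL h => exact step (.appL E _) hK (.appL hE h) trivial fun _ => rfl
      | appR hV _ h => exact step (.appR _ hV E) hK (.appR h hE) hV fun _ => rfl
      | arithL h => exact step (.arithL _ E _) hK (.arithL _ hE h) trivial fun _ => rfl
      | arithR hV _ h => exact step (.arithR _ _ hV E) hK (.arithR _ h hE) hV fun _ => rfl
      | ite h₁ h₂ => exact step (.ite E _ _) hK (.iteC hE h₁ h₂) trivial fun _ => rfl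
      | ref => exact step (.ref E) hK (.ref hE) trivial fun _ => rfl
      | deref => exact step (.deref E) hK (.deref hE) trivial fun _ => rfl
      | assignL h => exact step (.assignL E _) hK (.assignL hE h) trivial fun _ => rfl
      | assignR hV _ h => exact step (.assignR _ hV E) hK (.assignR h hE) hV fun _ => rfl
      | letbox h => exact step (.letbox E _) hK (.letboxL hE h) trivial fun _ => rfl

/-- Approximation in all stacks, where the local substitution is typed at layer `j` up to the
position `c` and at layer `i` from there on. -/
def StackApprox (S : SCtx) (Ψ : GCtx) (Γ : LCtx) (i j : Layer) (c : ℕ) (T : Ty) (M N : Tm) :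
    Prop :=
  ∀ (S' : SCtx) (σ : GSub) (δ : Fin Γ.length → Tm) (K : List Frame) (h : Heap),
    SCtxSub S S' → SCtxWF S' → GSubTy S' [] σ Ψ → LSubstHasTy S' [] [] j δ Γ →
    (∀ k : Fin Γ.length, c ≤ k → HasTy S' [] [] i (δ k) Γ[k]) →
    StackTy S' K T → HeapHasTy S' [] [] h →
    Halts K ((M.gsubst σ).lsubst (ofFin δ)) h → Halts K ((N.gsubst σ).lsubst (ofFin δ)) h

/-! ### Trading layer-one functions for references -/

section StackApprox

variable {S : SCtx} {Ψ : GCtx} {Γ : LCtx} {i : Layer} {T : Ty} {M N : Tm}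

theorem CIUApprox.stackApprox (hM : HasTy S Ψ Γ i M T) (hN : HasTy S Ψ Γ i N T)
    (H : CIUApprox S Ψ Γ i T M N) {c : ℕ} : StackApprox S Ψ Γ i i c T M N := by
  intro S' σ δ K h hS hw hσ hδ _ hK hh Hc
  -- The value `unit` is never used: renaming entries would need a variable of the empty global
  -- context.
  let σ' : Fin Ψ.length → Tm := fun u => (σ u).elim (fun _ => Tm.unit) id
  have e : ∀ u Γ T, Ψ[u]? = some (Γ, T) →
      ∃ P, σ u = Sum.inr P ∧ HasTy S' [] Γ Layer.zero P T := by
    intro u Γ T hu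
    rcases hσ u Γ T hu with ⟨v, _, hv⟩ | h
    · simp at hv
    · exact h
  have hσ' : GSubstHasTy S' [] σ' Ψ := by
    refine ⟨rfl, fun u Γ T hu => ?_⟩
    obtain ⟨P, e, hP⟩ := e u Γ T hu
    simpa [σ', e] using hP
  have es : ∀ {P}, HasTy S Ψ Γ i P T → P.gsubst (gofFin σ') = P.gsubst σ := by
    intro P hP
    refine hP.gsubst_congr fun u p hu => ?_
    obtain ⟨Q, e, hQ⟩ := e u p.1 p.2 hu
    simp [gofFin, lt_of_getElem? hu rfl, σ', e]
  obtain ⟨E, T', hE, HE⟩ := exists_ectx (i := i) .hole hK (.hole hw GCtxWF.nil LCtxWF.nil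
    (Incl.refl []) (Incl.refl []) (Layer.le_one i))
  have := H S' _ _ σ' δ E _ T' h hS hσ' hδ hE hh
  rw [converges_iff_halts, converges_iff_halts, ← HE, ← HE, es hM, es hN] at this
  exact this Hc

/-- Numbers, unit and locations of a layer-zero type contain nothing of layer one, and boxes have no
layer-zero type. Only a function can hide layer-one computations, in its body. -/
theorem HasTy.zero_or_function {S : SCtx} {V : Tm} {T : Ty} (h : HasTy S [] [] Layer.one V T)
    (hV : V.IsValue) (hT : TyWF Layer.zero T) : HasTy S [] [] Layer.zero V T ∨
      ∃ A B, T = .arrow A B ∧ ∃ M Γ, (V = .lam M ∨ V = .recfn M) ∧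
        HasTy S [] Γ Layer.one M B := by
  cases h with
  | unit h₁ h₂ _ => exact .inl (.unit h₁ h₂ LCtxWF.nil)
  | num n h₁ h₂ _ => exact .inl (.num n h₁ h₂ LCtxWF.nil)
  | loc h₁ h₂ _ h _ =>
    cases hT with
    | ref hT => exact .inl (.loc h₁ h₂ LCtxWF.nil h hT)
  | lam h => exact .inr ⟨_, _, rfl, _, _, .inl rfl, h⟩
  | recfn h => exact .inr ⟨_, _, rfl, _, _, .inr rfl, h⟩
  | box => cases hT
  | var _ _ _ h => simp at h
  | _ => cases hV

/-- Position `c` is freed from its layer constraint. If its value is a genuine layer-one function,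
it is stored at a fresh location and replaced by the layer-zero expansion. `Halts.eta` transports
the run of `M` to the new substitution, the hypothesis passes to `N`, and `Halts.of_eta` transports
back. -/
theorem StackApprox.succ (hM : HasTy S Ψ Γ Layer.zero M T) (hN : HasTy S Ψ Γ Layer.zero N T)
    {c : ℕ} (H : StackApprox S Ψ Γ Layer.zero Layer.one c T M N) :
    StackApprox S Ψ Γ Layer.zero Layer.one (c + 1) T M N := by
  intro S' σ δ K h hS hw hσ hδ hc hK hh Hc
  by_cases hlt : c < Γ.length
  swap
  · exact H S' σ δ K h hS hw hσ hδ (fun k hk => absurd k.2 (by omega)) hK hh Hc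
  let j : Fin Γ.length := ⟨c, hlt⟩
  have hget : Γ[(j : ℕ)]? = some Γ[j] := List.getElem?_eq_getElem hlt
  have hj := hδ.2.2 j Γ[j] hget
  rcases hj.zero_or_function (hδ.2.1 j) (hM.lctxWF.get hget) with h₀ | ⟨A, B, e, Q, Γ', hQ, hQty⟩
  · refine H S' σ δ K h hS hw hσ hδ (fun k hk => ?_) hK hh Hc
    rcases Nat.eq_or_lt_of_le hk with hk | hk
    · obtain rfl : j = k := Fin.ext hk
      exact h₀
    · exact hc k hk
  · obtain ⟨ℓ, hℓ⟩ := exists_notMem_heap h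
    have hℓS : ℓ ∉ S' := fun hm => hℓ ((hh.1 ℓ).1 hm)
    have hTj : TyWF Layer.zero Γ[j] := hM.lctxWF.get hget
    have hs : SCtxSub S' (S'.insert ℓ Γ[j]) := SCtxSub.insert hℓS _
    have hw' : SCtxWF (S'.insert ℓ Γ[j]) := hw.insert ℓ hTj.lift
    have hI : Invariant (δ j) := hj.invariant
    have hV := hδ.2.1 j
    have hH : HeapEta (δ j) ℓ (fun l l' => l = l' ∧ l ∈ S') h (h.insert ℓ (δ j)) := by
      refine ⟨?_, ?_, ?_, ?_, Finmap.lookup_insert _, Q, hQ, .refl hQty⟩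
      · rintro l _ ⟨rfl, hl⟩
        obtain ⟨U, hU⟩ := exists_lookup_of_mem hl
        obtain ⟨W, hW⟩ := exists_lookup_of_mem ((hh.1 l).1 hl)
        have hne : l ≠ ℓ := by
          rintro rfl
          exact hℓS hl
        exact ⟨W, W, hW, by rw [Finmap.lookup_insert_of_ne _ hne, hW],
          .refl (hh.2 l U W hU hW).2⟩
      · rintro l _ _ ⟨rfl, _⟩ ⟨rfl, _⟩
        rfl
      · rintro _ _ l ⟨rfl, _⟩ ⟨rfl, _⟩
        rfl
      · rintro l _ ⟨rfl, hl⟩ rfl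
        exact hℓS hl
    let η : Tm := .lam (.app (.deref (.loc ℓ)) (.var 0))
    have hη : HasTy (S'.insert ℓ Γ[j]) [] [] Layer.zero η Γ[j] := by
      have hL : Finmap.lookup ℓ (S'.insert ℓ Γ[j]) = some (.arrow A B) := by
        rw [Finmap.lookup_insert, e]
      have hAB : TyWF Layer.zero (.arrow A B) := e ▸ hTj
      have hA : LCtxWF Layer.zero [A] := LCtxWF.nil.cons (by cases hAB; assumption)
      -- The rule for locations at layer zero looks only at the declared type `A → B`, which is of
      -- layer zero; the stored function itself need not be.
      exact (congrArg (HasTy (S'.insert ℓ Γ[j]) [] [] Layer.zero η) e).mpr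
        (.lam (.app (.deref (.loc hw' GCtxWF.nil hA hL hAB))
          (.var hw' GCtxWF.nil hA (x := 0) rfl)))
    let δ' : Fin Γ.length → Tm := Function.update δ j η
    have hδ' : ∀ k, Eta (δ j) ℓ (fun l l' => l = l' ∧ l ∈ S') (δ k) (δ' k) := by
      intro k
      by_cases hk : k = j
      · subst hk
        simp only [δ', Function.update_self]
        exact .eta rfl
      · simp only [δ', Function.update_of_ne hk]
        exact .refl (hδ.2.2 k Γ[k] (List.getElem?_eq_getElem k.2))
    have hK' : StackEta (δ j) ℓ (fun l l' => l = l' ∧ l ∈ S') K K := StackEta.refl hK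
    have hE : ∀ {P}, HasTy S Ψ Γ Layer.zero P T →
        Eta (δ j) ℓ (fun l l' => l = l' ∧ l ∈ S') ((P.gsubst σ).lsubst (ofFin δ))
          ((P.gsubst σ).lsubst (ofFin δ')) := fun hP =>
      (Eta.refl ((hP.mono_store hS hw).gsubst hσ GCtxWF.nil)).lsubst hI (Eta.ofFin hδ')
    refine Halts.of_eta hI ?_ (.main hK' (hE hN)) hH
    -- The test for the hypothesis extends the store by `ℓ`, holding the original function, and
    -- changes the substitution at `j` alone.
    refine H (S'.insert ℓ Γ[j]) σ δ' K (h.insert ℓ (δ j)) (hS.trans hs) hw'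
      (hσ.mono_store hs hw') ⟨rfl, fun k => ?_, fun k U hU => ?_⟩ (fun k hk => ?_)
      (StackRel.mono (fun _ _ _ _ h => h.mono_store hs hw') hK)
      ((HowHeap.refl hh).alloc hℓ hV hV (.refl hj)).right (Hc.eta hI hK' hH (hE hM))
    · by_cases hk : k = j
      · subst hk
        simp only [δ', Function.update_self]
        exact .lam _
      · simp only [δ', Function.update_of_ne hk]
        exact hδ.2.1 k
    · by_cases hk : k = j
      · subst hk
        obtain rfl := Option.some.inj (hget.symm.trans hU)
        simp only [δ', Function.update_self]
        exact hη.lift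
      · simp only [δ', Function.update_of_ne hk]
        exact (hδ.2.2 k U hU).mono_store hs hw'
    · by_cases hk' : k = j
      · subst hk'
        simp only [δ', Function.update_self]
        exact hη
      · simp only [δ', Function.update_of_ne hk']
        refine (hc k ?_).mono_store hs hw'
        have : (k : ℕ) ≠ c := fun h => hk' (Fin.ext h)
        omega

/-- Induction on the number of unconstrained positions: with none, all entries are of layer zero and
the hypothesis applies directly; with all of them, no constraint is left. -/
theorem CIUApprox.stackApprox_one (hM : HasTy S Ψ Γ i M T) (hN : HasTy S Ψ Γ i N T)
    (H : CIUApprox S Ψ Γ i T M N) : StackApprox S Ψ Γ i Layer.one Γ.length T M N := by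
  cases i with
  | one => exact H.stackApprox hM hN
  | zero =>
    have key : ∀ c, StackApprox S Ψ Γ Layer.zero Layer.one c T M N := by
      intro c
      induction c with
      | zero =>
        intro S' σ δ K h hS hw hσ hδ hc hK hh
        refine H.stackApprox (c := 0) hM hN S' σ δ K h hS hw hσ ⟨hδ.1, hδ.2.1, fun k U hU => ?_⟩
          hc hK hh
        obtain rfl := Option.some.inj ((List.getElem?_eq_getElem k.2).symm.trans hU)
        exact hc k (Nat.zero_le _)
      | succ c ih => exact ih.succ hM hN
    exact key _

/-- What remains is to pass from a total substitution to its restriction to `Γ`, which typed terms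
cannot distinguish. -/
theorem CIUApprox.ciu (hM : HasTy S Ψ Γ i M T) (hN : HasTy S Ψ Γ i N T)
    (H : CIUApprox S Ψ Γ i T M N) : Ciu S Ψ Γ i M N T := by
  refine ⟨hM, hN, fun S' σ τ K h hS hw hσ hτ hK hh Hc => ?_⟩
  have e : ∀ {P}, HasTy S Ψ Γ i P T → (P.gsubst σ).lsubst τ =
      (P.gsubst σ).lsubst (ofFin fun k : Fin Γ.length => τ k) := fun hP =>
    ((hP.mono_store hS hw).gsubst hσ GCtxWF.nil).lsubst_congr fun x T hx =>
      (ofFin_of_lt (fun k : Fin Γ.length => τ k) (lt_of_getElem? hx rfl)).symm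
  rw [e hM] at Hc
  rw [e hN]
  exact H.stackApprox_one hM hN S' σ _ K h hS hw hσ
    ⟨rfl, fun k => (hτ k _ (List.getElem?_eq_getElem k.2)).1, fun k U hU => (hτ k U hU).2⟩
    (fun k hk => absurd k.2 (by omega)) hK hh Hc

end StackApprox

end LMML

theorem mainTheorem2 (S : LMML.SCtx) (Ψ : LMML.GCtx) (Γ : LMML.LCtx) (i : LMML.Layer)
    (T : LMML.Ty) (M₁ M₂ : LMML.Tm)
    (hM₁ : LMML.HasTy S Ψ Γ i M₁ T) (hM₂ : LMML.HasTy S Ψ Γ i M₂ T) :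
    LMML.CtxApprox S Ψ Γ i T M₁ M₂ ↔ LMML.CIUApprox S Ψ Γ i T M₁ M₂ :=
  ⟨LMML.CtxApprox.ciuApprox hM₁ hM₂, fun H => (LMML.CIUApprox.ciu hM₁ hM₂ H).ctxApprox⟩
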